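/- All graphs are finite and simple. Let $\Gamma$ be a graph and $G\le\mathrm{Aut}(\Gamma)$; for vertices $u,v$ write $G_v$ for the stabiliser of $v$ in $G$, $G_{uv}=G_u\cap G_v$, and $G_v^{\Gamma(v)}$ for the permutation group induced by $G_v$ on the neighbourhood $\Gamma(v)$ of $v$. For a permutation group $L$, the pair $(\Gamma,G)$ is *locally-$L$* if $\Gamma$ is connected, $G$ is transitive on the vertices of $\Gamma$, and $G_v^{\Gamma(v)}$ is permutation isomorphic to $L$ for a vertex $v$ (equivalently, for every vertex $v$). A transitive permutation group $L$ is *graph-restrictive* if there is a constant $c(L)$ such that $|G_{uv}|\le c(L)$ for every locally-$L$ pair $(\Gamma,G)$ and every arc $(u,v)$ of $\Gamma$ (that is, every ordered pair of adjacent vertices). Let $p$ be a prime, let $Z$ be the centre of $\mathrm{GL}(2,p)$ (the group of scalar matrices), let $G$ be a subgroup with $\mathrm{SL}(2,p)\le G\le\mathrm{GL}(2,p)$, and let $K$ be a subgroup of $G\cap Z$. Let $\Omega$ be the set of $K$-orbits on the nonzero column vectors in $\mathbb{F}_p^2$. Then $G$ acts on $\Omega$ by $g\cdot[v]=[gv]$,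 the kernel of this action is $K$, and the permutation group $L\cong G/K$ induced by $G$ on $\Omega$ is graph-restrictive (in particular, transitive). In particular, the following permutation groups are graph-restrictive: $\mathrm{GL}(2,p)$ and $\mathrm{SL}(2,p)$ acting on the nonzero vectors of $\mathbb{F}_p^2$, and $\mathrm{PGL}(2,p)$ and $\mathrm{PSL}(2,p)$ acting on the projective line over $\mathbb{F}_p$. -/

import Mathlib

open scoped MatrixGroups LinearAlgebra.Projectivization

universe u v

/-- The permutation group on `X` induced by a group `H` acting on `X`. -/
def inducedPermGroup (H : Type u) (X : Type v) [Group H] [MulAction H X] :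
    Subgroup (Equiv.Perm X) :=
  (MulAction.toPermHom H X).range

/-- Permutation isomorphism of permutation groups. -/
def PermIsomorphic {X : Type u} {Y : Type v}
    (A : Subgroup (Equiv.Perm X)) (B : Subgroup (Equiv.Perm Y)) : Prop :=
  ∃ (e : X ≃ Y) (φ : A ≃* B), ∀ (a : A) (x : X),
    e ((a : Equiv.Perm X) x) = (φ a : Equiv.Perm Y) (e x)

/-- For `G ≤ Aut(Γ)`, the stabiliser `G_a` acts on the neighbourhood `Γ(a)`. -/
instance neighborAction {V : Type u} (Γ : SimpleGraph V) (G : Subgroup (Γ ≃g Γ)) (a : V) :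
    MulAction (MulAction.stabilizer G a) (Γ.neighborSet a) where
  smul g b := ⟨(g : G) • (b : V), by
    have h : Γ.Adj ((g : G) • a) ((g : G) • (b : V)) :=
      ((g : G) : Γ ≃g Γ).map_adj_iff.mpr b.2
    rwa [MulAction.mem_stabilizer_iff.mp g.2] at h⟩
  one_smul b := Subtype.ext (one_smul G (b : V))
  mul_smul g h b := Subtype.ext (mul_smul (g : G) (h : G) (b : V))

/-- The local action `G_a^{Γ(a)}`: the permutation group induced by `G_a` on `Γ(a)`. -/
def localAction {V : Type u} (Γ : SimpleGraph V) (G : Subgroup (Γ ≃g Γ)) (a : V) :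
    Subgroup (Equiv.Perm (Γ.neighborSet a)) :=
  inducedPermGroup (MulAction.stabilizer G a) (Γ.neighborSet a)

/-- `(Γ, G)` is locally-`L`: `Γ` is connected and `G`-vertex-transitive, and the local action
at a vertex is permutation isomorphic to `L`. -/
def IsLocally {V : Type u} {Ω : Type v} (Γ : SimpleGraph V) (G : Subgroup (Γ ≃g Γ))
    (L : Subgroup (Equiv.Perm Ω)) : Prop :=
  Γ.Connected ∧ MulAction.IsPretransitive G V ∧ ∃ a : V, PermIsomorphic (localAction Γ G a) L

/-- `L` is graph-restrictive: it is transitive, and there is a constant `c` such that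
`|G_{ab}| ≤ c` for every finite locally-`L` pair `(Γ, G)` and every arc `(a, b)` of `Γ`. -/
def IsGraphRestrictive {Ω : Type v} (L : Subgroup (Equiv.Perm Ω)) : Prop :=
  MulAction.IsPretransitive L Ω ∧
    ∃ c : ℕ, ∀ (V : Type u) [Finite V] (Γ : SimpleGraph V) (G : Subgroup (Γ ≃g Γ)),
      IsLocally Γ G L → ∀ a b : V, Γ.Adj a b →
        Nat.card ↥(MulAction.stabilizer G a ⊓ MulAction.stabilizer G b) ≤ c

/-- If `K` is a central subgroup of a group `H` acting on `X`, then `H` acts on the set of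
`K`-orbits of `X` by `h • [x] = [h • x]`; this is the resulting homomorphism. -/
def orbitPermHom {H : Type u} [Group H] (X : Type v) [MulAction H X] (K : Subgroup H)
    (hK : K ≤ Subgroup.center H) : H →* Equiv.Perm (MulAction.orbitRel.Quotient K X) :=
  @MulAction.toPermHom H (MulAction.orbitRel.Quotient K X) _
    { smul := fun h => Quotient.map (fun x : X => h • x) (by
        rintro x y ⟨k, rfl⟩
        refine ⟨k, ?_⟩
        change (k : H) • h • y = h • (k : H) • y
        rw [smul_smul, smul_smul, Subgroup.mem_center_iff.mp (hK k.2) h])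
      one_smul := by
        rintro ⟨x⟩
        exact congrArg (Quotient.mk _) (one_smul H x)
      mul_smul := by
        rintro g h ⟨x⟩
        exact congrArg (Quotient.mk _) (mul_smul g h x) }

/-- The nonzero vectors of `𝔽_p²` (as column vectors). -/
def NonzeroVec (p : ℕ) : Type := {v : Fin 2 → ZMod p // v ≠ 0}

/-- A group acting linearly on `𝔽_p²` acts on the nonzero vectors; this is used for `GL(2,p)` and
`SL(2,p)`, where `g • v` is the matrix-vector product. -/
instance nonzeroVecAction (p : ℕ) (H : Type u) [Group H] [DistribMulAction H (Fin 2 → ZMod p)] :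
    MulAction H (NonzeroVec p) where
  smul g v := ⟨g • v.1, (smul_ne_zero_iff_ne g).mpr v.2⟩
  one_smul v := Subtype.ext (one_smul H v.1)
  mul_smul g h v := Subtype.ext (mul_smul g h v.1)

/-- The permutation group `L` induced by `G ≤ GL(2,p)` on the set of `K`-orbits of nonzero vectors
of `𝔽_p²`, for a group `K` of scalar matrices. -/
def linearOrbitGroup (p : ℕ) (G K : Subgroup (GL (Fin 2) (ZMod p)))
    (hK : K ≤ Subgroup.center (GL (Fin 2) (ZMod p))) :
    Subgroup (Equiv.Perm (MulAction.orbitRel.Quotient K (NonzeroVec p))) :=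
  G.map (orbitPermHom (NonzeroVec p) K hK)

set_option linter.unusedSectionVars false

/-! ### Conjugation and coprime powers in finite groups. -/

section GroupLemmas

variable {G : Type*} [Group G]

/-! Write `K_x` for the kernel of `G_x` on the neighbourhood of `x`. For an edge `xy`, the quotient
of `G_xy` by `K_x ∩ K_y` embeds in a product of two symmetric groups of degree `|Ω|`, so it is
enough to bound `K_x ∩ K_y`; the bound obtained is `p ^ 6`. Of `L` only the properties collected in
`IsRankOne` are needed. They come from transvections over a prime field: the `p`-elements fixing a
point form a group of order `p`, and two of them with different axes generate a transitive group.

The engine is `eq_bot_of_normalized`: a subgroup fixing both ends of an edge, whose normaliser is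
locally transitive at both ends, fixes every vertex and is therefore trivial.

The first application is a Thompson–Wielandt argument (`isPGroup_inf`): `K_x ∩ K_y` is a `p`-group.
Consequently the `p`-elements of `G_xy` form a `p`-group `S_xy` (`mem_arcSylow`), and those in `K_x`
form a subgroup `Q_x` of index `p` in `S_xy`.

The order of `S_xy` is bounded by the amalgam method. If the centre of `S_xy` is not in `Q_x`, then
the centraliser of `Q_x` is locally transitive at `x`, so `Q_x ∩ Q_y = 1` and the order is at most
`p ^ 2`. Otherwise let `Z_x` be generated by the centres of all `S_xy` with `y` adjacent to `x`; it
is central in `Q_x`. Let `b` be the least distance of a critical pair, that is, of vertices `u, v`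
with `Z_u` not contained in `Q_v`. For critical pairs, `Z_u` and `Z_v` do not commute, and the
centres of arc groups have order at most `p ^ 2` (`IsCritical.card_arcCenter_le`). Criticality
propagates to the ends of all straight paths of length `b` (`IsCritical.shift`,
`not_le_of_isStraight`). Commutators of critical pairs on overlapping paths then force `b ≤ 2`
(`critical_dist_le_two`).

For `b = 1` the derived group of `Q_x`, and for `b = 2` that of `Q_x ∩ Q_y`, is unchanged on passing
to a neighbouring vertex or edge, so it is trivial by the engine. The resulting commutativity puts a
subgroup of small index of `S_xy` into its centre and gives `p ^ 4` and `p ^ 6`. -/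

theorem mem_normalizer_of_conj_mem [Finite G] {H : Subgroup G} {g : G}
    (h : ∀ a ∈ H, g * a * g⁻¹ ∈ H) : g ∈ Subgroup.normalizer (H : Set G) := by
  rw [Subgroup.mem_normalizer_iff]
  have hpow : ∀ n : ℕ, ∀ a ∈ H, g ^ n * a * (g ^ n)⁻¹ ∈ H := by
    intro n
    induction n with
    | zero => intro a ha; simpa using ha
    | succ n ih =>
      intro a ha
      have := ih _ (h a ha)
      have e : g ^ (n + 1) * a * (g ^ (n + 1))⁻¹ = g ^ n * (g * a * g⁻¹) * (g ^ n)⁻¹ := by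
        rw [pow_succ]; group
      rwa [e]
  refine fun a => ⟨h a, fun ha => ?_⟩
  obtain ⟨n, hn⟩ : ∃ n : ℕ, g ^ n = g⁻¹ :=
    ⟨orderOf g - 1, eq_inv_of_mul_eq_one_left (by
      rw [← pow_succ, Nat.sub_add_cancel (orderOf_pos g), pow_orderOf_eq_one])⟩
  have := hpow n _ ha
  rw [hn] at this
  simpa [mul_assoc] using this

theorem conj_mem_of_mem_normalizer {H : Subgroup G} {g a : G}
    (hg : g ∈ Subgroup.normalizer (H : Set G)) (ha : a ∈ H) : g * a * g⁻¹ ∈ H :=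
  (Subgroup.mem_normalizer_iff.mp hg a).mp ha

theorem mem_of_pow_mem_of_coprime {H : Subgroup G} {g : G} {n : ℕ}
    (hc : (orderOf g).Coprime n) (h : g ^ n ∈ H) : g ∈ H := by
  obtain ⟨m, hm⟩ := exists_pow_eq_self_of_coprime hc.symm
  rw [← hm]
  exact H.pow_mem h m

theorem exists_pow_prime_pow_coprime [Finite G] (p : ℕ) [hp : Fact p.Prime] (g : G) :
    ∃ k m : ℕ, orderOf g = p ^ k * m ∧ Nat.Coprime p m := by
  obtain ⟨k, m, hm, h⟩ := Nat.exists_eq_pow_mul_and_not_dvd (orderOf_pos g).ne' p hp.out.ne_one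
  exact ⟨k, m, h, (Nat.Prime.coprime_iff_not_dvd hp.out).2 hm⟩

theorem coprime_orderOf_pow [Finite G] {p k m : ℕ} {g : G} (hk : orderOf g = p ^ k * m)
    (hm : Nat.Coprime p m) (hp : 0 < p) : (orderOf (g ^ p ^ k)).Coprime p := by
  rw [orderOf_pow_of_dvd (pow_pos hp k).ne' (hk ▸ dvd_mul_right _ _), hk,
    Nat.mul_div_cancel_left _ (pow_pos hp k)]
  exact hm.symm

end GroupLemmas

/-! ### Locally rank-one actions and the edge-normaliser principle. -/

section Abstract

variable {V : Type*} (Γ : SimpleGraph V) (G : Type*) [Group G] [MulAction G V]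

/-- The pointwise stabiliser of a vertex and all its neighbours. -/
def nbrFixer (x : V) : Subgroup G where
  carrier := {g | g • x = x ∧ ∀ y, Γ.Adj x y → g • y = y}
  one_mem' := ⟨one_smul _ _, fun _ _ => one_smul _ _⟩
  mul_mem' := fun {a b} ha hb => ⟨by rw [mul_smul, hb.1, ha.1],
    fun y hy => by rw [mul_smul, hb.2 y hy, ha.2 y hy]⟩
  inv_mem' := fun {a} ha => ⟨inv_smul_eq_iff.mpr ha.1.symm,
    fun y hy => inv_smul_eq_iff.mpr (ha.2 y hy).symm⟩

/-- A vertex-transitive group of automorphisms of a connected graph whose local action has the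
features of a group between `SL(2,p)` and `GL(2,p)`, acting on vectors up to scalars: the
`p`-elements of a point stabiliser form a group of order `p`, any two such groups at points in
different directions generate a transitive group, and a point stabiliser has no nontrivial
normal `p'`-subgroup. -/
structure IsLocallyRankOne (p : ℕ) : Prop where
  connected : Γ.Connected
  smul_adj : ∀ (g : G) {x y : V}, Γ.Adj x y → Γ.Adj (g • x) (g • y)
  exists_smul : ∀ x y : V, ∃ g : G, g • x = y
  exists_smul_nbr : ∀ {x y z : V}, Γ.Adj x y → Γ.Adj x z → ∃ g : G, g • x = x ∧ g • y = z
  unip_of_pow : ∀ {x y : V} {g : G} {k : ℕ}, Γ.Adj x y → g • x = x → g • y = y →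
    g ^ p ^ k ∈ nbrFixer Γ G x → g ^ p ∈ nbrFixer Γ G x
  cyclic : ∀ {x y : V} {a h : G}, Γ.Adj x y → a • x = x → a • y = y → h • x = x → h • y = y →
    a ^ p ∈ nbrFixer Γ G x → h ^ p ∈ nbrFixer Γ G x → a ∉ nbrFixer Γ G x →
      ∃ k : ℕ, a ^ k * h ∈ nbrFixer Γ G x
  exists_unip : ∀ {x y : V}, Γ.Adj x y → ∃ a : G, a • x = x ∧ a • y = y ∧
    a ^ p ∈ nbrFixer Γ G x ∧ a ∉ nbrFixer Γ G x
  normal : ∀ {x y : V} (N : Subgroup G), Γ.Adj x y → (∀ n ∈ N, n • x = x ∧ n • y = y) →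
    (∀ g : G, g • x = x → g • y = y → ∀ n ∈ N, g * n * g⁻¹ ∈ N) →
    (∀ n ∈ N, n ^ p ∈ nbrFixer Γ G x → n ∈ nbrFixer Γ G x) → N ≤ nbrFixer Γ G x
  transitive : ∀ {x y z : V} {a b : G} (A : Subgroup G), Γ.Adj x y → Γ.Adj x z →
    (∀ g ∈ A, g • x = x) → a ∈ A → a • y = y → a ^ p ∈ nbrFixer Γ G x → a ∉ nbrFixer Γ G x →
    b ∈ A → b • z = z → b ^ p ∈ nbrFixer Γ G x → b ∉ nbrFixer Γ G x → a • z ≠ z →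
    ∀ {z₁ z₂ : V}, Γ.Adj x z₁ → Γ.Adj x z₂ → ∃ g ∈ A, g • z₁ = z₂
  directions : ∀ {x y : V}, Γ.Adj x y → ∃ z₁ z₂ : V, Γ.Adj x z₁ ∧ Γ.Adj x z₂ ∧
    (∀ a : G, a • x = x → a • y = y → a ^ p ∈ nbrFixer Γ G x → a ∉ nbrFixer Γ G x →
      a • z₁ ≠ z₁ ∧ a • z₂ ≠ z₂) ∧
    (∀ a : G, a • x = x → a • z₁ = z₁ → a ^ p ∈ nbrFixer Γ G x → a ∉ nbrFixer Γ G x →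
      a • z₂ ≠ z₂)

variable {Γ G}

/-- `A` moves any neighbour of `x` to any other. -/
def TransOnNbrs (Γ : SimpleGraph V) (A : Subgroup G) (x : V) : Prop :=
  ∀ ⦃z₁ z₂ : V⦄, Γ.Adj x z₁ → Γ.Adj x z₂ → ∃ g ∈ A, g • z₁ = z₂

theorem TransOnNbrs.mono {A B : Subgroup G} {x : V} (h : TransOnNbrs Γ A x) (hAB : A ≤ B) :
    TransOnNbrs Γ B x := fun _ _ h₁ h₂ =>
  let ⟨g, hg, e⟩ := h h₁ h₂
  ⟨g, hAB hg, e⟩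

theorem eq_bot_of_fixes [FaithfulSMul G V] {H : Subgroup G} (h : ∀ a ∈ H, ∀ v : V, a • v = v) :
    H = ⊥ := by
  rw [Subgroup.eq_bot_iff_forall]
  exact fun a ha => eq_of_smul_eq_smul (α := V) fun v => by rw [h a ha v, one_smul]

/-- A subgroup fixing an edge whose normaliser is locally transitive at both ends is trivial. -/
theorem eq_bot_of_normalized [FaithfulSMul G V] (hc : Γ.Connected)
    (hadj : ∀ (g : G) {x y : V}, Γ.Adj x y → Γ.Adj (g • x) (g • y)) {x y : V} (hxy : Γ.Adj x y)
    {H : Subgroup G} (hH : ∀ a ∈ H, a • x = x ∧ a • y = y)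
    (hx : TransOnNbrs Γ (MulAction.stabilizer G x ⊓ Subgroup.normalizer (H : Set G)) x)
    (hy : TransOnNbrs Γ (MulAction.stabilizer G y ⊓ Subgroup.normalizer (H : Set G)) y) :
    H = ⊥ := by
  -- Walking through the graph, each new neighbour is reached by a normalising element, so every
  -- vertex is a translate of `x` or `y` under the normaliser. As `H` fixes `x` and `y`, it fixes
  -- all these translates.
  have key : ∀ v : V, ∃ m ∈ Subgroup.normalizer (H : Set G), v = m • x ∨ v = m • y := by
    intro v
    obtain ⟨w⟩ := hc.preconnected v x
    induction w with
    | nil => exact ⟨1, one_mem _, Or.inl (one_smul _ _).symm⟩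
    | @cons a b c hab w ih =>
      obtain ⟨m, hm, h | h⟩ := ih hxy hH hx
      · have h1 : Γ.Adj c (m⁻¹ • a) := by
          have := hadj m⁻¹ hab.symm
          rwa [h, inv_smul_smul] at this
        obtain ⟨g, hg, e⟩ := hx hxy h1
        exact ⟨m * g, mul_mem hm hg.2, Or.inr (by rw [mul_smul, e, smul_inv_smul])⟩
      · have h1 : Γ.Adj y (m⁻¹ • a) := by
          have := hadj m⁻¹ hab.symm
          rwa [h, inv_smul_smul] at this
        obtain ⟨g, hg, e⟩ := hy hxy.symm h1
        exact ⟨m * g, mul_mem hm hg.2, Or.inl (by rw [mul_smul, e, smul_inv_smul])⟩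
  refine eq_bot_of_fixes (V := V) fun a ha v => ?_
  obtain ⟨m, hm, h⟩ := key v
  have h1 : m⁻¹ * a * m ∈ H := by
    have := conj_mem_of_mem_normalizer (inv_mem hm) ha
    rwa [inv_inv] at this
  have h2 := hH _ h1
  rcases h with rfl | rfl
  · have := congrArg (m • ·) h2.1
    simpa [mul_smul] using this
  · have := congrArg (m • ·) h2.2
    simpa [mul_smul] using this

theorem conj_mem_nbrFixer (hadj : ∀ (g : G) {x y : V}, Γ.Adj x y → Γ.Adj (g • x) (g • y))
    (g : G) {x : V} {a : G} (ha : a ∈ nbrFixer Γ G x) : g * a * g⁻¹ ∈ nbrFixer Γ G (g • x) := by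
  refine ⟨by simp [mul_smul, ha.1], fun y hy => ?_⟩
  have h1 : Γ.Adj x (g⁻¹ • y) := by simpa using hadj g⁻¹ hy
  rw [mul_smul, mul_smul, ha.2 _ h1, smul_inv_smul]

namespace IsLocallyRankOne

variable {p : ℕ} (h : IsLocallyRankOne Γ G p)
include h

theorem exists_smul_arc {x y x' y' : V} (hxy : Γ.Adj x y) (hxy' : Γ.Adj x' y') :
    ∃ g : G, g • x = x' ∧ g • y = y' := by
  obtain ⟨g, rfl⟩ := h.exists_smul x x'
  obtain ⟨k, hk, hk'⟩ := h.exists_smul_nbr (h.smul_adj g hxy) hxy'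
  exact ⟨k * g, by rw [mul_smul, hk], by rw [mul_smul, hk']⟩

theorem exists_swap {x y : V} (hxy : Γ.Adj x y) : ∃ g : G, g • x = y ∧ g • y = x :=
  h.exists_smul_arc hxy hxy.symm

theorem conj_mem_K (g : G) {x : V} {a : G} (ha : a ∈ nbrFixer Γ G x) :
    g * a * g⁻¹ ∈ nbrFixer Γ G (g • x) := conj_mem_nbrFixer h.smul_adj g ha

theorem conj_mem_K_of_fix {g : G} {x : V} (hg : g • x = x) {a : G} (ha : a ∈ nbrFixer Γ G x) :
    g * a * g⁻¹ ∈ nbrFixer Γ G x := by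
  have := h.conj_mem_K g ha
  rwa [hg] at this

theorem eq_bot [FaithfulSMul G V] {x y : V} (hxy : Γ.Adj x y)
    {H : Subgroup G} (hH : ∀ a ∈ H, a • x = x ∧ a • y = y)
    (hx : TransOnNbrs Γ (MulAction.stabilizer G x ⊓ Subgroup.normalizer (H : Set G)) x)
    (hy : TransOnNbrs Γ (MulAction.stabilizer G y ⊓ Subgroup.normalizer (H : Set G)) y) :
    H = ⊥ := eq_bot_of_normalized h.connected h.smul_adj hxy hH hx hy

/-- The product of two elements of order `p` modulo the kernel is again such. -/
theorem mul_pow_mem {x y : V} {a b : G} (hxy : Γ.Adj x y) (hax : a • x = x)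
    (hay : a • y = y) (hbx : b • x = x) (hby : b • y = y) (ha : a ^ p ∈ nbrFixer Γ G x)
    (hb : b ^ p ∈ nbrFixer Γ G x) : (a * b) ^ p ∈ nbrFixer Γ G x := by
  have norm : ∀ c d : G, d • x = x → c ∈ nbrFixer Γ G x → ∀ n : ℕ,
      ∃ c' ∈ nbrFixer Γ G x, (c * d) ^ n = c' * d ^ n := by
    intro c d hd hc n
    induction n with
    | zero => exact ⟨1, one_mem _, by simp⟩
    | succ n ih =>
      obtain ⟨c', hc', e⟩ := ih
      refine ⟨c * (d * c' * d⁻¹), mul_mem hc (h.conj_mem_K_of_fix hd hc'), ?_⟩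
      rw [pow_succ', e, pow_succ']
      group
  by_cases ha' : a ∈ nbrFixer Γ G x
  · obtain ⟨c, hc, e⟩ := norm a b hbx ha' p
    rw [e]
    exact mul_mem hc hb
  -- Modulo the kernel, `b` is a power of `a`, so `a * b` is a power of `a` too.
  · obtain ⟨k, hk⟩ := h.cyclic hxy hax hay hbx hby ha hb ha'
    obtain ⟨c, hc, e⟩ : ∃ c ∈ nbrFixer Γ G x, a * b = c * (a * (a ^ k)⁻¹) := by
      have hf : (a * (a ^ k)⁻¹) • x = x :=
        (MulAction.stabilizer G x).mul_mem hax (inv_mem (pow_mem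
          (MulAction.mem_stabilizer_iff.mpr hax) k))
      exact ⟨_, h.conj_mem_K_of_fix hf hk, by group⟩
    have hf : (a * (a ^ k)⁻¹) • x = x :=
      (MulAction.stabilizer G x).mul_mem hax (inv_mem (pow_mem
        (MulAction.mem_stabilizer_iff.mpr hax) k))
    obtain ⟨c', hc', e'⟩ := norm c _ hf hc p
    rw [e, e']
    refine mul_mem hc' ?_
    have hcomm : Commute a (a ^ k)⁻¹ := ((Commute.refl a).pow_right k).inv_right
    rw [hcomm.mul_pow, inv_pow, ← pow_mul, mul_comm k p, pow_mul]
    exact mul_mem ha (inv_mem (pow_mem ha k))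

/-- A subgroup of `G_x` containing nontrivial `p`-elements in all directions. -/
theorem trans_of_forall {x : V} (A : Subgroup G) (hA : ∀ g ∈ A, g • x = x)
    (hu : ∀ y, Γ.Adj x y → ∃ a ∈ A, a • y = y ∧ a ^ p ∈ nbrFixer Γ G x ∧ a ∉ nbrFixer Γ G x) :
    TransOnNbrs Γ A x := by
  intro z₁ z₂ h₁ h₂
  obtain ⟨w, _, hw, _, hd, _⟩ := h.directions h₁
  obtain ⟨a, ha, hay, hap, haK⟩ := hu z₁ h₁
  obtain ⟨b, hb, hby, hbp, hbK⟩ := hu w hw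
  exact h.transitive A h₁ hw hA ha hay hap haK hb hby hbp hbK (hd a (hA a ha) hay hap haK).1 h₁ h₂

/-- A normal subgroup of `G_x` containing a nontrivial `p`-element. -/
theorem trans_of_normal {x y : V} (A : Subgroup G) (hA : ∀ g ∈ A, g • x = x)
    (hn : ∀ g : G, g • x = x → ∀ a ∈ A, g * a * g⁻¹ ∈ A) (hxy : Γ.Adj x y) {a : G} (ha : a ∈ A)
    (hay : a • y = y) (hap : a ^ p ∈ nbrFixer Γ G x) (haK : a ∉ nbrFixer Γ G x) :
    TransOnNbrs Γ A x := by
  refine h.trans_of_forall A hA fun z hz => ?_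
  obtain ⟨g, hg, rfl⟩ := h.exists_smul_nbr hxy hz
  refine ⟨_, hn g hg a ha, by simp [mul_smul, hay], ?_, fun hc => haK ?_⟩
  · rw [conj_pow]
    exact h.conj_mem_K_of_fix hg hap
  · have := h.conj_mem_K_of_fix (inv_smul_eq_iff.mpr hg.symm) hc
    simpa [mul_assoc] using this

end IsLocallyRankOne

end Abstract

/-! ### Normal `p`- and `p'`-subgroups of the kernels; `K_x ∩ K_y` is a `p`-group. -/

section Cores

variable {V : Type*} {Γ : SimpleGraph V} {G : Type*} [Group G] [MulAction G V]

/-- `N` is a normal subgroup, with property `c`, of the kernel of `G_x` on the neighbours. -/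
structure IsNormalInFixer (Γ : SimpleGraph V) (c : Subgroup G → Prop) (x : V) (N : Subgroup G) :
    Prop where
  le : N ≤ nbrFixer Γ G x
  prop : c N
  conj_mem : ∀ k ∈ nbrFixer Γ G x, ∀ n ∈ N, k * n * k⁻¹ ∈ N

/-- A candidate of largest order absorbs every other one, because the join of two candidates is a
candidate. Leaving `c` open yields `O_p(K_x)` and `O_{p'}(K_x)` at once. -/
theorem exists_greatest_normalInFixer [Finite G] {c : Subgroup G → Prop} (hbot : c ⊥)
    (hsup : ∀ N M : Subgroup G, c N → c M → M ≤ Subgroup.normalizer (N : Set G) → c (M ⊔ N))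
    (x : V) : ∃ N, IsNormalInFixer Γ c x N ∧ ∀ M, IsNormalInFixer Γ c x M → M ≤ N := by
  have : Nonempty {N : Subgroup G // IsNormalInFixer Γ c x N} :=
    ⟨⊥, bot_le, hbot, fun k _ n hn => by simp_all⟩
  obtain ⟨⟨N, hN⟩, hmax⟩ :=
    Finite.exists_max fun N : {N : Subgroup G // IsNormalInFixer Γ c x N} => Nat.card N.1
  refine ⟨N, hN, fun M hM => ?_⟩
  have hnorm : ∀ L : Subgroup G, IsNormalInFixer Γ c x L →
      nbrFixer Γ G x ≤ Subgroup.normalizer (L : Set G) :=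
    fun L hL k hk => mem_normalizer_of_conj_mem (hL.conj_mem k hk)
  have hs : IsNormalInFixer Γ c x (M ⊔ N) := by
    refine ⟨sup_le hM.le hN.le, hsup N M hN.prop hM.prop (hM.le.trans (hnorm N hN)), ?_⟩
    intro k hk
    have : M ⊔ N ≤ (M ⊔ N).comap (MulAut.conj k).toMonoidHom :=
      sup_le (fun n hn => Subgroup.mem_sup_left (hM.conj_mem k hk n hn))
        (fun n hn => Subgroup.mem_sup_right (hN.conj_mem k hk n hn))
    exact fun n hn => this hn
  have h1 := Subgroup.eq_of_le_of_card_ge (le_sup_right : N ≤ M ⊔ N) (hmax ⟨_, hs⟩)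
  rw [h1]
  exact le_sup_left

/-- The greatest candidate `F x` is invariant under `G_x`, so `hK` puts it into `K_y`. Since `K_y`
fixes `x`, it normalises `F x`; hence `F x ≤ F y`. By connectedness `F x` lies in every kernel and
fixes all vertices. -/
theorem IsLocallyRankOne.normalInFixer_eq_bot [Finite G] [FaithfulSMul G V] {p : ℕ}
    (h : IsLocallyRankOne Γ G p) {c : Subgroup G → Prop} (hbot : c ⊥)
    (hsup : ∀ N M : Subgroup G, c N → c M → M ≤ Subgroup.normalizer (N : Set G) → c (M ⊔ N))
    (hconj : ∀ (g : G) (N : Subgroup G), c N → c (N.map (MulAut.conj g).toMonoidHom))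
    (hK : ∀ (x y : V) (N : Subgroup G), Γ.Adj x y → IsNormalInFixer Γ c x N →
      (∀ g : G, g • x = x → ∀ n ∈ N, g * n * g⁻¹ ∈ N) → N ≤ nbrFixer Γ G y)
    {x : V} {N : Subgroup G} (hN : IsNormalInFixer Γ c x N) : N = ⊥ := by
  choose F hF hmax using fun x => exists_greatest_normalInFixer (Γ := Γ) hbot hsup x
  have hinv : ∀ x, ∀ g : G, g • x = x → ∀ n ∈ F x, g * n * g⁻¹ ∈ F x := by
    intro x g hg n hn
    refine hmax x ((F x).map (MulAut.conj g).toMonoidHom) ⟨?_, hconj g _ (hF x).prop, ?_⟩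
      (Subgroup.mem_map_of_mem _ hn)
    · rintro _ ⟨n, hn, rfl⟩
      exact h.conj_mem_K_of_fix hg ((hF x).le hn)
    · rintro k hk _ ⟨n, hn, rfl⟩
      have hk' := h.conj_mem_K_of_fix (inv_smul_eq_iff.mpr hg.symm) hk
      refine ⟨_, (hF x).conj_mem _ hk' n hn, ?_⟩
      simp [mul_assoc]
  have hle : ∀ x y, Γ.Adj x y → F x ≤ F y := fun x y hxy => by
    refine hmax y _ ⟨hK x y _ hxy (hF x) (hinv x), (hF x).prop, fun k hk => ?_⟩
    exact hinv x k (hk.2 x hxy.symm)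
  have hwalk : ∀ {u v : V} (_ : Γ.Walk u v), F u ≤ F v := by
    intro u v w
    induction w with
    | nil => exact le_rfl
    | cons hab _ ih => exact (hle _ _ hab).trans ih
  have hall : ∀ v, F x ≤ F v := fun v =>
    let ⟨w⟩ := h.connected.preconnected x v
    hwalk w
  have hb : F x = ⊥ := eq_bot_of_fixes (V := V) fun a ha v => ((hF v).le (hall v ha)).1
  exact le_bot_iff.mp (hb ▸ hmax x N hN)

/-- If `m * n` has order `p`, then `m ^ p ∈ N`. As `m` has order prime to `p`, this gives `m ∈ N`,
and then `m * n` is an element of order `p` in `N`. -/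
theorem not_dvd_card_sup [Finite G] {p : ℕ} [Fact p.Prime] (N M : Subgroup G)
    (hN : ¬ p ∣ Nat.card N) (hM : ¬ p ∣ Nat.card M) (hnorm : M ≤ Subgroup.normalizer (N : Set G)) :
    ¬ p ∣ Nat.card ↥(M ⊔ N) := by
  intro hd
  obtain ⟨⟨g, hg⟩, hord⟩ := exists_prime_orderOf_dvd_card' p hd
  have hord' : orderOf g = p := by rwa [Subgroup.orderOf_mk] at hord
  rw [← SetLike.mem_coe, Subgroup.coe_mul_of_left_le_normalizer_right M N hnorm] at hg
  obtain ⟨m, hm, n, hn, rfl⟩ := hg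
  have hpow : ∀ k : ℕ, ∃ n' ∈ N, (m * n) ^ k = m ^ k * n' := by
    intro k
    induction k with
    | zero => exact ⟨1, one_mem _, by simp⟩
    | succ k ih =>
      obtain ⟨n', hn', e⟩ := ih
      have := conj_mem_of_mem_normalizer (inv_mem (hnorm hm)) hn'
      exact ⟨_, mul_mem this hn, by simp only [pow_succ, e]; group⟩
  have hcop : ∀ (L : Subgroup G), ¬ p ∣ Nat.card L → ∀ l ∈ L, (orderOf l).Coprime p := by
    intro L hL l hl
    refine ((Nat.Prime.coprime_iff_not_dvd Fact.out).mpr fun hdv => hL ?_).symm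
    exact hdv.trans (Subgroup.orderOf_dvd_natCard L hl)
  obtain ⟨n', hn', e⟩ := hpow p
  have h1 : (m * n) ^ p = 1 := by rw [← hord']; exact pow_orderOf_eq_one _
  rw [h1] at e
  have hmN : m ∈ N := by
    refine mem_of_pow_mem_of_coprime (hcop M hM m hm) ?_
    rw [eq_inv_of_mul_eq_one_left e.symm]
    exact inv_mem hn'
  have hmn := hcop N hN _ (mul_mem hmN hn)
  rw [hord', Nat.coprime_self] at hmn
  exact (Fact.out : p.Prime).one_lt.ne' hmn

namespace IsLocallyRankOne

variable {p : ℕ} (h : IsLocallyRankOne Γ G p)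
include h

/-- A `G_x`-invariant `p'`-subgroup of `K_x` induces on the neighbourhood of `y` a normal
`p'`-subgroup of the stabiliser of the point `x`, which is trivial by the `normal` property. -/
theorem coprime_normalInFixer_eq_bot [Finite G] [FaithfulSMul G V] [hp : Fact p.Prime] {x : V}
    {N : Subgroup G} (hN : IsNormalInFixer Γ (fun N : Subgroup G => ¬ p ∣ Nat.card N) x N) :
    N = ⊥ := by
  refine h.normalInFixer_eq_bot ?_ not_dvd_card_sup ?_ ?_ hN
  · simpa using hp.out.one_lt.ne'
  · intro g N hN
    rwa [Nat.card_congr (N.equivMapOfInjective _ (MulAut.conj g).injective).toEquiv.symm]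
  · intro x y N hxy hN hn
    refine h.normal N hxy.symm (fun n hn' => ⟨(hN.le hn').2 y hxy, (hN.le hn').1⟩)
      (fun g _ hg => hn g hg) fun n hn' hnp => ?_
    refine mem_of_pow_mem_of_coprime
      ((Nat.Prime.coprime_iff_not_dvd hp.out).mpr fun hdv => hN.prop ?_).symm hnp
    exact hdv.trans (Subgroup.orderOf_dvd_natCard N hn')

/-- If the kernels have no nontrivial normal `p`-subgroup, they are trivial. -/
theorem nbrFixer_eq_bot [Finite G] [Finite V] [FaithfulSMul G V] [hp : Fact p.Prime]
    (hQ : ∀ (x : V) (N : Subgroup G),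
      IsNormalInFixer Γ (fun N : Subgroup G => IsPGroup p N) x N → N = ⊥) (x : V) :
    nbrFixer Γ G x = ⊥ := by
  by_contra hne
  have hdist : ∀ (g : G) (u v : V), Γ.dist (g • u) (g • v) = Γ.dist u v := by
    have hle : ∀ (g : G) (u v : V), Γ.dist (g • u) (g • v) ≤ Γ.dist u v := by
      intro g u v
      obtain ⟨w, hw⟩ := h.connected.exists_walk_length_eq_dist u v
      let f : Γ →g Γ := ⟨fun z => g • z, fun hab => h.smul_adj g hab⟩
      have := SimpleGraph.dist_le (w.map f)
      rwa [SimpleGraph.Walk.length_map, hw] at this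
    refine fun g u v => le_antisymm (hle g u v) ?_
    simpa using hle g⁻¹ (g • u) (g • v)
  -- `Y n` is the pointwise stabiliser of the ball of radius `n`. For the least `m` with `Y m = ⊥`,
  -- the contradiction comes from showing that `Y (m - 1)` is trivial as well.
  let Y : ℕ → Subgroup G := fun n =>
    { carrier := {g | g • x = x ∧ ∀ z, Γ.dist x z ≤ n → g • z = z}
      one_mem' := ⟨one_smul _ _, fun _ _ => one_smul _ _⟩
      mul_mem' := fun {a b} ha hb => ⟨by rw [mul_smul, hb.1, ha.1],
        fun y hy => by rw [mul_smul, hb.2 y hy, ha.2 y hy]⟩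
      inv_mem' := fun {a} ha => ⟨inv_smul_eq_iff.mpr ha.1.symm,
        fun y hy => inv_smul_eq_iff.mpr (ha.2 y hy).symm⟩ }
  have hYK : Y 1 = nbrFixer Γ G x := by
    ext g
    refine ⟨fun hg => ⟨hg.1, fun y hy => hg.2 y (SimpleGraph.dist_eq_one_iff_adj.mpr hy).le⟩,
      fun hg => ⟨hg.1, fun y hy => ?_⟩⟩
    rcases Nat.le_one_iff_eq_zero_or_eq_one.mp hy with h0 | h1
    · rw [h.connected.dist_eq_zero_iff] at h0
      rw [← h0]
      exact hg.1
    · exact hg.2 y (SimpleGraph.dist_eq_one_iff_adj.mp h1)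
  have hex : ∃ n, Y n = ⊥ := by
    have : Nonempty V := ⟨x⟩
    obtain ⟨z₀, hz₀⟩ := Finite.exists_max fun z => Γ.dist x z
    exact ⟨Γ.dist x z₀, eq_bot_of_fixes (V := V) fun a ha v => ha.2 v (hz₀ v)⟩
  classical
  let m := Nat.find hex
  have hm : Y m = ⊥ := Nat.find_spec hex
  have hmono : ∀ {i j : ℕ}, i ≤ j → Y j ≤ Y i := fun hij g hg =>
    ⟨hg.1, fun z hz => hg.2 z (hz.trans hij)⟩
  have hm1 : 1 < m := by
    by_contra hle
    refine hne (hYK ▸ le_bot_iff.mp ?_)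
    rw [← hm]
    exact hmono (not_lt.mp hle)
  obtain ⟨n, hn⟩ : ∃ n, m = n + 2 := ⟨m - 2, by omega⟩
  have hYn : Y (n + 1) ≠ ⊥ := Nat.find_min hex (show n + 1 < m by omega)
  rw [hn] at hm
  have hYconj : ∀ g : G, g • x = x → ∀ a ∈ Y (n + 1), g * a * g⁻¹ ∈ Y (n + 1) := by
    intro g hg a ha
    refine ⟨by rw [mul_smul, mul_smul, inv_smul_eq_iff.mpr hg.symm, ha.1, hg], fun z hz => ?_⟩
    have : Γ.dist x (g⁻¹ • z) ≤ n + 1 := by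
      have := hdist g x (g⁻¹ • z)
      rw [hg, smul_inv_smul] at this
      omega
    rw [mul_smul, mul_smul, ha.2 _ this, smul_inv_smul]
  have hprev : ∀ z, ∀ k, Γ.dist x z = k + 1 → ∃ z', Γ.Adj z z' ∧ Γ.dist x z' = k := by
    intro z k hk
    obtain ⟨w, hw⟩ := h.connected.exists_walk_length_eq_dist z x
    rw [SimpleGraph.dist_comm, hk] at hw
    cases w with
    | nil => simp at hw
    | @cons _ b _ hab w =>
      refine ⟨b, hab, ?_⟩
      have h1 : Γ.dist b x ≤ w.length := SimpleGraph.dist_le w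
      rw [SimpleGraph.Walk.length_cons] at hw
      have h2 := h.connected.dist_triangle (u := x) (v := b) (w := z)
      rw [SimpleGraph.dist_eq_one_iff_adj.mpr hab.symm] at h2
      rw [SimpleGraph.dist_comm] at h1
      omega
  -- The elements of exponent `p` are closed under products. A vertex `z` on the outermost sphere
  -- has a predecessor `z'`, which has a predecessor `z''`; both factors fix `z'` and `z''`, so
  -- around `z'` they lie in one group of order `p`. The `p`-th power of the product therefore fixes
  -- the ball of radius `n + 2` and is trivial.
  let E : Subgroup G :=
    { carrier := {g | g ∈ Y (n + 1) ∧ g ^ p = 1}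
      one_mem' := ⟨one_mem _, one_pow _⟩
      inv_mem' := fun {a} ha => ⟨inv_mem ha.1, by rw [inv_pow, ha.2, inv_one]⟩
      mul_mem' := fun {a b} ha hb => by
        refine ⟨mul_mem ha.1 hb.1, ?_⟩
        rw [← Subgroup.mem_bot, ← hm]
        have hab := mul_mem ha.1 hb.1
        refine ⟨(pow_mem hab p).1, fun z hz => ?_⟩
        rcases hz.lt_or_eq with hlt | heq
        · exact (pow_mem hab p).2 z (by omega)
        · obtain ⟨z', hzz', hz'⟩ := hprev z _ heq
          obtain ⟨z'', hzz'', hz''⟩ := hprev z' _ hz'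
          have := h.mul_pow_mem hzz'' (ha.1.2 z' hz'.le) (ha.1.2 z'' (by omega))
            (hb.1.2 z' hz'.le) (hb.1.2 z'' (by omega)) (by rw [ha.2]; exact one_mem _)
            (by rw [hb.2]; exact one_mem _)
          exact this.2 z hzz'.symm }
  have hfixK : ∀ k ∈ nbrFixer Γ G x, k • x = x := fun k hk => hk.1
  have hEbot : E = ⊥ := hQ x E
    ⟨fun g hg => hYK ▸ hmono (show 1 ≤ n + 1 by omega) hg.1,
      fun g => ⟨1, by rw [pow_one]; exact Subtype.ext g.2.2⟩,
      fun k hk a ha => ⟨hYconj k (hfixK k hk) a ha.1, by rw [conj_pow, ha.2]; group⟩⟩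
  -- As `E` is a normal `p`-subgroup of the kernel, it is trivial. So `Y (n + 1)` is a normal
  -- `p'`-subgroup, hence trivial.
  refine hYn (h.coprime_normalInFixer_eq_bot (x := x) ⟨fun g hg =>
    hYK ▸ hmono (show 1 ≤ n + 1 by omega) hg, fun hd => ?_,
      fun k hk a ha => hYconj k (hfixK k hk) a ha⟩)
  obtain ⟨⟨g, hg⟩, hord⟩ := exists_prime_orderOf_dvd_card' p hd
  rw [Subgroup.orderOf_mk] at hord
  have : g ∈ E := ⟨hg, by rw [← hord]; exact pow_orderOf_eq_one _⟩
  rw [hEbot, Subgroup.mem_bot] at this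
  rw [this, orderOf_one] at hord
  exact hp.out.one_lt.ne hord

/-- The pointwise stabiliser of the neighbourhood of an edge is a `p`-group. -/
theorem isPGroup_inf [Finite G] [Finite V] [FaithfulSMul G V] [hp : Fact p.Prime] {x y : V}
    (hxy : Γ.Adj x y) : IsPGroup p ↥(nbrFixer Γ G x ⊓ nbrFixer Γ G y) := by
  by_cases hcase : ∀ (x y : V) (N : Subgroup G), Γ.Adj x y →
      IsNormalInFixer Γ (fun N : Subgroup G => IsPGroup p N) x N →
      (∀ g : G, g • x = x → ∀ n ∈ N, g * n * g⁻¹ ∈ N) → N ≤ nbrFixer Γ G y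
  · have hbot := h.nbrFixer_eq_bot (fun x N hN => h.normalInFixer_eq_bot
      (c := fun N : Subgroup G => IsPGroup p N) IsPGroup.of_bot
      (fun N M hN hM hMN => hM.to_sup_of_normal_right' hN hMN)
      (fun g N hN => hN.map _) hcase hN) x
    rw [hbot, bot_inf_eq]
    exact IsPGroup.of_bot
  -- Otherwise some `p`-subgroup `N₀`, normal in the stabiliser of `x₀`, acts nontrivially around
  -- `y₀`. Its conjugates supply nontrivial `p`-elements in all directions at every vertex. They are
  -- shown to normalise `E`, the subgroup generated by the `p'`-elements of `K_x ∩ K_y`.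
  push Not at hcase
  obtain ⟨x₀, y₀, N₀, hadj₀, hN₀, hinv₀, hnot₀⟩ := hcase
  obtain ⟨n₀, hn₀, hn₀'⟩ := SetLike.not_le_iff_exists.mp hnot₀
  let E : Subgroup G := Subgroup.closure
    {a | a ∈ nbrFixer Γ G x ⊓ nbrFixer Γ G y ∧ (orderOf a).Coprime p}
  have hEle : E ≤ nbrFixer Γ G x ⊓ nbrFixer Γ G y :=
    (Subgroup.closure_le _).mpr fun a ha => ha.1
  have main : ∀ {u v : V}, Γ.Adj u v → nbrFixer Γ G u ⊓ nbrFixer Γ G v =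
      nbrFixer Γ G x ⊓ nbrFixer Γ G y →
      TransOnNbrs Γ (MulAction.stabilizer G v ⊓ Subgroup.normalizer (E : Set G)) v := by
    intro u v huv hA
    refine h.trans_of_forall _ (fun g hg => hg.1) fun w hvw => ?_
    obtain ⟨g, rfl, rfl⟩ := h.exists_smul_arc hadj₀ hvw.symm
    have hconj : ∀ n ∈ N₀, g * n * g⁻¹ ∈ nbrFixer Γ G (g • x₀) := fun n hn =>
      h.conj_mem_K g (hN₀.le hn)
    have hpw : ∀ n ∈ N₀, ∃ k : ℕ, n ^ p ^ k = 1 := by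
      intro n hn
      obtain ⟨k, hk⟩ := hN₀.prop ⟨n, hn⟩
      exact ⟨k, by simpa using congrArg Subtype.val hk⟩
    refine ⟨g * n₀ * g⁻¹, ⟨(hconj n₀ hn₀).2 _ hvw.symm, ?_⟩, (hconj n₀ hn₀).1, ?_, fun hc => ?_⟩
    · refine mem_normalizer_of_conj_mem ?_
      have : E ≤ E.comap (MulAut.conj (g * n₀ * g⁻¹)).toMonoidHom := by
        refine (Subgroup.closure_le _).mpr ?_
        rintro a ⟨ha, hord⟩
        refine Subgroup.subset_closure ?_
        have hord' : (orderOf (g * n₀ * g⁻¹ * a * (g * n₀ * g⁻¹)⁻¹)).Coprime p := by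
          rwa [← MulAut.conj_apply, MulEquiv.orderOf_eq]
        refine ⟨?_, hord'⟩
        set q := g * n₀ * g⁻¹ with hq
        have hqv : q • g • y₀ = g • y₀ := (hconj n₀ hn₀).2 _ hvw.symm
        rw [← hA] at ha
        -- the commutator of `q` and `a`
        have hr1 : q * a * q⁻¹ * a⁻¹ ∈ nbrFixer Γ G (g • y₀) :=
          mul_mem (h.conj_mem_K_of_fix hqv ha.2) (inv_mem ha.2)
        have haw : a • g • x₀ = g • x₀ := ha.2.2 _ hvw
        have hr2 : ∃ n ∈ N₀, q * a * q⁻¹ * a⁻¹ = g * n * g⁻¹ := by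
          have hs : (g⁻¹ * a * g) • x₀ = x₀ := by
            rw [mul_smul, mul_smul, haw, inv_smul_smul]
          refine ⟨n₀ * ((g⁻¹ * a * g) * n₀⁻¹ * (g⁻¹ * a * g)⁻¹),
            mul_mem hn₀ (hinv₀ _ hs _ (inv_mem hn₀)), by rw [hq]; group⟩
        obtain ⟨n, hn, hrn⟩ := hr2
        set r := q * a * q⁻¹ * a⁻¹ with hr
        have hra : q * a * q⁻¹ = r * a := by rw [hr]; group
        have hru : r • u = u := hr1.2 u huv.symm
        have hrv : r • g • y₀ = g • y₀ := hr1.1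
        have hnorm : ∀ s : G, s • u = u → s • g • y₀ = g • y₀ →
            ∀ b ∈ nbrFixer Γ G u ⊓ nbrFixer Γ G (g • y₀),
            s * b * s⁻¹ ∈ nbrFixer Γ G u ⊓ nbrFixer Γ G (g • y₀) := fun s hs hs' b hb =>
          ⟨h.conj_mem_K_of_fix hs hb.1, h.conj_mem_K_of_fix hs' hb.2⟩
        -- Modulo `K_u ∩ K_v`, the `p'`-element `q * a * q⁻¹ = r * a` agrees with `r`, which lies in
        -- a conjugate of `N₀` and is a `p`-element. So a `p`-power of `r * a` lies in `K_u ∩ K_v`,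
        -- and by coprimality so does `r * a` itself.
        have hpow : ∀ k : ℕ, ∃ b ∈ nbrFixer Γ G u ⊓ nbrFixer Γ G (g • y₀),
            (r * a) ^ k = b * r ^ k := by
          intro k
          induction k with
          | zero => exact ⟨1, one_mem _, by simp⟩
          | succ k ih =>
            obtain ⟨b, hb, e⟩ := ih
            refine ⟨r * (a * b) * r⁻¹, hnorm r hru hrv _ (mul_mem ha hb), ?_⟩
            rw [pow_succ', e, pow_succ']
            group
        rw [MulEquiv.toMonoidHom_eq_coe, MonoidHom.coe_coe, MulAut.conj_apply, ← hA, hra]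
        rw [hra] at hord'
        obtain ⟨k, hk⟩ := hpw n hn
        obtain ⟨b, hb, e⟩ := hpow (p ^ k)
        refine mem_of_pow_mem_of_coprime (n := p ^ k) (hord'.pow_right k) ?_
        rw [e, hrn, conj_pow, hk]
        simpa using hb
      exact fun a ha => this ha
    · obtain ⟨k, hk⟩ := hpw n₀ hn₀
      refine h.unip_of_pow (k := k) hvw ((hconj n₀ hn₀).2 _ hvw.symm) (hconj n₀ hn₀).1 ?_
      rw [conj_pow, hk]
      simp
    · refine hn₀' ?_
      have := h.conj_mem_K g⁻¹ hc
      simpa [mul_assoc] using this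
  have hE : E = ⊥ := h.eq_bot hxy
    (fun a ha => ⟨(hEle ha).1.1, (hEle ha).2.1⟩) (main hxy.symm (inf_comm _ _)) (main hxy rfl)
  rintro ⟨a, ha⟩
  obtain ⟨k, m, hk, hm⟩ := exists_pow_prime_pow_coprime p a
  refine ⟨k, Subtype.ext ?_⟩
  have : a ^ p ^ k ∈ E :=
    Subgroup.subset_closure ⟨pow_mem ha _, coprime_orderOf_pow hk hm hp.out.pos⟩
  rw [hE] at this
  simpa using this

end IsLocallyRankOne

end Cores

/-! ### Sections of order at most `p`. -/

section CyclicMod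

variable {G : Type*} [Group G]

/-- `A` is of exponent `p` and cyclic modulo `B`. -/
def CyclicMod (p : ℕ) (A B : Subgroup G) : Prop :=
  ∀ a ∈ A, a ^ p ∈ B ∧ (a ∉ B → ∀ g ∈ A, ∃ k : ℕ, a ^ k * g ∈ B)

theorem CyclicMod.mono {p : ℕ} {A A' B : Subgroup G} (hc : CyclicMod p A B) (hA : A' ≤ A) :
    CyclicMod p A' B :=
  fun a ha => ⟨(hc a (hA ha)).1, fun hb g hg => (hc a (hA ha)).2 hb g (hA hg)⟩

theorem CyclicMod.congr {p : ℕ} {A B B' : Subgroup G} (hc : CyclicMod p A B)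
    (hB : A ⊓ B = A ⊓ B') : CyclicMod p A B' := by
  have hiff : ∀ a ∈ A, (a ∈ B ↔ a ∈ B') := fun a ha => by
    have : a ∈ A ⊓ B ↔ a ∈ A ⊓ B' := by rw [hB]
    simpa [Subgroup.mem_inf, ha] using this
  intro a ha
  refine ⟨(hiff _ (pow_mem ha p)).mp (hc a ha).1, fun hb g hg => ?_⟩
  obtain ⟨k, hk⟩ := (hc a ha).2 (mt (hiff a ha).mp hb) g hg
  exact ⟨k, (hiff _ (mul_mem (pow_mem ha k) hg)).mp hk⟩

/-- If `a ∈ A` is outside `B`, the inverses of the powers of `a` with exponent below `p` represent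
all cosets of `A ⊓ B` in `A`. -/
theorem CyclicMod.card_le [Finite G] {p : ℕ} (hp : 0 < p) {A B : Subgroup G}
    (hc : CyclicMod p A B) : Nat.card A ≤ p * Nat.card ↥(A ⊓ B) := by
  by_cases hAB : A ≤ B
  · rw [inf_eq_left.mpr hAB]
    exact Nat.le_mul_of_pos_left _ hp
  · obtain ⟨a, ha, hb⟩ := SetLike.not_le_iff_exists.mp hAB
    let f : Fin p × ↥(A ⊓ B) → A := fun q =>
      ⟨(a ^ (q.1 : ℕ))⁻¹ * q.2.1, mul_mem (inv_mem (pow_mem ha _)) q.2.2.1⟩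
    have hf : Function.Surjective f := by
      rintro ⟨g, hg⟩
      obtain ⟨k, hk⟩ := (hc a ha).2 hb g hg
      refine ⟨⟨⟨k % p, Nat.mod_lt _ hp⟩, ⟨(a ^ (p * (k / p)))⁻¹ * (a ^ k * g), ?_, ?_⟩⟩, ?_⟩
      · exact A.mul_mem (A.inv_mem (pow_mem ha _)) (mul_mem (pow_mem ha _) hg)
      · rw [pow_mul]
        exact B.mul_mem (B.inv_mem (pow_mem (hc a ha).1 _)) hk
      · refine Subtype.ext ?_
        change (a ^ (k % p))⁻¹ * ((a ^ (p * (k / p)))⁻¹ * (a ^ k * g)) = g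
        have : a ^ k = a ^ (p * (k / p)) * a ^ (k % p) := by rw [← pow_add, Nat.div_add_mod]
        rw [this]
        group
    have := Nat.card_le_card_of_surjective f hf
    rwa [Nat.card_prod, Nat.card_fin] at this

end CyclicMod

/-! ### The `p`-groups attached to arcs and vertices. -/

section Sylow

variable {V : Type*} (Γ : SimpleGraph V) (G : Type*) [Group G] [MulAction G V] (p : ℕ)

/-- The subgroup generated by the `p`-elements fixing `x` and `y`. -/
def arcSylow (x y : V) : Subgroup G :=
  Subgroup.closure {g | g • x = x ∧ g • y = y ∧ ∃ k : ℕ, g ^ p ^ k = 1}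

/-- The subgroup generated by the `p`-elements fixing `x` and all its neighbours. -/
def fixerSylow (x : V) : Subgroup G :=
  Subgroup.closure {g | g ∈ nbrFixer Γ G x ∧ ∃ k : ℕ, g ^ p ^ k = 1}

/-- The centre of `arcSylow`. -/
def arcCenter (x y : V) : Subgroup G :=
  arcSylow G p x y ⊓ Subgroup.centralizer (arcSylow G p x y : Set G)

/-- The subgroup generated by the centres at the arcs starting at `x`. -/
def centerSpan (x : V) : Subgroup G := ⨆ y, ⨆ (_ : Γ.Adj x y), arcCenter G p x y

/-- The intersection of the centres at the arcs starting at `x`. -/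
def centerCore (x : V) : Subgroup G := ⨅ y, ⨅ (_ : Γ.Adj x y), arcCenter G p x y

local notation "𝐊" => nbrFixer Γ G
local notation "𝐒" => arcSylow G p
local notation "𝐐" => fixerSylow Γ G p
local notation "𝐂" => arcCenter G p
local notation "𝐙" => centerSpan Γ G p
local notation "𝐃" => centerCore Γ G p

variable {Γ G p}

theorem arcSylow_comm (x y : V) : 𝐒 x y = 𝐒 y x := by
  unfold arcSylow
  congr 1
  ext g
  exact ⟨fun hg => ⟨hg.2.1, hg.1, hg.2.2⟩, fun hg => ⟨hg.2.1, hg.1, hg.2.2⟩⟩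

theorem arcCenter_comm (x y : V) : 𝐂 x y = 𝐂 y x := by
  rw [arcCenter, arcCenter, arcSylow_comm]

theorem arcCenter_le (x y : V) : 𝐂 x y ≤ 𝐒 x y := inf_le_left

theorem mem_arcCenter {x y : V} {g : G} : g ∈ 𝐂 x y ↔ g ∈ 𝐒 x y ∧ ∀ a ∈ 𝐒 x y, a * g = g * a := by
  rw [arcCenter, Subgroup.mem_inf, Subgroup.mem_centralizer_iff]
  rfl

theorem arcCenter_le_centerSpan {x y : V} (hxy : Γ.Adj x y) : 𝐂 x y ≤ 𝐙 x :=
  le_iSup₂_of_le y hxy le_rfl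

theorem centerCore_le {x y : V} (hxy : Γ.Adj x y) : 𝐃 x ≤ 𝐂 x y := iInf₂_le y hxy

theorem conj_mem_arcSylow (g : G) {x y : V} {a : G} (ha : a ∈ 𝐒 x y) :
    g * a * g⁻¹ ∈ 𝐒 (g • x) (g • y) := by
  have : 𝐒 x y ≤ (𝐒 (g • x) (g • y)).comap (MulAut.conj g).toMonoidHom := by
    refine (Subgroup.closure_le _).mpr ?_
    rintro a ⟨h1, h2, k, hk⟩
    refine Subgroup.subset_closure ⟨?_, ?_, k, ?_⟩
    · simp [mul_smul, h1]
    · simp [mul_smul, h2]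
    · simp [conj_pow, hk]
  exact this ha

theorem conj_mem_arcCenter (g : G) {x y : V} {a : G} (ha : a ∈ 𝐂 x y) :
    g * a * g⁻¹ ∈ 𝐂 (g • x) (g • y) := by
  rw [mem_arcCenter] at ha ⊢
  refine ⟨conj_mem_arcSylow g ha.1, fun b hb => ?_⟩
  have hb' := conj_mem_arcSylow g⁻¹ hb
  rw [inv_smul_smul, inv_smul_smul, inv_inv] at hb'
  have := congrArg (fun t => g * t * g⁻¹) (ha.2 _ hb')
  simpa [mul_assoc] using this

namespace IsLocallyRankOne

variable (h : IsLocallyRankOne Γ G p)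
include h

theorem conj_mem_fixerSylow (g : G) {x : V} {a : G} (ha : a ∈ 𝐐 x) :
    g * a * g⁻¹ ∈ 𝐐 (g • x) := by
  have : 𝐐 x ≤ (𝐐 (g • x)).comap (MulAut.conj g).toMonoidHom := by
    refine (Subgroup.closure_le _).mpr ?_
    rintro a ⟨h1, k, hk⟩
    exact Subgroup.subset_closure ⟨h.conj_mem_K g h1, k, by simp [conj_pow, hk]⟩
  exact this ha

theorem conj_mem_centerSpan (g : G) {x : V} {a : G} (ha : a ∈ 𝐙 x) :
    g * a * g⁻¹ ∈ 𝐙 (g • x) := by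
  have : 𝐙 x ≤ (𝐙 (g • x)).comap (MulAut.conj g).toMonoidHom :=
    iSup₂_le fun y hxy a ha =>
      arcCenter_le_centerSpan (h.smul_adj g hxy) (conj_mem_arcCenter g ha)
  exact this ha

theorem conj_mem_fixerSylow_of_fix {g : G} {x : V} (hg : g • x = x) {a : G} (ha : a ∈ 𝐐 x) :
    g * a * g⁻¹ ∈ 𝐐 x := by
  have := h.conj_mem_fixerSylow g ha
  rwa [hg] at this

theorem conj_mem_centerSpan_of_fix {g : G} {x : V} (hg : g • x = x) {a : G} (ha : a ∈ 𝐙 x) :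
    g * a * g⁻¹ ∈ 𝐙 x := by
  have := h.conj_mem_centerSpan g ha
  rwa [hg] at this

variable [Finite G] [Finite V] [FaithfulSMul G V] [hp : Fact p.Prime]

/-- The product of two `p`-elements of `G_xy` has its `p`-th power in both kernels, hence in the
`p`-group `K_x ∩ K_y`. So the `p`-elements are already closed under products. -/
theorem mem_arcSylow {x y : V} (hxy : Γ.Adj x y) {g : G} :
    g ∈ 𝐒 x y ↔ g • x = x ∧ g • y = y ∧ ∃ k : ℕ, g ^ p ^ k = 1 := by
  refine ⟨fun hg => ?_, fun hg => Subgroup.subset_closure hg⟩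
  induction hg using Subgroup.closure_induction with
  | mem g hg => exact hg
  | one => exact ⟨one_smul _ _, one_smul _ _, 0, one_pow _⟩
  | inv g _ hg =>
    obtain ⟨h1, h2, k, hk⟩ := hg
    exact ⟨inv_smul_eq_iff.mpr h1.symm, inv_smul_eq_iff.mpr h2.symm, k, by simp [hk]⟩
  | mul a b _ _ ha hb =>
    obtain ⟨ha1, ha2, k, hk⟩ := ha
    obtain ⟨hb1, hb2, l, hl⟩ := hb
    refine ⟨by rw [mul_smul, hb1, ha1], by rw [mul_smul, hb2, ha2], ?_⟩
    have hax := h.unip_of_pow hxy ha1 ha2 (hk ▸ one_mem _)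
    have hay := h.unip_of_pow hxy.symm ha2 ha1 (hk ▸ one_mem _)
    have hbx := h.unip_of_pow hxy hb1 hb2 (hl ▸ one_mem _)
    have hby := h.unip_of_pow hxy.symm hb2 hb1 (hl ▸ one_mem _)
    obtain ⟨m, hm⟩ := h.isPGroup_inf hxy ⟨(a * b) ^ p, h.mul_pow_mem hxy ha1 ha2 hb1 hb2 hax hbx,
      h.mul_pow_mem hxy.symm ha2 ha1 hb2 hb1 hay hby⟩
    refine ⟨m + 1, ?_⟩
    have := congrArg Subtype.val hm
    rw [pow_succ', pow_mul]
    simpa using this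

theorem smul_left {x y : V} (hxy : Γ.Adj x y) {g : G} (hg : g ∈ 𝐒 x y) : g • x = x :=
  ((h.mem_arcSylow hxy).mp hg).1

theorem smul_right {x y : V} (hxy : Γ.Adj x y) {g : G} (hg : g ∈ 𝐒 x y) : g • y = y :=
  ((h.mem_arcSylow hxy).mp hg).2.1

theorem isPGroup_arcSylow {x y : V} (hxy : Γ.Adj x y) : IsPGroup p (𝐒 x y) := by
  rintro ⟨g, hg⟩
  obtain ⟨-, -, k, hk⟩ := (h.mem_arcSylow hxy).mp hg
  exact ⟨k, Subtype.ext hk⟩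

theorem mem_fixerSylow_iff {x y : V} (hxy : Γ.Adj x y) {g : G} :
    g ∈ 𝐐 x ↔ g ∈ 𝐒 x y ∧ g ∈ 𝐊 x := by
  refine ⟨fun hg => ?_, fun hg => Subgroup.subset_closure ⟨hg.2, ?_⟩⟩
  · have : 𝐐 x ≤ 𝐒 x y ⊓ 𝐊 x := (Subgroup.closure_le _).mpr fun g hg =>
      ⟨Subgroup.subset_closure ⟨hg.1.1, hg.1.2 y hxy, hg.2⟩, hg.1⟩
    exact this hg
  · exact ((h.mem_arcSylow hxy).mp hg.1).2.2

theorem fixerSylow_le {x y : V} (hxy : Γ.Adj x y) : 𝐐 x ≤ 𝐒 x y :=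
  fun _ hg => ((h.mem_fixerSylow_iff hxy).mp hg).1

theorem fixerSylow_le' {x y : V} (hxy : Γ.Adj x y) : 𝐐 y ≤ 𝐒 x y :=
  arcSylow_comm (p := p) (G := G) x y ▸ h.fixerSylow_le hxy.symm

theorem fixerSylow_le_nbrFixer {x y : V} (hxy : Γ.Adj x y) : 𝐐 x ≤ 𝐊 x :=
  fun _ hg => ((h.mem_fixerSylow_iff hxy).mp hg).2

theorem pow_mem_nbrFixer {x y : V} (hxy : Γ.Adj x y) {g : G} (hg : g ∈ 𝐒 x y) : g ^ p ∈ 𝐊 x := by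
  obtain ⟨h1, h2, k, hk⟩ := (h.mem_arcSylow hxy).mp hg
  exact h.unip_of_pow hxy h1 h2 (hk ▸ one_mem _)

theorem cyclicMod {x y : V} (hxy : Γ.Adj x y) : CyclicMod p (𝐒 x y) (𝐐 x) := by
  intro a ha
  have hap := h.pow_mem_nbrFixer hxy ha
  refine ⟨(h.mem_fixerSylow_iff hxy).mpr ⟨pow_mem ha p, hap⟩, fun hb g hg => ?_⟩
  rw [h.mem_fixerSylow_iff hxy, not_and] at hb
  obtain ⟨k, hk⟩ := h.cyclic hxy (h.smul_left hxy ha) (h.smul_right hxy ha) (h.smul_left hxy hg)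
    (h.smul_right hxy hg) hap (h.pow_mem_nbrFixer hxy hg) (hb ha)
  exact ⟨k, (h.mem_fixerSylow_iff hxy).mpr ⟨mul_mem (pow_mem ha k) hg, hk⟩⟩

theorem cyclicMod' {x y : V} (hxy : Γ.Adj x y) : CyclicMod p (𝐒 x y) (𝐐 y) := by
  rw [arcSylow_comm]
  exact h.cyclicMod hxy.symm

theorem exists_notMem_fixerSylow {x y : V} (hxy : Γ.Adj x y) : ∃ a ∈ 𝐒 x y, a ∉ 𝐐 x := by
  obtain ⟨u, hux, huy, hup, hu⟩ := h.exists_unip hxy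
  -- The `p`-part `u ^ m` does the job: if it were in the kernel, then since `u ^ p` is there too,
  -- Bézout for the coprime `p` and `m` would put `u` itself there.
  obtain ⟨k, m, hk, hm⟩ := exists_pow_prime_pow_coprime p u
  have hfix : ∀ z : V, u • z = z → u ^ m • z = z := fun z hz =>
    pow_mem (MulAction.mem_stabilizer_iff.mpr hz) m
  refine ⟨u ^ m, (h.mem_arcSylow hxy).mpr ⟨hfix x hux, hfix y huy, k, ?_⟩, fun hc => hu ?_⟩
  · rw [← pow_mul, mul_comm, ← hk, pow_orderOf_eq_one]
  · have h1 := h.fixerSylow_le_nbrFixer hxy hc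
    have hz : (u : G) ^ ((p : ℤ) * p.gcdA m + m * p.gcdB m) ∈ 𝐊 x := by
      rw [zpow_add, zpow_mul, zpow_mul, zpow_natCast, zpow_natCast]
      exact mul_mem (zpow_mem hup _) (zpow_mem h1 _)
    rw [← Nat.gcd_eq_gcd_ab, hm] at hz
    simpa using hz

/-- `S_xy` is generated by `a` and `Q_x`, and `Q_x` does not depend on `y`. Equality of arc groups
thus plays the role of "same direction at `x`". -/
theorem arcSylow_eq_of_smul_eq {x y z : V} (hxy : Γ.Adj x y) (hxz : Γ.Adj x z) {a : G}
    (ha : a ∈ 𝐒 x y) (hb : a ∉ 𝐐 x) (haz : a • z = z) : 𝐒 x y = 𝐒 x z := by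
  have ha' : a ∈ 𝐒 x z := by
    obtain ⟨h1, -, h3⟩ := (h.mem_arcSylow hxy).mp ha
    exact (h.mem_arcSylow hxz).mpr ⟨h1, haz, h3⟩
  have key : ∀ {u v : V}, Γ.Adj x u → Γ.Adj x v → a ∈ 𝐒 x u → a ∈ 𝐒 x v → 𝐒 x u ≤ 𝐒 x v := by
    intro u v hu hv hau hav g hg
    obtain ⟨k, hk⟩ := (h.cyclicMod hu a hau).2 hb g hg
    have := mul_mem (inv_mem (pow_mem hav k)) (h.fixerSylow_le hv hk)
    simpa using this
  exact le_antisymm (key hxy hxz ha ha') (key hxz hxy ha' ha)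

theorem trans_of_two {x y z : V} {a b : G} (A : Subgroup G) (hxy : Γ.Adj x y) (hxz : Γ.Adj x z)
    (hA : ∀ g ∈ A, g • x = x) (ha : a ∈ A) (haS : a ∈ 𝐒 x y) (haQ : a ∉ 𝐐 x)
    (hb : b ∈ A) (hbS : b ∈ 𝐒 x z) (hbQ : b ∉ 𝐐 x) (hne : 𝐒 x y ≠ 𝐒 x z) :
    TransOnNbrs Γ A x := by
  intro z₁ z₂ h₁ h₂
  refine h.transitive A hxy hxz hA ha (h.smul_right hxy haS) (h.pow_mem_nbrFixer hxy haS) ?_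
    hb (h.smul_right hxz hbS) (h.pow_mem_nbrFixer hxz hbS) ?_ ?_ h₁ h₂
  · exact fun hc => haQ ((h.mem_fixerSylow_iff hxy).mpr ⟨haS, hc⟩)
  · exact fun hc => hbQ ((h.mem_fixerSylow_iff hxz).mpr ⟨hbS, hc⟩)
  · exact fun hc => hne (h.arcSylow_eq_of_smul_eq hxy hxz haS haQ hc)

theorem trans_of_sylow {x y z : V} (A : Subgroup G) (hxy : Γ.Adj x y) (hxz : Γ.Adj x z)
    (hy : 𝐒 x y ≤ A) (hz : 𝐒 x z ≤ A) (hne : 𝐒 x y ≠ 𝐒 x z) :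
    TransOnNbrs Γ (MulAction.stabilizer G x ⊓ A) x := by
  obtain ⟨a, ha, haQ⟩ := h.exists_notMem_fixerSylow hxy
  obtain ⟨b, hb, hbQ⟩ := h.exists_notMem_fixerSylow hxz
  exact h.trans_of_two _ hxy hxz (fun g hg => hg.1) ⟨h.smul_left hxy ha, hy ha⟩ ha haQ
    ⟨h.smul_left hxz hb, hz hb⟩ hb hbQ hne

theorem trans_of_invariant {x y : V} (A : Subgroup G)
    (hn : ∀ g : G, g • x = x → ∀ a ∈ A, g * a * g⁻¹ ∈ A) (hxy : Γ.Adj x y) {a : G} (ha : a ∈ A)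
    (haS : a ∈ 𝐒 x y) (haQ : a ∉ 𝐐 x) : TransOnNbrs Γ (MulAction.stabilizer G x ⊓ A) x := by
  have hax := h.smul_left hxy haS
  refine h.trans_of_normal (y := y) (a := a) _ (fun g hg => hg.1) (fun g hg b hb => ⟨?_, hn g hg b hb.2⟩)
    hxy ⟨hax, ha⟩ (h.smul_right hxy haS) (h.pow_mem_nbrFixer hxy haS)
    fun hc => haQ ((h.mem_fixerSylow_iff hxy).mpr ⟨haS, hc⟩)
  have hb1 : b • x = x := hb.1
  change (g * b * g⁻¹) • x = x
  rw [mul_smul, mul_smul, inv_smul_eq_iff.mpr hg.symm, hb1, hg]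

theorem exists_directions {x y : V} (hxy : Γ.Adj x y) : ∃ z₁ z₂ : V, Γ.Adj x z₁ ∧ Γ.Adj x z₂ ∧
    𝐒 x y ≠ 𝐒 x z₁ ∧ 𝐒 x y ≠ 𝐒 x z₂ ∧ 𝐒 x z₁ ≠ 𝐒 x z₂ := by
  obtain ⟨z₁, z₂, h₁, h₂, hd, hd'⟩ := h.directions hxy
  have notK : ∀ {w : V} {a : G}, Γ.Adj x w → a ∈ 𝐒 x w → a ∉ 𝐐 x → a ∉ 𝐊 x :=
    fun hw ha haQ hc => haQ ((h.mem_fixerSylow_iff hw).mpr ⟨ha, hc⟩)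
  obtain ⟨a, ha, haQ⟩ := h.exists_notMem_fixerSylow hxy
  obtain ⟨b, hb, hbQ⟩ := h.exists_notMem_fixerSylow h₁
  have had := hd a (h.smul_left hxy ha) (h.smul_right hxy ha) (h.pow_mem_nbrFixer hxy ha)
    (notK hxy ha haQ)
  have hbd := hd' b (h.smul_left h₁ hb) (h.smul_right h₁ hb) (h.pow_mem_nbrFixer h₁ hb)
    (notK h₁ hb hbQ)
  refine ⟨z₁, z₂, h₁, h₂, fun e => had.1 ?_, fun e => had.2 ?_, fun e => hbd ?_⟩
  · exact h.smul_right h₁ (e ▸ ha)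
  · exact h.smul_right h₂ (e ▸ ha)
  · exact h.smul_right h₂ (e ▸ hb)

end IsLocallyRankOne

end Sylow

/-! ### Critical pairs. -/

section Amalgam

variable {V : Type*} {Γ : SimpleGraph V} {G : Type*} [Group G] [MulAction G V] {p : ℕ}

local notation "𝐊" => nbrFixer Γ G
local notation "𝐒" => arcSylow G p
local notation "𝐐" => fixerSylow Γ G p
local notation "𝐂" => arcCenter G p
local notation "𝐙" => centerSpan Γ G p
local notation "𝐃" => centerCore Γ G p

/-- The centres of the arc groups act trivially on the neighbourhoods. -/
def CentersInFixers (Γ : SimpleGraph V) (G : Type*) [Group G] [MulAction G V] (p : ℕ) : Prop :=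
  ∀ x y : V, Γ.Adj x y → arcCenter G p x y ≤ fixerSylow Γ G p x

theorem centerSpan_le (hC : CentersInFixers Γ G p) (x : V) : 𝐙 x ≤ 𝐐 x :=
  iSup₂_le fun _ hxy => hC _ _ hxy

/-- Companion of `CyclicMod p A B`: an element commuting with `A ∩ B` and with one element of `A`
outside `B` commutes with all of `A`. -/
theorem Commute.of_pow_mul {g a t : G} {k : ℕ} (ha : Commute a t)
    (h : Commute (a ^ k * g) t) : Commute g t := by
  have := (ha.pow_left k).inv_left.mul_left h
  rwa [inv_mul_cancel_left] at this

theorem mem_normalizer_of_forall_commute {H : Subgroup G} {g : G}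
    (h : ∀ a ∈ H, Commute g a) : g ∈ Subgroup.normalizer (H : Set G) := by
  rw [Subgroup.mem_normalizer_iff]
  have h1 : ∀ a ∈ H, g * a * g⁻¹ = a := fun a ha => by rw [(h a ha).eq, mul_inv_cancel_right]
  refine fun a => ⟨fun ha => by rwa [h1 a ha], fun ha => ?_⟩
  have := h1 _ ha
  have h2 : g * a * g⁻¹ = a := by
    have := congrArg (fun t => g⁻¹ * t * g) this
    simpa [mul_assoc] using this
  rwa [h2] at ha

theorem commute_arcCenter {x y : V} {c a : G} (hc : c ∈ 𝐂 x y) (ha : a ∈ 𝐒 x y) : Commute a c :=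
  (mem_arcCenter.mp hc).2 a ha

namespace IsLocallyRankOne

variable (h : IsLocallyRankOne Γ G p)
variable [Finite G] [Finite V] [FaithfulSMul G V] [hp : Fact p.Prime]
include h

theorem arcCenter_ne_bot {x y : V} (hxy : Γ.Adj x y) : 𝐂 x y ≠ ⊥ := by
  obtain ⟨a, ha, haQ⟩ := h.exists_notMem_fixerSylow hxy
  have : Nontrivial (𝐒 x y) :=
    ⟨⟨⟨a, ha⟩, 1, fun e => haQ (by rw [show a = 1 from congrArg Subtype.val e]; exact one_mem _)⟩⟩
  have := (h.isPGroup_arcSylow hxy).center_nontrivial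
  obtain ⟨⟨⟨c, hc⟩, hc'⟩, hne⟩ := exists_ne (1 : Subgroup.center (𝐒 x y))
  intro hb
  have hmem : c ∈ 𝐂 x y := by
    refine mem_arcCenter.mpr ⟨hc, fun b hb => ?_⟩
    exact congrArg Subtype.val (Subgroup.mem_center_iff.mp hc' ⟨b, hb⟩)
  rw [hb, Subgroup.mem_bot] at hmem
  exact hne (Subtype.ext (Subtype.ext hmem))

theorem trans_transport {x w : V} {H : Subgroup G} {t : G} (ht : t • x = w)
    (htH : t ∈ Subgroup.normalizer (H : Set G))
    (hx : TransOnNbrs Γ (MulAction.stabilizer G x ⊓ Subgroup.normalizer (H : Set G)) x) :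
    TransOnNbrs Γ (MulAction.stabilizer G w ⊓ Subgroup.normalizer (H : Set G)) w := by
  intro z₁ z₂ h₁ h₂
  subst ht
  have e₁ : Γ.Adj x (t⁻¹ • z₁) := by simpa using h.smul_adj t⁻¹ h₁
  have e₂ : Γ.Adj x (t⁻¹ • z₂) := by simpa using h.smul_adj t⁻¹ h₂
  obtain ⟨g, hg, e⟩ := hx e₁ e₂
  have hgx : g • x = x := hg.1
  refine ⟨t * g * t⁻¹, ⟨?_, Subgroup.mul_mem _ (Subgroup.mul_mem _ htH hg.2) (Subgroup.inv_mem _ htH)⟩, ?_⟩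
  · change (t * g * t⁻¹) • t • x = t • x
    rw [mul_smul, mul_smul, inv_smul_smul, hgx]
  · rw [mul_smul, mul_smul, e, smul_inv_smul]

/-- If the centre of an arc group is not in the kernel, the arc group has order at most `p²`. -/
theorem card_le_of_center_not_le {x y : V} (hxy : Γ.Adj x y) (hC : ¬ 𝐂 x y ≤ 𝐐 x) :
    Nat.card (𝐒 x y) ≤ p ^ 2 := by
  -- The centraliser of `Q_u` is invariant under `G_u` and contains a conjugate of `c`, which acts
  -- nontrivially around `u`. So it is locally transitive, and it normalises every subgroup of
  -- `Q_u`.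
  have key : ∀ {u v : V}, Γ.Adj u v → ∀ H : Subgroup G, H ≤ 𝐐 u →
      TransOnNbrs Γ (MulAction.stabilizer G u ⊓ Subgroup.normalizer (H : Set G)) u := by
    intro u v huv H hH
    obtain ⟨g, rfl, rfl⟩ := h.exists_smul_arc hxy huv
    obtain ⟨c, hc, hcQ⟩ := SetLike.not_le_iff_exists.mp hC
    have hc' := conj_mem_arcCenter g hc
    refine TransOnNbrs.mono (h.trans_of_invariant
      (Subgroup.centralizer (𝐐 (g • x) : Set G)) ?_ huv (a := g * c * g⁻¹) ?_
      (arcCenter_le _ _ hc') ?_) ?_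
    · intro k hk a ha
      rw [Subgroup.mem_centralizer_iff] at ha ⊢
      intro q hq
      have := ha _ (h.conj_mem_fixerSylow_of_fix (inv_smul_eq_iff.mpr hk.symm) hq)
      have := congrArg (fun t => k * t * k⁻¹) this
      simpa [mul_assoc] using this
    · rw [Subgroup.mem_centralizer_iff]
      exact fun q hq => commute_arcCenter hc' (h.fixerSylow_le huv hq)
    · intro hc
      have := h.conj_mem_fixerSylow g⁻¹ hc
      rw [inv_smul_smul] at this
      exact hcQ (by simpa [mul_assoc] using this)
    · refine inf_le_inf_left _ fun a ha => mem_normalizer_of_forall_commute fun b hb => ?_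
      exact (Subgroup.mem_centralizer_iff.mp ha b (hH hb)).symm
  have hbot : 𝐐 x ⊓ 𝐐 y = ⊥ := h.eq_bot hxy
    (fun a ha => ⟨h.smul_left hxy (h.fixerSylow_le hxy ha.1),
      h.smul_right hxy (h.fixerSylow_le hxy ha.1)⟩)
    (key hxy _ inf_le_left) (key hxy.symm _ inf_le_right)
  have h1 := (h.cyclicMod hxy).card_le hp.out.pos
  have h2 := ((h.cyclicMod' hxy).mono (inf_le_left (b := 𝐐 x))).card_le hp.out.pos
  have h3 : 𝐒 x y ⊓ 𝐐 x ⊓ 𝐐 y = ⊥ := by rw [inf_assoc, hbot, inf_bot_eq]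
  rw [h3, Subgroup.card_bot, mul_one] at h2
  calc Nat.card (𝐒 x y) ≤ p * Nat.card ↥(𝐒 x y ⊓ 𝐐 x) := h1
    _ ≤ p * p := Nat.mul_le_mul_left _ h2
    _ = p ^ 2 := (sq p).symm

theorem commute_centerSpan {x : V} {z q : G} (hz : z ∈ 𝐙 x) (hq : q ∈ 𝐐 x) : Commute z q := by
  have : 𝐙 x ≤ Subgroup.centralizer (𝐐 x : Set G) := by
    refine iSup₂_le fun y hxy c hc => ?_
    rw [Subgroup.mem_centralizer_iff]
    exact fun q hq => commute_arcCenter hc (h.fixerSylow_le hxy hq)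
  exact (Subgroup.mem_centralizer_iff.mp (this hz) q hq).symm

theorem centerSpan_ne_bot {x y : V} (hxy : Γ.Adj x y) : 𝐙 x ≠ ⊥ := fun hb =>
  h.arcCenter_ne_bot hxy (le_bot_iff.mp (hb ▸ arcCenter_le_centerSpan hxy))

/-- The common element is centralised by two arc groups in different directions. These generate a
group transitive on the neighbours of `x`, and conjugation by it carries the element, unchanged,
into the centre at every arc from `x`. -/
theorem arcCenter_inf_le_centerCore {x y z : V} (hxy : Γ.Adj x y) (hxz : Γ.Adj x z)
    (hne : 𝐒 x y ≠ 𝐒 x z) : 𝐂 x y ⊓ 𝐂 x z ≤ 𝐃 x := by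
  intro d hd
  simp only [centerCore, Subgroup.mem_iInf]
  intro w hw
  have ht := h.trans_of_sylow (Subgroup.centralizer {d}) hxy hxz
    (fun a ha => Subgroup.mem_centralizer_singleton_iff.mpr (commute_arcCenter hd.1 ha))
    (fun a ha => Subgroup.mem_centralizer_singleton_iff.mpr (commute_arcCenter hd.2 ha)) hne
  obtain ⟨g, ⟨hgx, hg⟩, e⟩ := ht hxy hw
  have := conj_mem_arcCenter g hd.1
  rw [Subgroup.mem_centralizer_singleton_iff.mp hg, mul_inv_cancel_right, e,
    show g • x = x from hgx] at this
  exact this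

/-- Every subgroup of `D_u` is centralised by all arc groups at `u`, so the intersection is
normalised locally transitively at both ends. -/
theorem centerCore_inf_centerCore {x y : V} (hxy : Γ.Adj x y) : 𝐃 x ⊓ 𝐃 y = ⊥ := by
  have key : ∀ {u v : V}, Γ.Adj u v → ∀ H : Subgroup G, H ≤ 𝐃 u →
      TransOnNbrs Γ (MulAction.stabilizer G u ⊓ Subgroup.normalizer (H : Set G)) u := by
    intro u v huv H hH
    obtain ⟨z, _, hz, _, hne, _⟩ := h.exists_directions huv
    refine h.trans_of_sylow _ huv hz (fun a ha => ?_) (fun a ha => ?_) hne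
    · exact mem_normalizer_of_forall_commute fun b hb =>
        commute_arcCenter (centerCore_le huv (hH hb)) ha
    · exact mem_normalizer_of_forall_commute fun b hb =>
        commute_arcCenter (centerCore_le hz (hH hb)) ha
  refine h.eq_bot hxy (fun a ha => ?_) (key hxy _ inf_le_left) (key hxy.symm _ inf_le_right)
  have := arcCenter_le _ _ (centerCore_le hxy ha.1)
  exact ⟨h.smul_left hxy this, h.smul_right hxy this⟩

end IsLocallyRankOne

/-- The groups `𝐙 x` and `𝐙 y` act on the neighbourhoods of `y` and `x`, fixing `y'` and `x'`, and
`𝐙 x` acts nontrivially. -/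
structure IsCritical (Γ : SimpleGraph V) (G : Type*) [Group G] [MulAction G V] (p : ℕ)
    (x x' y y' : V) : Prop where
  adj_left : Γ.Adj x x'
  adj_right : Γ.Adj y y'
  le_right : centerSpan Γ G p x ≤ arcSylow G p y y'
  le_left : centerSpan Γ G p y ≤ arcSylow G p x x'
  not_le : ¬ centerSpan Γ G p x ≤ fixerSylow Γ G p y

variable (h : IsLocallyRankOne Γ G p)
variable [Finite G] [Finite V] [FaithfulSMul G V] [hp : Fact p.Prime]
include h
variable (hC : CentersInFixers Γ G p)
include hC

omit hC in
theorem IsCritical.smul {x x' y y' : V} (hc : IsCritical Γ G p x x' y y') (g : G) :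
    IsCritical Γ G p (g • x) (g • x') (g • y) (g • y') where
  adj_left := h.smul_adj g hc.adj_left
  adj_right := h.smul_adj g hc.adj_right
  le_right z hz := by
    have := h.conj_mem_centerSpan g⁻¹ hz
    rw [inv_smul_smul] at this
    have := conj_mem_arcSylow g (hc.le_right this)
    simpa [mul_assoc] using this
  le_left z hz := by
    have := h.conj_mem_centerSpan g⁻¹ hz
    rw [inv_smul_smul] at this
    have := conj_mem_arcSylow g (hc.le_left this)
    simpa [mul_assoc] using this
  not_le hle := hc.not_le fun z hz => by
    have := h.conj_mem_fixerSylow g⁻¹ (hle (h.conj_mem_centerSpan g hz))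
    rw [inv_smul_smul] at this
    simpa [mul_assoc] using this

/-- If they commuted, an element of `Z_x` outside `Q_y` would make the centraliser of `Z_y` locally
transitive at `y`, and likewise at every vertex. The centre at an arc lies in the span at both of
its ends, so it would be trivial. -/
theorem IsCritical.exists_not_commute {x x' y y' : V} (hc : IsCritical Γ G p x x' y y') :
    ∃ z ∈ 𝐙 x, ∃ w ∈ 𝐙 y, ¬ Commute z w := by
  by_contra! hcom
  obtain ⟨c, hcZ, hcQ⟩ := SetLike.not_le_iff_exists.mp hc.not_le
  have key : ∀ {u v : V}, Γ.Adj u v → ∀ H : Subgroup G, H ≤ 𝐙 u →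
      TransOnNbrs Γ (MulAction.stabilizer G u ⊓ Subgroup.normalizer (H : Set G)) u := by
    intro u v huv H hH
    obtain ⟨g, rfl⟩ := h.exists_smul y u
    have hadj := h.smul_adj g hc.adj_right
    have hcS := conj_mem_arcSylow g (hc.le_right hcZ)
    refine TransOnNbrs.mono (h.trans_of_invariant
      (Subgroup.centralizer (𝐙 (g • y) : Set G)) ?_ hadj (a := g * c * g⁻¹) ?_
      hcS ?_) ?_
    · intro k hk a ha
      rw [Subgroup.mem_centralizer_iff] at ha ⊢
      intro q hq
      have := ha _ (h.conj_mem_centerSpan_of_fix (inv_smul_eq_iff.mpr hk.symm) hq)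
      have := congrArg (fun t => k * t * k⁻¹) this
      simpa [mul_assoc] using this
    · rw [Subgroup.mem_centralizer_iff]
      intro q hq
      have := h.conj_mem_centerSpan g⁻¹ hq
      rw [inv_smul_smul] at this
      have := congrArg (fun t => g * t * g⁻¹) (hcom c hcZ _ this).eq
      simpa [mul_assoc] using this.symm
    · intro hc
      have := h.conj_mem_fixerSylow g⁻¹ hc
      rw [inv_smul_smul] at this
      exact hcQ (by simpa [mul_assoc] using this)
    · refine inf_le_inf_left _ fun a ha => mem_normalizer_of_forall_commute fun b hb => ?_
      exact (Subgroup.mem_centralizer_iff.mp ha b (hH hb)).symm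
  have hxy := hc.adj_left
  refine h.arcCenter_ne_bot hxy (h.eq_bot hxy (fun a ha => ?_)
    (key hxy _ (arcCenter_le_centerSpan hxy))
    (key hxy.symm _ (arcCenter_comm (p := p) (G := G) x x' ▸ arcCenter_le_centerSpan hxy.symm)))
  exact ⟨h.smul_left hxy (arcCenter_le _ _ ha), h.smul_right hxy (arcCenter_le _ _ ha)⟩

theorem IsCritical.symm {x x' y y' : V} (hc : IsCritical Γ G p x x' y y') :
    IsCritical Γ G p y y' x x' where
  adj_left := hc.adj_right
  adj_right := hc.adj_left
  le_right := hc.le_left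
  le_left := hc.le_right
  not_le hle := by
    obtain ⟨z, hz, w, hw, hne⟩ := hc.exists_not_commute h hC
    exact hne (h.commute_centerSpan hz (hle hw))

/-- An element `w` of `Z_y` outside `Q_x` generates `S_xx'` together with `Q_x`. What lies in `Z_x ∩
Q_y` commutes with both. Conversely, an element of `Z_x` outside `Q_y` that is central in `S_xx'`
would make `Z_x` commute with `Z_y`. -/
theorem IsCritical.inf_eq {x x' y y' : V} (hc : IsCritical Γ G p x x' y y') :
    𝐙 x ⊓ 𝐐 y = 𝐙 x ⊓ 𝐂 x x' := by
  refine Subgroup.ext fun z => ⟨fun hz => ⟨hz.1, ?_⟩, fun hz => ⟨hz.1, ?_⟩⟩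
  · obtain ⟨w, hw, hwQ⟩ := SetLike.not_le_iff_exists.mp (hc.symm h hC).not_le
    refine mem_arcCenter.mpr ⟨h.fixerSylow_le hc.adj_left (centerSpan_le hC x hz.1), fun a ha => ?_⟩
    obtain ⟨k, hk⟩ := (h.cyclicMod hc.adj_left w (hc.le_left hw)).2 hwQ a ha
    exact Commute.of_pow_mul (h.commute_centerSpan hw hz.2) (h.commute_centerSpan hz.1 hk).symm
  · by_contra hzQ
    obtain ⟨u, hu, w, hw, hne⟩ := hc.exists_not_commute h hC
    obtain ⟨k, hk⟩ := (h.cyclicMod hc.adj_right z (hc.le_right hz.1)).2 hzQ u (hc.le_right hu)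
    exact hne (Commute.of_pow_mul (commute_arcCenter hz.2 (hc.le_left hw)).symm
      (h.commute_centerSpan hw hk).symm)

/-- The commutator of non-commuting elements of `Z_x` and `Z_y` lies in `Z_x ∩ Z_y`, and `inf_eq`
applies from both sides. -/
theorem IsCritical.exists_ne_one {x x' y y' : V} (hc : IsCritical Γ G p x x' y y') :
    ∃ r ≠ 1, r ∈ 𝐂 x x' ∧ r ∈ 𝐂 y y' := by
  obtain ⟨z, hz, w, hw, hne⟩ := hc.exists_not_commute h hC
  have hwx := h.smul_left hc.adj_left (hc.le_left hw)
  have hzy := h.smul_left hc.adj_right (hc.le_right hz)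
  have hrx : z * w * z⁻¹ * w⁻¹ ∈ 𝐙 x := by
    have := mul_mem hz (h.conj_mem_centerSpan_of_fix hwx (inv_mem hz))
    simpa [mul_assoc] using this
  have hry : z * w * z⁻¹ * w⁻¹ ∈ 𝐙 y :=
    mul_mem (h.conj_mem_centerSpan_of_fix hzy hw) (inv_mem hw)
  refine ⟨z * w * z⁻¹ * w⁻¹, fun e => hne ?_, ?_, ?_⟩
  · rw [mul_inv_eq_one, mul_inv_eq_iff_eq_mul] at e
    exact e
  · exact (((hc.inf_eq h hC).le ⟨hrx, centerSpan_le hC y hry⟩ : _) : _ ∈ 𝐙 x ⊓ 𝐂 x x').2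
  · exact ((((hc.symm h hC).inf_eq h hC).le ⟨hry, centerSpan_le hC x hrx⟩ : _) :
      _ ∈ 𝐙 y ⊓ 𝐂 y y').2

theorem IsCritical.cyclicMod {x x' y y' : V} (hc : IsCritical Γ G p x x' y y') {u v : V}
    (huv : Γ.Adj u v) : CyclicMod p (𝐙 u) (𝐂 u v) := by
  obtain ⟨g, rfl, rfl⟩ := h.exists_smul_arc hc.adj_left huv
  have hc' := IsCritical.smul h hc g
  exact ((h.cyclicMod hc'.adj_right).mono hc'.le_right).congr (hc'.inf_eq h hC)

theorem IsCritical.not_le_arcCenter {x x' y y' : V} (hc : IsCritical Γ G p x x' y y') {u v : V}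
    (huv : Γ.Adj u v) : ¬ 𝐙 u ≤ 𝐂 u v := by
  obtain ⟨g, rfl, rfl⟩ := h.exists_smul_arc hc.adj_left huv
  have hc' := IsCritical.smul h hc g
  intro hle
  have := hc'.inf_eq h hC
  rw [inf_eq_left.mpr hle, inf_eq_left] at this
  exact hc'.not_le this

theorem IsCritical.not_le_centerCore {x x' y y' : V} (hc : IsCritical Γ G p x x' y y') {u v : V}
    (huv : Γ.Adj u v) : ¬ 𝐂 u v ≤ 𝐃 u := by
  intro hle
  refine hc.not_le_arcCenter h hC huv (iSup₂_le fun w hw a ha => ?_)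
  obtain ⟨g, hg, rfl⟩ := h.exists_smul_nbr huv hw
  have hg' : g⁻¹ • u = u := inv_smul_eq_iff.mpr hg.symm
  have h1 := conj_mem_arcCenter g⁻¹ ha
  rw [inv_smul_smul, hg'] at h1
  have hadj : Γ.Adj u (g⁻¹ • v) := by simpa [hg'] using h.smul_adj g⁻¹ huv
  have h2 := conj_mem_arcCenter g (centerCore_le hadj (hle h1))
  rw [smul_inv_smul, hg] at h2
  simpa [mul_assoc] using h2

/-- `D_v` lies in `Z_u`, and it meets the centre at another direction `z` from `u` inside `D_u ∩ D_v
= 1`; the section of `Z_u` by that centre has order at most `p`. -/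
theorem IsCritical.card_centerCore_le {x x' y y' : V} (hc : IsCritical Γ G p x x' y y') {u v : V}
    (huv : Γ.Adj u v) : Nat.card (𝐃 v) ≤ p := by
  obtain ⟨z, _, hz, _, hne, _⟩ := h.exists_directions huv
  have hle : 𝐃 v ≤ 𝐂 u v := arcCenter_comm (p := p) (G := G) v u ▸ centerCore_le huv.symm
  have h1 := ((hc.cyclicMod h hC hz).mono
    (hle.trans (arcCenter_le_centerSpan huv))).card_le hp.out.pos
  have h2 : 𝐃 v ⊓ 𝐂 u z = ⊥ := by
    refine le_bot_iff.mp ?_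
    rw [← h.centerCore_inf_centerCore huv]
    exact le_inf ((inf_le_inf_right _ hle).trans (h.arcCenter_inf_le_centerCore huv hz hne))
      inf_le_left
  rwa [h2, Subgroup.card_bot, mul_one] at h1

theorem IsCritical.card_arcCenter_le {x x' y y' : V} (hc : IsCritical Γ G p x x' y y') {u v : V}
    (huv : Γ.Adj u v) : Nat.card (𝐂 u v) ≤ p ^ 2 := by
  obtain ⟨z, _, hz, _, hne, _⟩ := h.exists_directions huv
  have h1 := ((hc.cyclicMod h hC hz).mono (arcCenter_le_centerSpan huv)).card_le hp.out.pos
  have h2 := Subgroup.card_le_of_le (h.arcCenter_inf_le_centerCore huv hz hne)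
  calc Nat.card (𝐂 u v) ≤ p * Nat.card ↥(𝐂 u v ⊓ 𝐂 u z) := h1
    _ ≤ p * p := Nat.mul_le_mul_left _ (h2.trans (hc.card_centerCore_le h hC huv.symm))
    _ = p ^ 2 := (sq p).symm

/-- Critical pairs can be shifted along an edge in a different direction. -/
theorem IsCritical.shift {x x' y y' w : V} (hc : IsCritical Γ G p x x' y y') (hw : Γ.Adj x w)
    (hne : 𝐒 x w ≠ 𝐒 x x') : ¬ 𝐙 w ≤ 𝐐 y' := by
  intro hle
  have hwS : 𝐙 w ≤ 𝐒 y y' := hle.trans (h.fixerSylow_le' hc.adj_right)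
  -- Under the contrary assumption `W` is normalised by `S_xw` and by `Z_y`, which act around `x` in
  -- different directions. An automorphism swapping `x` and `w` also normalises `W`, so local
  -- transitivity holds at both ends and `W` would be trivial.
  let W := 𝐙 x ⊔ 𝐙 w
  have hZx : 𝐙 x ≤ W := le_sup_left
  have hZw : 𝐙 w ≤ W := le_sup_right
  have hW : ∀ g : G, g • x = x → (∀ a ∈ 𝐙 w, g * a * g⁻¹ ∈ W) →
      g ∈ Subgroup.normalizer (W : Set G) := by
    intro g hg hgw
    refine mem_normalizer_of_conj_mem fun a ha => ?_
    have : W ≤ W.comap (MulAut.conj g).toMonoidHom :=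
      sup_le (fun a ha => hZx (h.conj_mem_centerSpan_of_fix hg ha)) fun a ha => hgw a ha
    exact this ha
  have hS : 𝐒 x w ≤ Subgroup.normalizer (W : Set G) := fun g hg =>
    hW g (h.smul_left hw hg) fun a ha =>
      hZw (h.conj_mem_centerSpan_of_fix (h.smul_right hw hg) ha)
  obtain ⟨c, hcZ, hcQ⟩ := SetLike.not_le_iff_exists.mp hc.not_le
  have hZy : 𝐙 y ≤ Subgroup.normalizer (W : Set G) := by
    intro z hz
    have hzx := h.smul_left hc.adj_left (hc.le_left hz)
    refine hW z hzx fun a ha => ?_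
    -- Up to a power of `c ∈ Z_x`, the element `a` lies in `Q_y` and commutes with `Z_y`. So
    -- conjugation by `z` changes `a` only by an element of `Z_x`.
    obtain ⟨k, hk⟩ := (h.cyclicMod hc.adj_right c (hc.le_right hcZ)).2 hcQ a (hwS ha)
    have e : z * a * z⁻¹ = z * (c ^ k)⁻¹ * z⁻¹ * c ^ k * a := by
      have := (h.commute_centerSpan hz hk).eq
      calc z * a * z⁻¹ = z * (c ^ k)⁻¹ * z⁻¹ * (z * (c ^ k * a)) * z⁻¹ := by group
        _ = _ := by rw [this]; group
    rw [e]
    exact mul_mem (hZx (mul_mem (h.conj_mem_centerSpan_of_fix hzx (inv_mem (pow_mem hcZ k)))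
      (pow_mem hcZ k))) (hZw ha)
  obtain ⟨a, ha, haQ⟩ := SetLike.not_le_iff_exists.mp (hc.symm h hC).not_le
  obtain ⟨b, hb, hbQ⟩ := h.exists_notMem_fixerSylow hw
  have htx := h.trans_of_two (MulAction.stabilizer G x ⊓ Subgroup.normalizer (W : Set G))
    hw hc.adj_left (fun g hg => hg.1) ⟨h.smul_left hw hb, hS hb⟩ hb hbQ
    ⟨h.smul_left hc.adj_left (hc.le_left ha), hZy ha⟩ (hc.le_left ha) haQ hne
  obtain ⟨t, htx', htw⟩ := h.exists_swap hw
  have htW : t ∈ Subgroup.normalizer (W : Set G) := by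
    refine mem_normalizer_of_conj_mem fun a ha => ?_
    have : W ≤ W.comap (MulAut.conj t).toMonoidHom := by
      refine sup_le (fun a ha => hZw ?_) fun a ha => hZx ?_
      · have := h.conj_mem_centerSpan t ha
        rwa [htx'] at this
      · have := h.conj_mem_centerSpan t ha
        rwa [htw] at this
    exact this ha
  have hWS : W ≤ 𝐒 x w := sup_le ((centerSpan_le hC x).trans (h.fixerSylow_le hw))
    ((centerSpan_le hC w).trans (h.fixerSylow_le' hw))
  have hWbot : W = ⊥ := h.eq_bot hw
    (fun a ha => ⟨h.smul_left hw (hWS ha), h.smul_right hw (hWS ha)⟩) htx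
    (h.trans_transport htx' htW htx)
  exact h.centerSpan_ne_bot hw (le_bot_iff.mp (hWbot ▸ hZx))

end Amalgam

/-! ### Straight paths and the critical distance. -/

section Paths

variable {V : Type*} {Γ : SimpleGraph V} {G : Type*} [Group G] [MulAction G V] {p : ℕ}

local notation "𝐊" => nbrFixer Γ G
local notation "𝐒" => arcSylow G p
local notation "𝐐" => fixerSylow Γ G p
local notation "𝐂" => arcCenter G p
local notation "𝐙" => centerSpan Γ G p
local notation "𝐃" => centerCore Γ G p

/-- A path of length `n`. -/
def IsPath (Γ : SimpleGraph V) (n : ℕ) (s : ℕ → V) : Prop :=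
  ∀ i < n, Γ.Adj (s i) (s (i + 1))

/-- A path of length `n` leaving each inner vertex in a direction other than the one in which
it entered. -/
structure IsStraight (Γ : SimpleGraph V) (G : Type*) [Group G] [MulAction G V] (p n : ℕ)
    (s : ℕ → V) : Prop where
  isPath : IsPath Γ n s
  ne : ∀ i, i + 1 < n → arcSylow G p (s i) (s (i + 1)) ≠ arcSylow G p (s (i + 1)) (s (i + 2))

/-- There are no critical pairs at distance less than `b`. -/
def NotCriticalBelow (Γ : SimpleGraph V) (G : Type*) [Group G] [MulAction G V] (p b : ℕ) : Prop :=
  ∀ x y : V, Γ.dist x y < b → centerSpan Γ G p x ≤ fixerSylow Γ G p y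

theorem IsPath.dist_le {n : ℕ} {s : ℕ → V} (hs : IsPath Γ n s) (hc : Γ.Connected) {i j : ℕ}
    (hij : i ≤ j) (hj : j ≤ n) : Γ.dist (s i) (s j) ≤ j - i := by
  induction j, hij using Nat.le_induction with
  | base => simp
  | succ j hij ih =>
    have h1 := hc.dist_triangle (u := s i) (v := s j) (w := s (j + 1))
    rw [SimpleGraph.dist_eq_one_iff_adj.mpr (hs j (by omega))] at h1
    have := ih (by omega)
    omega

theorem IsStraight.shift {n m k : ℕ} {s : ℕ → V} (hs : IsStraight Γ G p n s) (hmk : m + k ≤ n) :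
    IsStraight Γ G p m (fun i => s (i + k)) where
  isPath i hi := by
    have := hs.isPath (i + k) (by omega)
    rwa [show i + k + 1 = i + 1 + k by omega] at this
  ne i hi := by
    have := hs.ne (i + k) (by omega)
    rwa [show i + k + 1 = i + 1 + k by omega, show i + k + 2 = i + 2 + k by omega] at this

theorem IsStraight.congr {n : ℕ} {s t : ℕ → V} (hs : IsStraight Γ G p n s)
    (hst : ∀ i ≤ n, s i = t i) : IsStraight Γ G p n t where
  isPath i hi := by
    rw [← hst i (by omega), ← hst (i + 1) (by omega)]
    exact hs.isPath i hi
  ne i hi := by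
    rw [← hst i (by omega), ← hst (i + 1) (by omega), ← hst (i + 2) (by omega)]
    exact hs.ne i hi

/-- Extension of a straight path by one vertex. -/
theorem IsStraight.update [DecidableEq ℕ] {n : ℕ} {s : ℕ → V} (hs : IsStraight Γ G p n s) {w : V}
    (hn : 0 < n) (hw : Γ.Adj (s n) w) (hne : arcSylow G p (s (n - 1)) (s n) ≠ arcSylow G p (s n) w) :
    IsStraight Γ G p (n + 1) (Function.update s (n + 1) w) where
  isPath i hi := by
    rw [Function.update_of_ne (by omega)]
    rcases (Nat.lt_succ_iff.mp hi).lt_or_eq with h | rfl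
    · rw [Function.update_of_ne (by omega)]
      exact hs.isPath i h
    · rwa [Function.update_self]
  ne i hi := by
    rw [Function.update_of_ne (by omega), Function.update_of_ne (by omega)]
    rcases (show i + 1 < n ∨ i + 1 = n by omega) with h | rfl
    · rw [Function.update_of_ne (by omega)]
      exact hs.ne i h
    · rw [Function.update_self]
      exact hne

variable (h : IsLocallyRankOne Γ G p)
variable [Finite G] [Finite V] [FaithfulSMul G V] [hp : Fact p.Prime]
include h

theorem exists_isStraight {x y : V} (hxy : Γ.Adj x y) (n : ℕ) :
    ∃ s : ℕ → V, IsStraight Γ G p (n + 1) s ∧ s 0 = x ∧ s 1 = y := by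
  induction n with
  | zero =>
    refine ⟨fun i => if i = 0 then x else y, ⟨fun i hi => ?_, fun i hi => by omega⟩, rfl, rfl⟩
    obtain rfl : i = 0 := by omega
    exact hxy
  | succ n ih =>
    obtain ⟨s, hs, h0, h1⟩ := ih
    obtain ⟨w, _, hw, _, hne, _⟩ := h.exists_directions (hs.isPath n (by omega)).symm
    rw [arcSylow_comm] at hne
    refine ⟨_, hs.update (by omega) hw hne, ?_, ?_⟩
    · rwa [Function.update_of_ne (by omega)]
    · rwa [Function.update_of_ne (by omega)]

variable (hC : CentersInFixers Γ G p) {b : ℕ} (hb : NotCriticalBelow Γ G p b)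
include hC

theorem exists_not_centerSpan_le {x y : V} (hxy : Γ.Adj x y) : ∃ v w : V, ¬ 𝐙 v ≤ 𝐐 w := by
  by_contra! hall
  refine h.centerSpan_ne_bot hxy (eq_bot_of_fixes (V := V) fun a ha v => ?_)
  by_cases hv : ∃ w, Γ.Adj v w
  · obtain ⟨w, hw⟩ := hv
    exact (h.fixerSylow_le_nbrFixer hw (hall x v ha)).1
  · obtain ⟨g, rfl⟩ := h.exists_smul x v
    exact absurd ⟨g • y, h.smul_adj g hxy⟩ hv

include hb

theorem isCritical_of_path (hb1 : 1 ≤ b) {s : ℕ → V} (hs : IsPath Γ b s)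
    (hcrit : ¬ 𝐙 (s 0) ≤ 𝐐 (s b)) : IsCritical Γ G p (s 0) (s 1) (s b) (s (b - 1)) := by
  have h01 : Γ.Adj (s 0) (s 1) := hs 0 (by omega)
  have hbb : Γ.Adj (s (b - 1)) (s b) := by
    have := hs (b - 1) (by omega)
    rwa [Nat.sub_add_cancel hb1] at this
  refine ⟨h01, hbb.symm, ?_, ?_, hcrit⟩
  · refine (hb _ (s (b - 1)) ?_).trans (h.fixerSylow_le' hbb.symm)
    have := hs.dist_le h.connected (Nat.zero_le (b - 1)) (by omega)
    omega
  · refine (hb _ (s 1) ?_).trans (h.fixerSylow_le' h01)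
    have := hs.dist_le h.connected hb1 le_rfl
    rw [SimpleGraph.dist_comm]
    omega

/-- If some pair at distance `b` is critical, then every straight path of length `b` is. -/
theorem not_le_of_isStraight (hb1 : 1 ≤ b) {u v : V} (huv : Γ.dist u v = b) (hcr : ¬ 𝐙 u ≤ 𝐐 v)
    {y : ℕ → V} (hy : IsStraight Γ G p b y) : ¬ 𝐙 (y 0) ≤ 𝐐 (y b) := by
  obtain ⟨w, hw⟩ := h.connected.exists_walk_length_eq_dist u v
  rw [huv] at hw
  have hx : IsPath Γ b w.getVert := fun i hi => w.adj_getVert_succ (by omega)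
  have hx0 : w.getVert 0 = u := w.getVert_zero
  have hxb : w.getVert b = v := by rw [← hw]; exact w.getVert_length
  generalize w.getVert = x at hx hx0 hxb
  subst hx0 hxb
  have hyb : Γ.Adj (y (b - 1)) (y b) := by
    have := hy.isPath (b - 1) (by omega)
    rwa [Nat.sub_add_cancel hb1] at this
  obtain ⟨z, _, hz, _, hne, _⟩ := h.exists_directions hyb.symm
  rw [arcSylow_comm] at hne
  obtain ⟨g, hg0, hg1⟩ := h.exists_smul_arc (hx 0 (by omega)) hz
  -- The given straight path is followed by a translate of the critical path that leaves its end in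
  -- a new direction. Only the first half and the junction need be straight: from the critical
  -- second half, the window of length `b` moves back one step at a time by `IsCritical.shift`.
  let s : ℕ → V := fun i => if i ≤ b then y i else g • x (i - b)
  have hs1 : ∀ i ≤ b, s i = y i := fun i hi => if_pos hi
  have hs2 : ∀ i, s (b + i) = g • x i := by
    intro i
    rcases Nat.eq_zero_or_pos i with rfl | hi
    · rw [hg0]
      exact hs1 b le_rfl
    · have : ¬ b + i ≤ b := by omega
      simp only [s, if_neg this, Nat.add_sub_cancel_left]
  have hspath : IsPath Γ (b + b) s := by
    intro i hi
    rcases lt_or_ge i b with hlt | hge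
    · rw [hs1 i hlt.le, hs1 (i + 1) hlt]
      exact hy.isPath i hlt
    · obtain ⟨j, rfl⟩ := Nat.exists_eq_add_of_le hge
      rw [add_assoc, hs2, hs2]
      exact h.smul_adj g (hx j (by omega))
  have hsne : ∀ i < b, arcSylow G p (s (i + 1)) (s i) ≠ arcSylow G p (s (i + 1)) (s (i + 2)) := by
    intro i hi
    rw [arcSylow_comm]
    rcases (show i + 1 < b ∨ i + 1 = b by omega) with hlt | heq
    · rw [hs1 i hi.le, hs1 _ hlt.le, hs1 _ (by omega)]
      exact hy.ne i hlt
    · have e2 : s (i + 2) = z := by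
        rw [show i + 2 = b + 1 by omega, hs2, ← hg1]
      rw [e2, hs1 i hi.le, hs1 _ heq.le, show i = b - 1 by omega, Nat.sub_add_cancel hb1]
      exact hne
  have main : ∀ k ≤ b, ¬ 𝐙 (s (b - k)) ≤ 𝐐 (s (b - k + b)) := by
    intro k
    induction k with
    | zero =>
      intro _
      rw [Nat.sub_zero, hs2, hs1 b le_rfl, ← hg0]
      intro hle
      refine hcr fun a ha => ?_
      have := h.conj_mem_fixerSylow g⁻¹ (hle (h.conj_mem_centerSpan g ha))
      rw [inv_smul_smul] at this
      simpa [mul_assoc] using this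
    | succ k ih =>
      intro hk
      obtain ⟨i, hi⟩ : ∃ i, i + 1 = b - k := ⟨b - k - 1, by omega⟩
      have hi' : b - (k + 1) = i := by omega
      rw [hi']
      have h1 := ih (by omega)
      rw [← hi] at h1
      have hc : IsCritical Γ G p (s (0 + (i + 1))) (s (1 + (i + 1))) (s (b + (i + 1)))
          (s (b - 1 + (i + 1))) := by
        refine isCritical_of_path h hC hb hb1 (s := fun j => s (j + (i + 1))) (fun j hj => ?_) ?_
        · have := hspath (j + (i + 1)) (by omega)
          rwa [show j + (i + 1) + 1 = j + 1 + (i + 1) by omega] at this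
        · simp only [zero_add]
          rwa [add_comm b]
      rw [show 0 + (i + 1) = i + 1 by omega, show 1 + (i + 1) = i + 2 by omega,
        show b - 1 + (i + 1) = i + b by omega] at hc
      exact hc.shift h hC (hspath i (by omega)).symm (hsne i (by omega))
  have := main b le_rfl
  rw [Nat.sub_self, zero_add, hs1 0 (Nat.zero_le _), hs1 b le_rfl] at this
  exact this

/-- The critical distance is at most two. -/
theorem critical_dist_le_two {u v : V} (huv : Γ.dist u v = b) (hcr : ¬ 𝐙 u ≤ 𝐐 v) : b ≤ 2 := by
  by_contra! hb3
  have crit : ∀ {s : ℕ → V}, IsStraight Γ G p b s →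
      IsCritical Γ G p (s 0) (s 1) (s b) (s (b - 1)) := fun hs =>
    isCritical_of_path h hC hb (by omega) hs.isPath
      (not_le_of_isStraight h hC hb (by omega) huv hcr hs)
  obtain ⟨x, y, hxy⟩ : ∃ x y, Γ.Adj x y := by
    by_contra! hno
    obtain ⟨w, hw⟩ := h.connected.exists_walk_length_eq_dist u v
    cases w with
    | nil => rw [SimpleGraph.dist_self] at huv; omega
    | cons hadj _ => exact hno _ _ hadj
  obtain ⟨s, hs, -, -⟩ := exists_isStraight h hxy (b + 3)
  have adj : ∀ i < b + 4, Γ.Adj (s i) (s (i + 1)) := hs.isPath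
  -- Below distance `b` one span lies in the `Q` of the other vertex, where the other span is
  -- central. Both uses are at index difference two, and this is where `b ≥ 3` enters.
  have comm : ∀ i j, i ≤ j → j < i + b → j ≤ b + 4 → ∀ z ∈ 𝐙 (s i), ∀ w ∈ 𝐙 (s j),
      Commute z w := by
    intro i j hij hjb hj z hz w hw
    refine (h.commute_centerSpan hw (hb _ _ ?_ hz)).symm
    have := hs.isPath.dist_le h.connected hij hj
    omega
  have crit' : ∀ i, i + b ≤ b + 4 →
      IsCritical Γ G p (s i) (s (i + 1)) (s (i + b)) (s (i + b - 1)) := by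
    intro i hi
    have := crit (hs.shift (m := b) (k := i) (by omega))
    simp only [zero_add] at this
    rwa [add_comm 1 i, add_comm b i, show b - 1 + i = i + b - 1 by omega] at this
  have hc0 := crit' 0 (by omega)
  -- the centre at `(s 2, s 3)` is not contained in `𝐙 (s (b + 1))`
  have hnot : ¬ 𝐂 (s 2) (s 3) ≤ 𝐙 (s (b + 1)) := by
    intro hle
    have hc := crit' 3 (by omega)
    obtain ⟨z, hz, w, hw, hzw⟩ := hc.exists_not_commute h hC
    have h23 : 𝐂 (s 2) (s 3) ≤ 𝐙 (s 3) := by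
      rw [arcCenter_comm]
      exact arcCenter_le_centerSpan (adj 2 (by omega)).symm
    -- Such a `c` generates `Z` at `s 3` modulo the centre at `(s 3, s 4)`. Both would commute with
    -- `Z` at `s (b + 3)`, contradicting the critical pair from `s 3`.
    obtain ⟨c, hcC, hcn⟩ : ∃ c ∈ 𝐂 (s 2) (s 3), c ∉ 𝐂 (s 3) (s 4) := by
      by_contra! hall
      refine hc0.not_le_centerCore h hC (adj 2 (by omega)).symm ?_
      rw [arcCenter_comm]
      exact (le_inf (arcCenter_comm (p := p) (G := G) (s 2) (s 3)).le hall).trans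
        (h.arcCenter_inf_le_centerCore (adj 2 (by omega)).symm (adj 3 (by omega))
          (by rw [arcSylow_comm]; exact hs.ne 2 (by omega)))
    obtain ⟨k, hk⟩ := (hc0.cyclicMod h hC (adj 3 (by omega)) c (h23 hcC)).2 hcn z hz
    refine hzw (Commute.of_pow_mul (k := k) (comm (b + 1) (3 + b) (by omega) (by omega) (by omega) c
      (hle hcC) w hw) ?_)
    exact (commute_arcCenter hk (hc.le_left hw)).symm
  have hadjb := adj (b + 1) (by omega)
  obtain ⟨t, ht, hne₁, hne₂⟩ : ∃ t, Γ.Adj (s (b + 1)) t ∧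
      𝐒 (s b) (s (b + 1)) ≠ 𝐒 (s (b + 1)) t ∧ 𝐒 (s (b + 1)) (s (b + 2)) ≠ 𝐒 (s (b + 1)) t := by
    obtain ⟨z₁, z₂, h₁, h₂, e₁, e₂, e₃⟩ := h.exists_directions (adj b (by omega)).symm
    rw [arcSylow_comm] at e₁ e₂
    by_cases hz : 𝐒 (s (b + 1)) (s (b + 2)) = 𝐒 (s (b + 1)) z₁
    · exact ⟨z₂, h₂, e₂, hz ▸ e₃⟩
    · exact ⟨z₁, h₁, e₁, hz⟩
  have hcrit₁ := crit' 2 (by omega)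
  have hcrit₂ : IsCritical Γ G p (s 2) (s 3) t (s (b + 1)) := by
    have hs' := ((hs.shift (m := b + 1) (k := 0) (by omega)).update (by omega) (w := t)
      (by simpa using ht) (by simpa using hne₁)).shift (m := b) (k := 2) (by omega)
    have := crit hs'
    simp only [add_zero] at this
    rwa [Function.update_of_ne (by omega), Function.update_of_ne (by omega),
      show b + 2 = b + 1 + 1 by omega, Function.update_self,
      Function.update_of_ne (by omega), show b - 1 + 2 = b + 1 by omega] at this
  obtain ⟨r₁, hr₁, hr₁C, hr₁'⟩ := hcrit₁.exists_ne_one h hC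
  obtain ⟨r₂, hr₂, hr₂C, hr₂'⟩ := hcrit₂.exists_ne_one h hC
  rw [show 2 + b - 1 = b + 1 by omega, show 2 + b = b + 2 by omega, arcCenter_comm] at hr₁'
  rw [arcCenter_comm] at hr₂'
  -- `W` is a proper subgroup of a `p`-group of order at most `p ^ 2`, so it has order at most `p`
  -- and is generated by `r₂`. Hence `r₁` is central at two directions from `s (b + 1)` and lies in
  -- the core there.
  let W := 𝐂 (s 2) (s 3) ⊓ 𝐙 (s (b + 1))
  have hr₁W : r₁ ∈ W := ⟨hr₁C, arcCenter_le_centerSpan hadjb hr₁'⟩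
  have hr₂W : r₂ ∈ W := ⟨hr₂C, arcCenter_le_centerSpan ht hr₂'⟩
  have hCp : IsPGroup p (𝐂 (s 2) (s 3)) :=
    (h.isPGroup_arcSylow (adj 2 (by omega))).to_le (arcCenter_le _ _)
  have hWp : IsPGroup p W := hCp.to_le inf_le_left
  have hWcard : Nat.card W ≤ p := by
    obtain ⟨k, hk⟩ := hCp.exists_card_eq
    obtain ⟨l, hl⟩ := hWp.exists_card_eq
    have hk2 : k ≤ 2 := (Nat.pow_le_pow_iff_right hp.out.one_lt).mp
      (hk ▸ hc0.card_arcCenter_le h hC (adj 2 (by omega)))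
    have hlt : Nat.card W < Nat.card (𝐂 (s 2) (s 3)) := by
      by_contra! hge
      have := Subgroup.eq_of_le_of_card_ge (inf_le_left : W ≤ 𝐂 (s 2) (s 3)) hge
      exact hnot (inf_eq_left.mp this)
    rw [hk, hl, Nat.pow_lt_pow_iff_right hp.out.one_lt] at hlt
    rw [hl]
    exact (Nat.pow_le_pow_right hp.out.pos (show l ≤ 1 by omega)).trans (pow_one p).le
  have hWz : Subgroup.zpowers r₂ = W := by
    refine Subgroup.eq_of_le_of_card_ge ((Subgroup.zpowers_le).mpr hr₂W) (hWcard.trans ?_)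
    obtain ⟨l, hl⟩ := (hWp.to_le ((Subgroup.zpowers_le).mpr hr₂W)).exists_card_eq
    rw [hl]
    refine Nat.le_self_pow ?_ p
    rintro rfl
    rw [pow_zero, Subgroup.card_eq_one, Subgroup.zpowers_eq_bot] at hl
    exact hr₂ hl
  have hr₁D : r₁ ∈ 𝐃 (s (b + 1)) := by
    refine h.arcCenter_inf_le_centerCore hadjb ht hne₂ ⟨hr₁', ?_⟩
    have : r₁ ∈ Subgroup.zpowers r₂ := hWz ▸ hr₁W
    exact (Subgroup.zpowers_le.mpr hr₂') this
  -- `r₁` commutes with `𝐙 (s 0)` and, with the centre at `(s b, s (b - 1))`, generates `𝐙 (s b)`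
  simp only [zero_add] at hc0
  obtain ⟨z, hz, w, hw, hzw⟩ := hc0.exists_not_commute h hC
  have hbsub : b - 1 + 1 = b := by omega
  have hadj' : Γ.Adj (s b) (s (b - 1)) := by
    have := adj (b - 1) (by omega)
    rw [hbsub] at this
    exact this.symm
  have hr₁b : r₁ ∈ 𝐂 (s b) (s (b + 1)) := by
    rw [arcCenter_comm]
    exact centerCore_le (adj b (by omega)).symm hr₁D
  have hr₁n : r₁ ∉ 𝐂 (s b) (s (b - 1)) := by
    intro hmem
    have hne := hs.ne (b - 1) (by omega)
    rw [hbsub, show b - 1 + 2 = b + 1 by omega, arcSylow_comm] at hne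
    have h1 := h.arcCenter_inf_le_centerCore hadj' (adj b (by omega)) hne ⟨hmem, hr₁b⟩
    have h2 : r₁ ∈ 𝐃 (s b) ⊓ 𝐃 (s (b + 1)) := ⟨h1, hr₁D⟩
    rw [h.centerCore_inf_centerCore (adj b (by omega)), Subgroup.mem_bot] at h2
    exact hr₁ h2
  obtain ⟨k, hk⟩ := (hc0.cyclicMod h hC hadj' r₁
    (arcCenter_le_centerSpan (adj b (by omega)) hr₁b)).2 hr₁n w hw
  have hcomm : Commute z r₁ := comm 0 2 (by omega) (by omega) (by omega) z hz r₁
    (arcCenter_le_centerSpan (adj 2 (by omega)) hr₁C)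
  exact hzw (Commute.of_pow_mul (k := k) hcomm.symm
    (commute_arcCenter hk (hc0.le_right hz)).symm).symm

end Paths

/-! ### Bounding the arc groups at critical distance one and two. -/

section Bound

open scoped commutatorElement

variable {V : Type*} {Γ : SimpleGraph V} {G : Type*} [Group G] [MulAction G V] {p : ℕ}

local notation "𝐊" => nbrFixer Γ G
local notation "𝐒" => arcSylow G p
local notation "𝐐" => fixerSylow Γ G p
local notation "𝐂" => arcCenter G p
local notation "𝐙" => centerSpan Γ G p
local notation "𝐃" => centerCore Γ G p

/-- Central factors do not change commutators, and every element of `A` lies in `B` up to a power of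
the central `c`. -/
theorem commutator_le_of_central {A B : Subgroup G} {c : G} (hc : ∀ a ∈ A, Commute c a)
    (hcA : c ∈ A) (hAB : ∀ a ∈ A, ∃ k : ℕ, c ^ k * a ∈ B) : ⁅A, A⁆ ≤ ⁅B, B⁆ := by
  rw [Subgroup.commutator_le]
  intro a ha a' ha'
  obtain ⟨k, hk⟩ := hAB a ha
  obtain ⟨l, hl⟩ := hAB a' ha'
  have key : ∀ (u v t : G), Commute u v → Commute u t → ⁅u * v, t⁆ = ⁅v, t⁆ := by
    intro u v t huv hut
    rw [commutatorElement_def, commutatorElement_def]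
    have h1 : u * v * t * (u * v)⁻¹ * t⁻¹ = u * (v * t * v⁻¹ * u⁻¹ * t⁻¹) := by group
    have h2 : u⁻¹ * t⁻¹ = t⁻¹ * u⁻¹ := (hut.inv_inv).eq
    rw [h1, mul_assoc (v * t * v⁻¹), h2]
    have h3 : Commute u (v * t * v⁻¹ * t⁻¹) :=
      ((huv.mul_right hut).mul_right huv.inv_right).mul_right hut.inv_right
    rw [← mul_assoc (v * t * v⁻¹), ← mul_assoc, h3.eq, mul_inv_cancel_right]
  have e1 : ⁅c ^ k * a, c ^ l * a'⁆ = ⁅a, c ^ l * a'⁆ :=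
    key _ _ _ ((hc a ha).pow_left k) ((hc _ (mul_mem (pow_mem hcA l) ha')).pow_left k)
  have e2 : ⁅c ^ l * a', a⁆ = ⁅a', a⁆ := key _ _ _ ((hc a' ha').pow_left l) ((hc a ha).pow_left l)
  have e3 : ⁅a, c ^ l * a'⁆ = ⁅a, a'⁆ := by
    rw [← commutatorElement_inv, e2, commutatorElement_inv]
  rw [← e3, ← e1]
  exact Subgroup.commutator_mem_commutator hk hl

theorem conj_mem_commutator {A B : Subgroup G} {g : G} (hg : ∀ a ∈ A, g * a * g⁻¹ ∈ B) :
    ∀ a ∈ ⁅A, A⁆, g * a * g⁻¹ ∈ ⁅B, B⁆ := by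
  have : ⁅A, A⁆ ≤ ⁅B, B⁆.comap (MulAut.conj g).toMonoidHom := by
    rw [← Subgroup.map_le_iff_le_comap, Subgroup.map_commutator]
    refine Subgroup.commutator_mono ?_ ?_ <;>
    · rw [Subgroup.map_le_iff_le_comap]
      exact hg
  exact fun a ha => this ha

theorem commute_of_commutator_eq_bot {A : Subgroup G} (hA : ⁅A, A⁆ = ⊥) {a b : G} (ha : a ∈ A)
    (hb : b ∈ A) : Commute a b := by
  have := Subgroup.commutator_mem_commutator ha hb
  rw [hA, Subgroup.mem_bot, commutatorElement_eq_one_iff_commute] at this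
  exact this

variable (h : IsLocallyRankOne Γ G p)
variable [Finite G] [Finite V] [FaithfulSMul G V] [hp : Fact p.Prime]
include h

/-- A generator of `Q_u` modulo `Q_u ∩ Q_v` can be taken in `Z_u`, so both groups have the same
derived group. By symmetry it is shared by `u` and `v`, hence trivial. With `Q_x` and `Q_y` abelian,
`Q_x ∩ Q_y` is central in `S_xy`, and two index-`p` steps above a group of order at most `p ^ 2`
give `p ^ 4`. -/
theorem card_arcSylow_le_of_adj (hC : CentersInFixers Γ G p)
    (hcr : ∀ x y : V, Γ.Adj x y → ¬ 𝐙 x ≤ 𝐐 y) {x y : V} (hxy : Γ.Adj x y) :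
    Nat.card (𝐒 x y) ≤ p ^ 4 := by
  have key : ∀ {u v : V}, Γ.Adj u v → ⁅𝐐 u, 𝐐 u⁆ = ⁅𝐐 u ⊓ 𝐐 v, 𝐐 u ⊓ 𝐐 v⁆ := by
    intro u v huv
    refine le_antisymm ?_ (Subgroup.commutator_mono inf_le_left inf_le_left)
    obtain ⟨c, hc, hcQ⟩ := SetLike.not_le_iff_exists.mp (hcr u v huv)
    refine commutator_le_of_central (fun a ha => h.commute_centerSpan hc ha)
      (centerSpan_le hC u hc) fun a ha => ?_
    have hcQu := centerSpan_le hC u hc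
    obtain ⟨k, hk⟩ := (h.cyclicMod' huv c (h.fixerSylow_le huv hcQu)).2 hcQ a
      (h.fixerSylow_le huv ha)
    exact ⟨k, mul_mem (pow_mem hcQu k) ha, hk⟩
  have htrans : ∀ {u v : V}, Γ.Adj u v → TransOnNbrs Γ (MulAction.stabilizer G u ⊓
      Subgroup.normalizer (⁅𝐐 u, 𝐐 u⁆ : Subgroup G)) u := by
    intro u v huv z₁ z₂ h₁ h₂
    obtain ⟨g, hg, e⟩ := h.exists_smul_nbr h₁ h₂
    refine ⟨g, ⟨hg, mem_normalizer_of_conj_mem ?_⟩, e⟩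
    exact conj_mem_commutator fun a ha => h.conj_mem_fixerSylow_of_fix hg ha
  have hbot : ∀ {u v : V}, Γ.Adj u v → ⁅𝐐 u, 𝐐 u⁆ = ⊥ := by
    intro u v huv
    have hle : ⁅𝐐 u, 𝐐 u⁆ ≤ 𝐐 u := Subgroup.commutator_le.mpr fun a ha b hb => by
      rw [commutatorElement_def]
      exact mul_mem (mul_mem (mul_mem ha hb) (inv_mem ha)) (inv_mem hb)
    refine h.eq_bot huv (fun a ha => ?_) (htrans huv) ?_
    · have := h.fixerSylow_le huv (hle ha)
      exact ⟨h.smul_left huv this, h.smul_right huv this⟩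
    · rw [key huv, inf_comm (𝐐 u), ← key huv.symm]
      exact htrans huv.symm
  have hTC : 𝐐 x ⊓ 𝐐 y ≤ 𝐂 x y := by
    intro t ht
    obtain ⟨c, hc, hcQ⟩ := SetLike.not_le_iff_exists.mp (hcr y x hxy.symm)
    refine mem_arcCenter.mpr ⟨h.fixerSylow_le hxy ht.1, fun a ha => ?_⟩
    obtain ⟨k, hk⟩ := (h.cyclicMod hxy c
      (h.fixerSylow_le' hxy (centerSpan_le hC y hc))).2 hcQ a ha
    exact Commute.of_pow_mul (h.commute_centerSpan hc ht.2)
      (commute_of_commutator_eq_bot (hbot hxy) hk ht.1)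
  have hcrit : IsCritical Γ G p x y y x :=
    ⟨hxy, hxy.symm, (centerSpan_le hC x).trans (h.fixerSylow_le' hxy.symm),
      (centerSpan_le hC y).trans (h.fixerSylow_le' hxy), hcr x y hxy⟩
  have h1 := (h.cyclicMod hxy).card_le hp.out.pos
  have h2 := ((h.cyclicMod' hxy).mono (inf_le_left (b := 𝐐 x))).card_le hp.out.pos
  have h3 : Nat.card ↥(𝐒 x y ⊓ 𝐐 x ⊓ 𝐐 y) ≤ p ^ 2 := by
    refine (Subgroup.card_le_of_le ?_).trans (hcrit.card_arcCenter_le h hC hxy)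
    rw [inf_assoc]
    exact inf_le_right.trans hTC
  calc Nat.card (𝐒 x y) ≤ p * (p * p ^ 2) :=
        h1.trans (Nat.mul_le_mul_left _ (h2.trans (Nat.mul_le_mul_left _ h3)))
    _ = p ^ 4 := by ring

/-- The derived group of `Q_u ∩ Q_v` is the same for consecutive edges of a straight path, hence
trivial. On a straight path `w, x, y, z`, an element of all four `Q`s commutes with `Q_x` (by `w, x,
y`) and `Q_y` (by `x, y, z`), so with `S_xy`. Four index-`p` steps above the centre, of order at
most `p ^ 2`, give `p ^ 6`. -/
theorem card_arcSylow_le_of_two (hC : CentersInFixers Γ G p)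
    (hle : ∀ x y : V, Γ.Adj x y → 𝐙 x ≤ 𝐐 y)
    (hcr : ∀ x y z : V, Γ.Adj x y → Γ.Adj y z → 𝐒 x y ≠ 𝐒 y z → ¬ 𝐙 x ≤ 𝐐 z) {x y : V}
    (hxy : Γ.Adj x y) : Nat.card (𝐒 x y) ≤ p ^ 6 := by
  have cyc : ∀ {u v w : V}, Γ.Adj u v → Γ.Adj v w → 𝐒 u v ≠ 𝐒 v w → ∃ c ∈ 𝐙 u, c ∈ 𝐐 u ∧ c ∈ 𝐐 v ∧
      ∀ a ∈ 𝐒 v w, ∃ k : ℕ, c ^ k * a ∈ 𝐐 w := by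
    intro u v w huv hvw hne
    obtain ⟨c, hc, hcQ⟩ := SetLike.not_le_iff_exists.mp (hcr u v w huv hvw hne)
    exact ⟨c, hc, centerSpan_le hC u hc, hle u v huv hc, fun a ha =>
      (h.cyclicMod' hvw c (h.fixerSylow_le hvw (hle u v huv hc))).2 hcQ a ha⟩
  have key : ∀ {u v w : V}, Γ.Adj u v → Γ.Adj v w → 𝐒 u v ≠ 𝐒 v w →
      ⁅𝐐 u ⊓ 𝐐 v, 𝐐 u ⊓ 𝐐 v⁆ ≤ ⁅𝐐 v ⊓ 𝐐 w, 𝐐 v ⊓ 𝐐 w⁆ := by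
    intro u v w huv hvw hne
    obtain ⟨c, hc, hcu, hcv, hcyc⟩ := cyc huv hvw hne
    refine commutator_le_of_central (fun a ha => h.commute_centerSpan hc ha.1) ⟨hcu, hcv⟩
      fun a ha => ?_
    obtain ⟨k, hk⟩ := hcyc a (h.fixerSylow_le hvw ha.2)
    exact ⟨k, mul_mem (pow_mem hcv k) ha.2, hk⟩
  have key' : ∀ {u v w : V}, Γ.Adj u v → Γ.Adj v w → 𝐒 u v ≠ 𝐒 v w →
      ⁅𝐐 u ⊓ 𝐐 v, 𝐐 u ⊓ 𝐐 v⁆ = ⁅𝐐 v ⊓ 𝐐 w, 𝐐 v ⊓ 𝐐 w⁆ := by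
    intro u v w huv hvw hne
    refine le_antisymm (key huv hvw hne) ?_
    have := key hvw.symm huv.symm (by rw [arcSylow_comm w v, arcSylow_comm v u]; exact hne.symm)
    rwa [inf_comm (𝐐 w), inf_comm (𝐐 v) (𝐐 u)] at this
  have hnorm : ∀ {u v : V}, Γ.Adj u v → 𝐒 u v ≤
      Subgroup.normalizer (⁅𝐐 u ⊓ 𝐐 v, 𝐐 u ⊓ 𝐐 v⁆ : Subgroup G) := by
    intro u v huv g hg
    refine mem_normalizer_of_conj_mem (conj_mem_commutator fun a ha => ⟨?_, ?_⟩)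
    · exact h.conj_mem_fixerSylow_of_fix (h.smul_left huv hg) ha.1
    · exact h.conj_mem_fixerSylow_of_fix (h.smul_right huv hg) ha.2
  have htrans : ∀ {u v : V}, Γ.Adj u v → TransOnNbrs Γ (MulAction.stabilizer G v ⊓
      Subgroup.normalizer (⁅𝐐 u ⊓ 𝐐 v, 𝐐 u ⊓ 𝐐 v⁆ : Subgroup G)) v := by
    intro u v huv
    obtain ⟨w, _, hw, _, hne, _⟩ := h.exists_directions huv.symm
    refine h.trans_of_sylow _ huv.symm hw ?_ ?_ hne
    · rw [arcSylow_comm]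
      exact hnorm huv
    · rw [key' huv hw (by rwa [arcSylow_comm])]
      exact hnorm hw
  have hbot : ∀ {u v : V}, Γ.Adj u v → ⁅𝐐 u ⊓ 𝐐 v, 𝐐 u ⊓ 𝐐 v⁆ = ⊥ := by
    intro u v huv
    have hle : ⁅𝐐 u ⊓ 𝐐 v, 𝐐 u ⊓ 𝐐 v⁆ ≤ 𝐐 u ⊓ 𝐐 v :=
      Subgroup.commutator_le.mpr fun a ha b hb => by
        rw [commutatorElement_def]
        exact mul_mem (mul_mem (mul_mem ha hb) (inv_mem ha)) (inv_mem hb)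
    refine h.eq_bot huv (fun a ha => ?_) ?_ (htrans huv)
    · have := h.fixerSylow_le huv (hle ha).1
      exact ⟨h.smul_left huv this, h.smul_right huv this⟩
    · have := htrans huv.symm
      rwa [inf_comm (𝐐 v)] at this
  have hcent : ∀ {u v w : V}, Γ.Adj u v → Γ.Adj v w → 𝐒 u v ≠ 𝐒 v w →
      ∀ t, t ∈ 𝐐 u → t ∈ 𝐐 v → t ∈ 𝐐 w → ∀ a ∈ 𝐐 v, Commute a t := by
    intro u v w huv hvw hne t htu htv htw a ha
    obtain ⟨c, hc, -, hcv, hcyc⟩ := cyc huv hvw hne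
    obtain ⟨k, hk⟩ := hcyc a (h.fixerSylow_le hvw ha)
    refine Commute.of_pow_mul (k := k) (h.commute_centerSpan hc htu) ?_
    exact commute_of_commutator_eq_bot (hbot hvw) ⟨mul_mem (pow_mem hcv k) ha, hk⟩ ⟨htv, htw⟩
  obtain ⟨w, _, hw, _, hne, _⟩ := h.exists_directions hxy
  obtain ⟨z, _, hz, _, hne', _⟩ := h.exists_directions hxy.symm
  have hwx : 𝐒 w x ≠ 𝐒 x y := by rw [arcSylow_comm]; exact hne.symm
  have hyz : 𝐒 x y ≠ 𝐒 y z := by rw [arcSylow_comm]; exact hne'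
  have hT : 𝐒 x y ⊓ 𝐐 x ⊓ 𝐐 y ⊓ 𝐐 w ⊓ 𝐐 z ≤ 𝐂 x y := by
    rintro t ⟨⟨⟨⟨htS, htx⟩, hty⟩, htw⟩, htz⟩
    refine mem_arcCenter.mpr ⟨htS, fun a ha => ?_⟩
    obtain ⟨c, hc, -, hcx, hcyc⟩ := cyc hw.symm hxy hwx
    obtain ⟨k, hk⟩ := hcyc a ha
    exact Commute.of_pow_mul (k := k) (hcent hw.symm hxy hwx t htw htx hty c hcx)
      (hcent hxy hz hyz t htx hty htz _ hk)
  have hcrit : IsCritical Γ G p w x y x := by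
    refine ⟨hw.symm, hxy.symm, (hle w x hw.symm).trans (h.fixerSylow_le' hxy.symm),
      (hle y x hxy.symm).trans (h.fixerSylow_le' hw.symm), hcr w x y hw.symm hxy hwx⟩
  have h1 := (h.cyclicMod hxy).card_le hp.out.pos
  have h2 := ((h.cyclicMod' hxy).mono (inf_le_left (b := 𝐐 x))).card_le hp.out.pos
  have h3 := ((h.cyclicMod hw.symm).mono (A' := 𝐒 x y ⊓ 𝐐 x ⊓ 𝐐 y)
    ((inf_le_left.trans inf_le_right).trans (h.fixerSylow_le' hw.symm))).card_le hp.out.pos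
  have h4 := ((h.cyclicMod' hz).mono (A' := 𝐒 x y ⊓ 𝐐 x ⊓ 𝐐 y ⊓ 𝐐 w)
    ((inf_le_left.trans inf_le_right).trans (h.fixerSylow_le hz))).card_le hp.out.pos
  have h5 := (Subgroup.card_le_of_le hT).trans (hcrit.card_arcCenter_le h hC hxy)
  calc Nat.card (𝐒 x y) ≤ p * (p * (p * (p * p ^ 2))) :=
        h1.trans (Nat.mul_le_mul_left _ (h2.trans (Nat.mul_le_mul_left _
          (h3.trans (Nat.mul_le_mul_left _ (h4.trans (Nat.mul_le_mul_left _ h5)))))))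
    _ = p ^ 6 := by ring

theorem card_arcSylow_le {x y : V} (hxy : Γ.Adj x y) : Nat.card (𝐒 x y) ≤ p ^ 6 := by
  by_cases hC : CentersInFixers Γ G p
  · obtain ⟨v₀, w₀, hvw₀⟩ := exists_not_centerSpan_le h hC hxy
    have hex : ∃ b, ∃ v w : V, Γ.dist v w = b ∧ ¬ 𝐙 v ≤ 𝐐 w := ⟨_, v₀, w₀, rfl, hvw₀⟩
    classical
    obtain ⟨v, w, hd, hcr⟩ := Nat.find_spec hex
    have hmin : NotCriticalBelow Γ G p (Nat.find hex) := fun v w hvw => by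
      by_contra hno
      exact Nat.find_min hex hvw ⟨v, w, rfl, hno⟩
    generalize Nat.find hex = b at hd hmin
    have hb1 : 1 ≤ b := by
      by_contra hb0
      rw [show b = 0 by omega, h.connected.dist_eq_zero_iff] at hd
      exact hcr (hd ▸ centerSpan_le hC v)
    have hb2 := critical_dist_le_two h hC hmin hd hcr
    have hst := fun {s : ℕ → V} => not_le_of_isStraight h hC hmin hb1 hd hcr (y := s)
    rcases (show b = 1 ∨ b = 2 by omega) with rfl | rfl
    · refine (card_arcSylow_le_of_adj h hC (fun u v huv => ?_) hxy).trans
        (Nat.pow_le_pow_right hp.out.pos (by norm_num))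
      obtain ⟨s, hs, rfl, rfl⟩ := exists_isStraight h huv 0
      exact hst hs
    · refine card_arcSylow_le_of_two h hC (fun u v huv => hmin u v ?_) (fun u v w huv hvw hne => ?_)
        hxy
      · rw [SimpleGraph.dist_eq_one_iff_adj.mpr huv]
        norm_num
      · obtain ⟨s, hs, rfl, rfl⟩ := exists_isStraight h huv 0
        have := hst (hs.update one_pos hvw hne)
        simpa using this
  · simp only [CentersInFixers, not_forall] at hC
    obtain ⟨u, v, huv, hno⟩ := hC
    obtain ⟨g, rfl, rfl⟩ := h.exists_smul_arc hxy huv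
    refine (h.card_le_of_center_not_le hxy fun hle => hno fun a ha => ?_).trans
      (Nat.pow_le_pow_right hp.out.pos (by norm_num))
    have := conj_mem_arcCenter g⁻¹ ha
    rw [inv_smul_smul, inv_smul_smul] at this
    have := h.conj_mem_fixerSylow g (hle this)
    simpa [mul_assoc] using this

/-- An element fixing an arc, modulo the neighbourhoods of both ends, lies in a `p`-group of
bounded order. -/
theorem card_nbrFixer_inf_le {x y : V} (hxy : Γ.Adj x y) :
    Nat.card ↥(nbrFixer Γ G x ⊓ nbrFixer Γ G y) ≤ p ^ 6 := by
  refine (Subgroup.card_le_of_le fun g hg => ?_).trans (card_arcSylow_le h hxy)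
  obtain ⟨k, hk⟩ := h.isPGroup_inf hxy ⟨g, hg⟩
  exact (h.mem_arcSylow hxy).mpr ⟨hg.1.1, hg.2.1, k, congrArg Subtype.val hk⟩

end Bound

/-! ### Transvections and the rank-one properties of the linear groups. -/

section RankOne

/-- The features of the permutation groups lying between `SL(2,p)` and `GL(2,p)`, acting on nonzero
vectors up to scalars, that are used in the amalgam method: the nontrivial `p`-elements of a point
stabiliser lie in a group of order `p`, two of them at points in different directions generate a
transitive group, and a point stabiliser has no nontrivial normal `p'`-subgroup. -/
structure IsRankOne {Ω : Type*} (p : ℕ) (L : Subgroup (Equiv.Perm Ω)) : Prop where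
  trans : ∀ x y : Ω, ∃ σ ∈ L, σ x = y
  pow : ∀ {σ : Equiv.Perm Ω} {x : Ω} {k : ℕ}, σ ∈ L → σ x = x → σ ^ p ^ k = 1 → σ ^ p = 1
  cyclic : ∀ {σ τ : Equiv.Perm Ω} {x : Ω}, σ ∈ L → τ ∈ L → σ x = x → τ x = x → σ ^ p = 1 →
    τ ^ p = 1 → σ ≠ 1 → ∃ k : ℕ, σ ^ k * τ = 1
  exists_unip : ∀ x : Ω, ∃ σ ∈ L, σ x = x ∧ σ ^ p = 1 ∧ σ ≠ 1
  normal : ∀ {x : Ω} {N : Subgroup (Equiv.Perm Ω)}, N ≤ L → (∀ σ ∈ N, σ x = x) →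
    (∀ τ ∈ L, τ x = x → ∀ σ ∈ N, τ * σ * τ⁻¹ ∈ N) → (∀ σ ∈ N, σ ^ p = 1 → σ = 1) →
    ∀ σ ∈ N, σ = 1
  transitive : ∀ {x y : Ω} {σ τ : Equiv.Perm Ω} {A : Subgroup (Equiv.Perm Ω)}, A ≤ L → σ ∈ A →
    τ ∈ A → σ x = x → σ ^ p = 1 → σ ≠ 1 → τ y = y → τ ^ p = 1 → τ ≠ 1 → σ y ≠ y →
    ∀ z₁ z₂ : Ω, ∃ ρ ∈ A, ρ z₁ = z₂
  directions : ∀ x : Ω, ∃ z₁ z₂ : Ω,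
    (∀ σ ∈ L, σ x = x → σ ^ p = 1 → σ ≠ 1 → σ z₁ ≠ z₁ ∧ σ z₂ ≠ z₂) ∧
    (∀ σ ∈ L, σ z₁ = z₁ → σ ^ p = 1 → σ ≠ 1 → σ z₂ ≠ z₂)

variable {p : ℕ}

/-- `π` parametrises the points by nonzero vectors, with fibres contained in lines, such that `L`
is induced by linear maps and contains the permutations induced by `SL(2,p)`. -/
structure IsVectorModel {Ω : Type*} (L : Subgroup (Equiv.Perm Ω)) (π : NonzeroVec p → Ω) :
    Prop where
  surj : Function.Surjective π
  line : ∀ {v w : NonzeroVec p}, π v = π w → ∃ c : ZMod p, w.1 = c • v.1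
  linear : ∀ σ ∈ L, ∃ g : GL (Fin 2) (ZMod p), ∀ v, σ (π v) = π (g • v)
  special : ∀ g : SL(2, ZMod p), ∃ σ ∈ L, ∀ v, σ (π v) = π (g.toGL • v)

/-- The transvection `w ↦ w + f * det (v, w) * v`. -/
def transv (v : Fin 2 → ZMod p) (f : ZMod p) : SL(2, ZMod p) :=
  ⟨!![1 - f * v 0 * v 1, f * v 0 ^ 2; -(f * v 1 ^ 2), 1 + f * v 0 * v 1], by
    rw [Matrix.det_fin_two_of]; ring⟩

theorem transv_mul (v : Fin 2 → ZMod p) (f f' : ZMod p) :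
    transv v f * transv v f' = transv v (f + f') := by
  ext i j
  rw [Matrix.SpecialLinearGroup.coe_mul, Matrix.mul_apply, Fin.sum_univ_two]
  fin_cases i <;> fin_cases j <;> simp [transv] <;> ring

theorem transv_zero (v : Fin 2 → ZMod p) : transv v 0 = 1 := by
  ext i j
  fin_cases i <;> fin_cases j <;> simp [transv]

theorem transv_pow (v : Fin 2 → ZMod p) (f : ZMod p) (k : ℕ) :
    transv v f ^ k = transv v (k * f) := by
  induction k with
  | zero => simp [transv_zero]
  | succ k ih =>
    rw [pow_succ, ih, transv_mul]
    congr 1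
    push_cast
    ring

theorem transv_mulVec (v w : Fin 2 → ZMod p) (f : ZMod p) :
    (transv v f).1.mulVec w = w + (f * (v 0 * w 1 - v 1 * w 0)) • v := by
  ext i
  fin_cases i <;> simp [transv, Matrix.mulVec, dotProduct, Fin.sum_univ_two] <;> ring

theorem transv_conj (h : SL(2, ZMod p)) (v : Fin 2 → ZMod p) (f : ZMod p) :
    h * transv v f = transv (h.1.mulVec v) f * h := by
  have hdet : h.1 0 0 * h.1 1 1 - h.1 0 1 * h.1 1 0 = 1 := by
    rw [← Matrix.det_fin_two]; exact h.2
  ext i j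
  rw [Matrix.SpecialLinearGroup.coe_mul, Matrix.SpecialLinearGroup.coe_mul, Matrix.mul_apply,
    Matrix.mul_apply, Fin.sum_univ_two, Fin.sum_univ_two]
  fin_cases i <;> fin_cases j <;> simp [transv, Matrix.mulVec, dotProduct, Fin.sum_univ_two]
  · linear_combination (f * v 1 * (h.1 0 0 * v 0 + h.1 0 1 * v 1)) * hdet
  · linear_combination (-f * v 0 * (h.1 0 0 * v 0 + h.1 0 1 * v 1)) * hdet
  · linear_combination (f * v 1 * (h.1 1 0 * v 0 + h.1 1 1 * v 1)) * hdet
  · linear_combination (-f * v 0 * (h.1 1 0 * v 0 + h.1 1 1 * v 1)) * hdet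

theorem NonzeroVec.ne_zero_or (v : NonzeroVec p) : v.1 0 ≠ 0 ∨ v.1 1 ≠ 0 := by
  by_contra! hc
  exact v.2 (funext fun i => by fin_cases i <;> [exact hc.1; exact hc.2])

variable [hp : Fact p.Prime]

/-- The first standard basis vector. -/
def stdVec (p : ℕ) [Fact p.Prime] : NonzeroVec p :=
  ⟨![1, 0], fun h => one_ne_zero (congrFun h 0)⟩

theorem exists_specialLinear_stdVec (v : NonzeroVec p) :
    ∃ h : SL(2, ZMod p), h.toGL • stdVec p = v := by
  have key : ∃ x y, v.1 0 * y - x * v.1 1 = 1 := by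
    rcases v.ne_zero_or with h0 | h1
    · exact ⟨0, (v.1 0)⁻¹, by rw [mul_inv_cancel₀ h0]; ring⟩
    · exact ⟨-(v.1 1)⁻¹, 0, by rw [neg_mul, inv_mul_cancel₀ h1]; ring⟩
  obtain ⟨x, y, hxy⟩ := key
  refine ⟨⟨!![v.1 0, x; v.1 1, y], by rw [Matrix.det_fin_two_of, hxy]⟩, Subtype.ext ?_⟩
  change Matrix.mulVec !![v.1 0, x; v.1 1, y] ![1, 0] = v.1
  ext i
  fin_cases i <;> simp [Matrix.mulVec, dotProduct]

theorem mulVec_eq_smul_transv {g : Matrix (Fin 2) (Fin 2) (ZMod p)} {l : ZMod p} (hl : l ≠ 0)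
    (h00 : g 0 0 = l) (h10 : g 1 0 = 0) (h11 : g 1 1 = l) (w : Fin 2 → ZMod p) :
    g.mulVec w = l • (transv (stdVec p).1 (g 0 1 / l)).1.mulVec w := by
  rw [transv_mulVec]
  ext i
  rw [Pi.smul_apply, Pi.add_apply, Pi.smul_apply]
  fin_cases i
  · simp [Matrix.mulVec, dotProduct, Fin.sum_univ_two, stdVec, h00]
    field_simp
  · simp [Matrix.mulVec, dotProduct, Fin.sum_univ_two, stdVec, h10, h11]

theorem exists_specialLinear_smul (v w : NonzeroVec p) :
    ∃ h : SL(2, ZMod p), h.toGL • v = w := by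
  obtain ⟨g, rfl⟩ := exists_specialLinear_stdVec v
  obtain ⟨h, rfl⟩ := exists_specialLinear_stdVec w
  exact ⟨h * g⁻¹, by rw [map_mul, map_inv, mul_smul, inv_smul_smul]⟩

namespace IsVectorModel

variable {Ω : Type*} {L : Subgroup (Equiv.Perm Ω)} {π : NonzeroVec p → Ω}
variable (h : IsVectorModel L π)
include h

theorem comp (g : SL(2, ZMod p)) : IsVectorModel L (fun v => π (g.toGL • v)) where
  surj x := by
    obtain ⟨v, rfl⟩ := h.surj x
    exact ⟨g.toGL⁻¹ • v, by simp⟩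
  line {v w} hvw := by
    obtain ⟨c, hc⟩ := h.line hvw
    refine ⟨c, ?_⟩
    have e : (g.toGL • w).1 = g.toGL • (c • v.1) := by
      rw [hc, smul_comm]
      rfl
    exact smul_left_cancel g.toGL e
  linear σ hσ := by
    obtain ⟨k, hk⟩ := h.linear σ hσ
    exact ⟨g.toGL⁻¹ * k * g.toGL, fun v => by
      rw [hk, ← mul_smul, ← mul_smul]; congr 2; group⟩
  special k := by
    obtain ⟨σ, hσ, e⟩ := h.special (g * k * g⁻¹)
    refine ⟨σ, hσ, fun v => ?_⟩
    rw [e, ← mul_smul, ← mul_smul]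
    congr 2
    simp [mul_assoc]

theorem ext {σ τ : Equiv.Perm Ω} (e : ∀ v, σ (π v) = τ (π v)) : σ = τ := by
  ext x
  obtain ⟨v, rfl⟩ := h.surj x
  exact e v

/-- Whether scaling by `c` preserves the fibre of `π` does not depend on the vector: `SL(2,p)` is
transitive on nonzero vectors and commutes with scalars. -/
theorem smul_eq {v v' w w' : NonzeroVec p} {c : ZMod p} (hv : v'.1 = c • v.1)
    (hw : w'.1 = c • w.1) (e : π v' = π v) : π w' = π w := by
  obtain ⟨k, rfl⟩ := exists_specialLinear_smul v w
  obtain ⟨σ, -, hσ⟩ := h.special k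
  have : w' = k.toGL • v' := Subtype.ext (by
    rw [hw, show (k.toGL • v').1 = k.toGL • v'.1 from rfl, hv, smul_comm]
    rfl)
  rw [this, ← hσ, ← hσ, e]

theorem pow_apply {σ : Equiv.Perm Ω} {g : GL (Fin 2) (ZMod p)} (e : ∀ v, σ (π v) = π (g • v))
    (k : ℕ) (v : NonzeroVec p) : (σ ^ k) (π v) = π (g ^ k • v) := by
  induction k generalizing v with
  | zero => simp
  | succ k ih => rw [pow_succ, Equiv.Perm.mul_apply, e, ih, pow_succ, mul_smul]

theorem transv_eq_one {σ : Equiv.Perm Ω} {v : NonzeroVec p}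
    (e : ∀ w, σ (π w) = π ((transv v.1 0).toGL • w)) : σ = 1 :=
  h.ext fun w => by rw [e, transv_zero]; simp

theorem transv_pow_eq_one {σ : Equiv.Perm Ω} {v : NonzeroVec p} {f : ZMod p}
    (e : ∀ w, σ (π w) = π ((transv v.1 f).toGL • w)) : σ ^ p = 1 := by
  refine h.transv_eq_one (v := v) fun w => ?_
  rw [h.pow_apply e, ← map_pow, transv_pow, CharP.cast_eq_zero, zero_mul]

theorem transv_apply_eq_iff {σ : Equiv.Perm Ω} {v : NonzeroVec p} {f : ZMod p} (hf : f ≠ 0)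
    (e : ∀ w, σ (π w) = π ((transv v.1 f).toGL • w)) (w : NonzeroVec p) :
    σ (π w) = π w ↔ v.1 0 * w.1 1 - v.1 1 * w.1 0 = 0 := by
  have hval : ((transv v.1 f).toGL • w).1 = w.1 + (f * (v.1 0 * w.1 1 - v.1 1 * w.1 0)) • v.1 :=
    transv_mulVec _ _ _
  rw [e]
  refine ⟨fun hw => ?_, fun hw => ?_⟩
  · obtain ⟨c, hc⟩ := h.line hw.symm
    rw [hval] at hc
    set d := v.1 0 * w.1 1 - v.1 1 * w.1 0 with hd
    by_contra hd0
    have h0 := congrFun hc 0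
    have h1 := congrFun hc 1
    simp only [Pi.add_apply, Pi.smul_apply, smul_eq_mul] at h0 h1
    have hc1 : c = 1 := by
      have : (1 - c) * d = 0 := by
        rw [hd] at h0 h1 ⊢
        linear_combination v.1 0 * h1 - v.1 1 * h0
      rcases mul_eq_zero.mp this with h' | h'
      · exact (sub_eq_zero.mp h').symm
      · exact absurd h' hd0
    rw [hc1] at h0 h1
    have h0' : f * d * v.1 0 = 0 := by linear_combination h0
    have h1' : f * d * v.1 1 = 0 := by linear_combination h1
    rcases v.ne_zero_or with hv | hv
    · exact hv (by simpa [hf, hd0] using h0')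
    · exact hv (by simpa [hf, hd0] using h1')
  · congr 1
    refine Subtype.ext ?_
    rw [hval, hw]
    simp

/-- A `p`-element fixing the point of a vector `v` acts as a transvection. -/
theorem exists_transv {σ : Equiv.Perm Ω} (hσ : σ ∈ L) {v : NonzeroVec p} (hv : σ (π v) = π v)
    {k : ℕ} (hk : σ ^ p ^ k = 1) : ∃ f, ∀ w, σ (π w) = π ((transv v.1 f).toGL • w) := by
  have base : ∀ {π : NonzeroVec p → Ω}, IsVectorModel L π → σ (π (stdVec p)) = π (stdVec p) →
      ∃ f, ∀ w, σ (π w) = π ((transv (stdVec p).1 f).toGL • w) := by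
    intro π h hfix
    obtain ⟨g, hg⟩ := h.linear σ hσ
    rw [hg] at hfix
    obtain ⟨l, hl⟩ := h.line hfix.symm
    have hval : ∀ (g : GL (Fin 2) (ZMod p)) (w : NonzeroVec p), (g • w).1 = g.1.mulVec w.1 :=
      fun _ _ => rfl
    have h00 : g.1 0 0 = l := by
      have := congrFun hl 0
      rw [hval] at this
      simpa [stdVec, Matrix.mulVec, dotProduct] using this
    have h10 : g.1 1 0 = 0 := by
      have := congrFun hl 1
      rw [hval] at this
      simpa [stdVec, Matrix.mulVec, dotProduct] using this
    have hpow : ∀ n : ℕ, (g ^ n).1 0 0 = l ^ n ∧ (g ^ n).1 1 0 = 0 ∧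
        (g ^ n).1 1 1 = g.1 1 1 ^ n := by
      intro n
      induction n with
      | zero => simp
      | succ n ih =>
        obtain ⟨i0, i1, i2⟩ := ih
        have hm : (g ^ (n + 1)).1 = (g ^ n).1 * g.1 := by rw [pow_succ]; rfl
        rw [hm]
        simp only [Matrix.mul_apply, Fin.sum_univ_two, i0, i1, i2, h00, h10]
        refine ⟨by ring, by ring, by ring⟩
    -- On `ZMod p` the map `x ↦ x ^ p ^ k` is the identity, so `g ^ p ^ k` has the same diagonal as
    -- `g`. It preserves every line, hence is scalar; so the two diagonal entries of `g` agree and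
    -- `g` is a scalar times a transvection.
    obtain ⟨q00, q10, q11⟩ := hpow (p ^ k)
    rw [ZMod.pow_card_pow] at q00 q11
    have hline : ∀ w : NonzeroVec p, ∃ c : ZMod p, (g ^ p ^ k).1.mulVec w.1 = c • w.1 := by
      intro w
      have := h.pow_apply hg (p ^ k) w
      rw [hk] at this
      obtain ⟨c, hc⟩ := h.line this
      exact ⟨c, hc⟩
    have q01 : (g ^ p ^ k).1 0 1 = 0 := by
      obtain ⟨c, hc⟩ := hline ⟨![0, 1], fun h0 => one_ne_zero (congrFun h0 1)⟩
      have := congrFun hc 0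
      simpa [Matrix.mulVec, dotProduct, Fin.sum_univ_two] using this
    have hld : l = g.1 1 1 := by
      obtain ⟨c, hc⟩ := hline ⟨![1, 1], fun h0 => one_ne_zero (congrFun h0 1)⟩
      have e0 := congrFun hc 0
      have e1 := congrFun hc 1
      simp only [Matrix.mulVec, dotProduct, Fin.sum_univ_two, q00, q01, q10, q11] at e0 e1
      simp at e0 e1
      rw [e0, e1]
    have hl0 : l ≠ 0 := by
      rintro rfl
      rw [zero_smul] at hl
      exact (g • stdVec p).2 hl
    refine ⟨g.1 0 1 / l, fun w => ?_⟩
    rw [hg]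
    refine h.smul_eq (c := l) hl ?_ hfix
    exact mulVec_eq_smul_transv hl0 h00 h10 hld.symm w.1
  obtain ⟨m, rfl⟩ := exists_specialLinear_stdVec v
  obtain ⟨f, hf⟩ := base (h.comp m) hv
  refine ⟨f, fun w => ?_⟩
  have := hf (m.toGL⁻¹ • w)
  rw [smul_inv_smul] at this
  rw [this, ← mul_smul, ← map_mul, transv_conj, map_mul, mul_smul, smul_inv_smul]
  rfl

theorem exists_transv_ne_zero {σ : Equiv.Perm Ω} (hσ : σ ∈ L) {v : NonzeroVec p}
    (hv : σ (π v) = π v) (hk : σ ^ p = 1) (hne : σ ≠ 1) :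
    ∃ f ≠ 0, ∀ w, σ (π w) = π ((transv v.1 f).toGL • w) := by
  obtain ⟨f, hf⟩ := h.exists_transv hσ hv (k := 1) (by rwa [pow_one])
  exact ⟨f, by rintro rfl; exact hne (h.transv_eq_one hf), hf⟩

/-- The commutator of `σ ∈ N` with a transvection fixing `x` lies in `N` and is a transvection with
parameter `s - 1`, where `s` is the ratio of the eigenvalues of `σ`. Having order dividing `p`, it
is trivial; so the eigenvalues agree, `σ` itself acts as a transvection, and `σ = 1`. -/
theorem normal {x : Ω} {N : Subgroup (Equiv.Perm Ω)} (hNL : N ≤ L) (hfix : ∀ σ ∈ N, σ x = x)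
    (hconj : ∀ τ ∈ L, τ x = x → ∀ σ ∈ N, τ * σ * τ⁻¹ ∈ N) (hN : ∀ σ ∈ N, σ ^ p = 1 → σ = 1) :
    ∀ σ ∈ N, σ = 1 := by
  intro σ hσ
  obtain ⟨v, rfl⟩ := h.surj x
  obtain ⟨m, rfl⟩ := exists_specialLinear_stdVec v
  replace h := h.comp m
  set π' : NonzeroVec p → Ω := fun v => π (m.toGL • v) with hπ'
  obtain ⟨g, hg⟩ := h.linear σ (hNL hσ)
  have hgfix : π' (g • stdVec p) = π' (stdVec p) := by rw [← hg]; exact hfix σ hσ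
  obtain ⟨l, hl⟩ := h.line hgfix.symm
  have hval : ∀ (g : GL (Fin 2) (ZMod p)) (w : NonzeroVec p), (g • w).1 = g.1.mulVec w.1 :=
    fun _ _ => rfl
  have hl0 : l ≠ 0 := by
    rintro rfl
    rw [zero_smul] at hl
    exact (g • stdVec p).2 hl
  have h00 : g.1 0 0 = l := by
    have := congrFun hl 0
    rw [hval] at this
    simpa [stdVec, Matrix.mulVec, dotProduct] using this
  have h10 : g.1 1 0 = 0 := by
    have := congrFun hl 1
    rw [hval] at this
    simpa [stdVec, Matrix.mulVec, dotProduct] using this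
  have hd0 : g.1 1 1 ≠ 0 := by
    intro hd
    have : IsUnit g.1.det := (Matrix.isUnit_iff_isUnit_det _).mp g.isUnit
    rw [Matrix.det_fin_two, hd, h10] at this
    simp at this
  obtain ⟨τ, hτ, hτe⟩ := h.special (transv (stdVec p).1 1)
  have hτfix : τ (π' (stdVec p)) = π' (stdVec p) := by
    rw [hτe]
    congr 1
    refine Subtype.ext ((transv_mulVec _ _ _).trans ?_)
    simp [stdVec]
  set s : ZMod p := l / g.1 1 1 with hs
  have hcomm : g * (transv (stdVec p).1 1).toGL = (transv (stdVec p).1 s).toGL * g := by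
    refine Units.ext ?_
    change g.1 * (transv (stdVec p).1 1).1 = (transv (stdVec p).1 s).1 * g.1
    ext i j
    rw [Matrix.mul_apply, Matrix.mul_apply, Fin.sum_univ_two, Fin.sum_univ_two]
    fin_cases i <;> fin_cases j <;> simp [transv, stdVec, h00, h10, hs]
    field_simp
    ring
  have hbr : σ * τ * σ⁻¹ * τ⁻¹ ∈ N := by
    have := N.mul_mem hσ (hconj τ hτ hτfix _ (N.inv_mem hσ))
    simpa [mul_assoc] using this
  have hact : ∀ w, (σ * τ * σ⁻¹ * τ⁻¹) (π' w) = π' ((transv (stdVec p).1 (s - 1)).toGL • w) := by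
    intro w
    have hst : ∀ u, (τ * σ) (π' u) = π' (((transv (stdVec p).1 1).toGL * g) • u) := fun u => by
      rw [Equiv.Perm.mul_apply, hg, hτe, mul_smul]
    have hts : ∀ u, (σ * τ) (π' u) = π' ((g * (transv (stdVec p).1 1).toGL) • u) := fun u => by
      rw [Equiv.Perm.mul_apply, hτe, hg, mul_smul]
    obtain ⟨u, rfl⟩ : ∃ u, w = ((transv (stdVec p).1 1).toGL * g) • u :=
      ⟨((transv (stdVec p).1 1).toGL * g)⁻¹ • w, by rw [smul_inv_smul]⟩
    rw [← hst, show σ * τ * σ⁻¹ * τ⁻¹ = (σ * τ) * (τ * σ)⁻¹ by group, Equiv.Perm.mul_apply,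
      Equiv.Perm.inv_def, Equiv.symm_apply_apply, hts, hcomm, ← mul_smul, ← mul_assoc, ← map_mul, transv_mul,
      sub_add_cancel]
  have hbr1 := hN _ hbr (h.transv_pow_eq_one (v := stdVec p) hact)
  have hs1 : s - 1 = 0 := by
    by_contra hne
    have := (h.transv_apply_eq_iff hne hact
      ⟨![0, 1], fun h0 => one_ne_zero (congrFun h0 1)⟩).mp (by rw [hbr1]; rfl)
    simp [stdVec] at this
  have hld : l = g.1 1 1 := by
    rw [sub_eq_zero, hs, div_eq_one_iff_eq hd0] at hs1
    exact hs1
  refine hN σ hσ (h.transv_pow_eq_one (v := stdVec p) (f := g.1 0 1 / l) fun w => ?_)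
  rw [hg]
  refine h.smul_eq (c := l) hl ?_ hgfix
  exact mulVec_eq_smul_transv hl0 h00 h10 hld.symm w.1

/-- In the basis `v, w`, powers of `σ` add arbitrary multiples of `v` to vectors off the line of
`v`, and powers of `τ` do the same with `w`; here it matters that the field is prime. Every vector
can thus be brought to `v + w`. -/
theorem transitive {x y : Ω} {σ τ : Equiv.Perm Ω} {A : Subgroup (Equiv.Perm Ω)} (hA : A ≤ L)
    (hσ : σ ∈ A) (hτ : τ ∈ A) (hσx : σ x = x) (hσp : σ ^ p = 1) (hσ1 : σ ≠ 1) (hτy : τ y = y)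
    (hτp : τ ^ p = 1) (hτ1 : τ ≠ 1) (hσy : σ y ≠ y) (z₁ z₂ : Ω) : ∃ ρ ∈ A, ρ z₁ = z₂ := by
  obtain ⟨v, rfl⟩ := h.surj x
  obtain ⟨w, rfl⟩ := h.surj y
  obtain ⟨f, hf, hfe⟩ := h.exists_transv_ne_zero (hA hσ) hσx hσp hσ1
  obtain ⟨f', hf', hfe'⟩ := h.exists_transv_ne_zero (hA hτ) hτy hτp hτ1
  set d := v.1 0 * w.1 1 - v.1 1 * w.1 0 with hd
  have hd0 : d ≠ 0 := fun hc => hσy ((h.transv_apply_eq_iff hf hfe w).mpr hc)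
  -- coordinates with respect to the basis `v, w`
  have hcoord : ∀ u : NonzeroVec p, ∃ a b : ZMod p, u.1 = a • v.1 + b • w.1 := by
    intro u
    refine ⟨(u.1 0 * w.1 1 - u.1 1 * w.1 0) / d, (v.1 0 * u.1 1 - v.1 1 * u.1 0) / d, ?_⟩
    ext i
    fin_cases i <;> simp <;> field_simp <;> rw [hd] <;> ring
  have hmove : ∀ {ρ : Equiv.Perm Ω} {t : NonzeroVec p} {r : ZMod p}, ρ ∈ A →
      (∀ u, ρ (π u) = π ((transv t.1 r).toGL • u)) → r ≠ 0 → ∀ (u : NonzeroVec p) (c : ZMod p),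
      t.1 0 * u.1 1 - t.1 1 * u.1 0 ≠ 0 → ∃ ρ' ∈ A, ∃ u' : NonzeroVec p,
      ρ' (π u) = π u' ∧ u'.1 = u.1 + c • t.1 := by
    intro ρ t r hρ hρe hr u c ht
    set e := t.1 0 * u.1 1 - t.1 1 * u.1 0 with he
    refine ⟨ρ ^ (c / (r * e)).val, pow_mem hρ _, _, h.pow_apply hρe _ u, ?_⟩
    rw [← map_pow, transv_pow]
    refine (transv_mulVec _ _ _).trans ?_
    rw [ZMod.natCast_zmod_val, ← he]
    congr 2
    field_simp
  have hσm := hmove hσ hfe hf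
  have hτm := hmove hτ hfe' hf'
  obtain ⟨m, hm⟩ : ∃ m : NonzeroVec p, m.1 = v.1 + w.1 := by
    refine ⟨⟨v.1 + w.1, fun hc => hd0 ?_⟩, rfl⟩
    have h0 := congrFun hc 0
    have h1 := congrFun hc 1
    simp only [Pi.add_apply, Pi.zero_apply] at h0 h1
    rw [hd]
    linear_combination v.1 0 * h1 - v.1 1 * h0
  have hBv : ∀ (u : NonzeroVec p) (a b : ZMod p), u.1 = a • v.1 + b • w.1 →
      v.1 0 * u.1 1 - v.1 1 * u.1 0 = b * d := by
    intro u a b e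
    rw [e, hd]
    simp only [Pi.add_apply, Pi.smul_apply, smul_eq_mul]
    ring
  have hBw : ∀ (u : NonzeroVec p) (a b : ZMod p), u.1 = a • v.1 + b • w.1 →
      w.1 0 * u.1 1 - w.1 1 * u.1 0 = -(a * d) := by
    intro u a b e
    rw [e, hd]
    simp only [Pi.add_apply, Pi.smul_apply, smul_eq_mul]
    ring
  have hto : ∀ u : NonzeroVec p, ∃ ρ ∈ A, ρ (π u) = π m := by
    have h1 : ∀ (u : NonzeroVec p) (b : ZMod p), u.1 = v.1 + b • w.1 →
        ∃ ρ ∈ A, ρ (π u) = π m := by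
      intro u b e
      obtain ⟨ρ, hρ, u', e1, e2⟩ := hτm u (1 - b) (by
        rw [hBw u 1 b (by rw [e, one_smul]), one_mul]
        exact neg_ne_zero.mpr hd0)
      refine ⟨ρ, hρ, e1.trans (congrArg π (Subtype.ext ?_))⟩
      rw [e2, e, hm]
      module
    have h2 : ∀ (u : NonzeroVec p) (a b : ZMod p), b ≠ 0 → u.1 = a • v.1 + b • w.1 →
        ∃ ρ ∈ A, ρ (π u) = π m := by
      intro u a b hb e
      obtain ⟨ρ, hρ, u', e1, e2⟩ := hσm u (1 - a) (by
        rw [hBv u a b e]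
        exact mul_ne_zero hb hd0)
      obtain ⟨ρ', hρ', e'⟩ := h1 u' b (by rw [e2, e]; module)
      exact ⟨ρ' * ρ, mul_mem hρ' hρ, by rw [Equiv.Perm.mul_apply, e1, e']⟩
    intro u
    obtain ⟨a, b, e⟩ := hcoord u
    by_cases hb : b = 0
    · have ha : a ≠ 0 := by
        rintro rfl
        exact u.2 (by rw [e, hb]; simp)
      -- On the line of `v` itself `σ` moves nothing, so `w` is added first.
      obtain ⟨ρ, hρ, u', e1, e2⟩ := hτm u 1 (by
        rw [hBw u a b e]
        exact neg_ne_zero.mpr (mul_ne_zero ha hd0))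
      obtain ⟨ρ', hρ', e'⟩ := h2 u' a 1 one_ne_zero (by rw [e2, e, hb]; module)
      exact ⟨ρ' * ρ, mul_mem hρ' hρ, by rw [Equiv.Perm.mul_apply, e1, e']⟩
    · exact h2 u a b hb e
  obtain ⟨u₁, rfl⟩ := h.surj z₁
  obtain ⟨u₂, rfl⟩ := h.surj z₂
  obtain ⟨ρ₁, hρ₁, e₁⟩ := hto u₁
  obtain ⟨ρ₂, hρ₂, e₂⟩ := hto u₂
  exact ⟨ρ₂⁻¹ * ρ₁, mul_mem (inv_mem hρ₂) hρ₁, by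
    rw [Equiv.Perm.mul_apply, e₁, ← e₂, Equiv.Perm.inv_def, Equiv.symm_apply_apply]⟩

/-- The lines of `(1,0)`, `(0,1)` and `(1,1)` are distinct over every `ZMod p`, including `p = 2`.
-/
theorem directions (x : Ω) : ∃ z₁ z₂ : Ω,
    (∀ σ ∈ L, σ x = x → σ ^ p = 1 → σ ≠ 1 → σ z₁ ≠ z₁ ∧ σ z₂ ≠ z₂) ∧
    (∀ σ ∈ L, σ z₁ = z₁ → σ ^ p = 1 → σ ≠ 1 → σ z₂ ≠ z₂) := by
  obtain ⟨v, rfl⟩ := h.surj x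
  obtain ⟨m, rfl⟩ := exists_specialLinear_stdVec v
  replace h := h.comp m
  set π' : NonzeroVec p → Ω := fun v => π (m.toGL • v) with hπ'
  let w : NonzeroVec p := ⟨![0, 1], fun h0 => one_ne_zero (congrFun h0 1)⟩
  let w' : NonzeroVec p := ⟨![1, 1], fun h0 => one_ne_zero (congrFun h0 1)⟩
  refine ⟨π' w, π' w', fun σ hσ hx hσp hσ1 => ?_, fun σ hσ hx hσp hσ1 => ?_⟩
  · obtain ⟨f, hf, hfe⟩ := h.exists_transv_ne_zero hσ hx hσp hσ1
    refine ⟨fun e => ?_, fun e => ?_⟩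
    · have := (h.transv_apply_eq_iff hf hfe w).mp e
      simp [stdVec, w] at this
    · have := (h.transv_apply_eq_iff hf hfe w').mp e
      simp [stdVec, w'] at this
  · obtain ⟨f, hf, hfe⟩ := h.exists_transv_ne_zero hσ hx hσp hσ1
    intro e
    have := (h.transv_apply_eq_iff hf hfe w').mp e
    simp [w, w'] at this

theorem isRankOne : IsRankOne p L where
  trans x y := by
    obtain ⟨v, rfl⟩ := h.surj x
    obtain ⟨w, rfl⟩ := h.surj y
    obtain ⟨g, rfl⟩ := exists_specialLinear_smul v w
    obtain ⟨σ, hσ, e⟩ := h.special g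
    exact ⟨σ, hσ, e v⟩
  pow {σ x k} hσ hx hk := by
    obtain ⟨v, rfl⟩ := h.surj x
    obtain ⟨f, hf⟩ := h.exists_transv hσ hx hk
    exact h.transv_pow_eq_one hf
  cyclic {σ τ x} hσ hτ hσx hτx hσp hτp hσ1 := by
    obtain ⟨v, rfl⟩ := h.surj x
    obtain ⟨f, hf, hfe⟩ := h.exists_transv_ne_zero hσ hσx hσp hσ1
    obtain ⟨f', hfe'⟩ := h.exists_transv hτ hτx (k := 1) (by rwa [pow_one])
    refine ⟨(-f' / f).val, h.transv_eq_one (v := v) fun w => ?_⟩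
    rw [Equiv.Perm.mul_apply, hfe', h.pow_apply hfe, ← mul_smul, ← map_pow, ← map_mul, transv_pow,
      transv_mul, ZMod.natCast_zmod_val]
    congr 4
    field_simp
    ring
  exists_unip x := by
    obtain ⟨v, rfl⟩ := h.surj x
    obtain ⟨σ, hσ, e⟩ := h.special (transv v.1 1)
    refine ⟨σ, hσ, ?_, h.transv_pow_eq_one e, ?_⟩
    · rw [h.transv_apply_eq_iff one_ne_zero e]
      ring
    · rintro rfl
      have hall := fun w => (h.transv_apply_eq_iff one_ne_zero e w).mp rfl
      rcases v.ne_zero_or with hv | hv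
      · refine hv ?_
        simpa using hall ⟨![0, 1], fun h0 => one_ne_zero (congrFun h0 1)⟩
      · refine hv ?_
        simpa using hall ⟨![1, 0], fun h0 => one_ne_zero (congrFun h0 0)⟩
  normal := h.normal
  transitive := h.transitive
  directions := h.directions

end IsVectorModel

end RankOne

/-! ### From the local permutation group to the graph. -/

section LocalAction

theorem IsRankOne.of_equiv {Ω Ω' : Type*} {p : ℕ} {A : Subgroup (Equiv.Perm Ω)}
    {B : Subgroup (Equiv.Perm Ω')} (hB : IsRankOne p B) (e : Ω ≃ Ω')
    (hmem : ∀ σ, σ ∈ A ↔ e.permCongrHom σ ∈ B) : IsRankOne p A := by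
  set c := e.permCongrHom with hc
  have happ : ∀ (σ : Equiv.Perm Ω) (x : Ω), c σ (e x) = e (σ x) := fun σ x => by
    simp [hc, Equiv.permCongrHom, Equiv.permCongr_apply]
  have hfix : ∀ (σ : Equiv.Perm Ω) (x : Ω), c σ (e x) = e x ↔ σ x = x := fun σ x => by
    rw [happ, e.apply_eq_iff_eq]
  have hone : ∀ σ : Equiv.Perm Ω, c σ = 1 ↔ σ = 1 := fun σ => by rw [map_eq_one_iff _ c.injective]
  have hpow : ∀ (σ : Equiv.Perm Ω) (n : ℕ), c σ ^ n = 1 ↔ σ ^ n = 1 := fun σ n => by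
    rw [← map_pow, hone]
  have hmap : ∀ {N : Subgroup (Equiv.Perm Ω)}, N ≤ A → N.map c.toMonoidHom ≤ B := by
    rintro N hN _ ⟨σ, hσ, rfl⟩
    exact (hmem σ).mp (hN hσ)
  refine ⟨fun x y => ?_, fun {σ x k} hσ hx hk => ?_, fun {σ τ x} hσ hτ hσx hτx hσp hτp hσ1 => ?_,
    fun x => ?_, fun {x N} hN hfixN hconj hp σ hσ => ?_,
    fun {x y σ τ H} hH hσ hτ hσx hσp hσ1 hτy hτp hτ1 hσy z₁ z₂ => ?_, fun x => ?_⟩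
  · obtain ⟨τ, hτ, h⟩ := hB.trans (e x) (e y)
    obtain ⟨σ, rfl⟩ := c.surjective τ
    exact ⟨σ, (hmem σ).mpr hτ, e.injective (by rw [← happ, h])⟩
  · exact (hpow _ _).mp (hB.pow ((hmem σ).mp hσ) ((hfix σ x).mpr hx) ((hpow _ _).mpr hk))
  · obtain ⟨k, hk⟩ := hB.cyclic ((hmem σ).mp hσ) ((hmem τ).mp hτ) ((hfix σ x).mpr hσx)
      ((hfix τ x).mpr hτx) ((hpow _ _).mpr hσp) ((hpow _ _).mpr hτp) (mt (hone σ).mp hσ1)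
    exact ⟨k, by rwa [← map_pow, ← map_mul, hone] at hk⟩
  · obtain ⟨τ, hτ, hx, hp, h1⟩ := hB.exists_unip (e x)
    obtain ⟨σ, rfl⟩ := c.surjective τ
    exact ⟨σ, (hmem σ).mpr hτ, (hfix σ x).mp hx, (hpow _ _).mp hp, mt (hone σ).mpr h1⟩
  · rw [← hone]
    refine hB.normal (x := e x) (N := N.map c.toMonoidHom) (hmap hN) ?_ ?_ ?_ _ ⟨σ, hσ, rfl⟩
    · rintro _ ⟨τ, hτ, rfl⟩
      exact (hfix τ x).mpr (hfixN τ hτ)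
    · rintro τ hτ hτx _ ⟨ρ, hρ, rfl⟩
      obtain ⟨τ, rfl⟩ := c.surjective τ
      refine ⟨τ * ρ * τ⁻¹, hconj τ ((hmem τ).mpr hτ) ((hfix τ x).mp hτx) ρ hρ, ?_⟩
      simp
    · rintro _ ⟨τ, hτ, rfl⟩ hτp
      exact (hone τ).mpr (hp τ hτ ((hpow _ _).mp hτp))
  · obtain ⟨_, ⟨ρ, hρ, rfl⟩, h⟩ := hB.transitive (x := e x) (y := e y) (σ := c σ) (τ := c τ)
      (hmap hH) ⟨σ, hσ, rfl⟩ ⟨τ, hτ, rfl⟩ ((hfix σ x).mpr hσx) ((hpow _ _).mpr hσp)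
      (mt (hone σ).mp hσ1) ((hfix τ y).mpr hτy) ((hpow _ _).mpr hτp) (mt (hone τ).mp hτ1)
      (mt (hfix σ y).mp hσy) (e z₁) (e z₂)
    exact ⟨ρ, hρ, e.injective ((happ ρ z₁).symm.trans h)⟩
  · obtain ⟨w₁, w₂, h₁, h₂⟩ := hB.directions (e x)
    obtain ⟨z₁, rfl⟩ := e.surjective w₁
    obtain ⟨z₂, rfl⟩ := e.surjective w₂
    refine ⟨z₁, z₂, fun σ hσ hx hp h1 => ?_, fun σ hσ hx hp h1 => ?_⟩
    · have := h₁ (c σ) ((hmem σ).mp hσ) ((hfix σ x).mpr hx) ((hpow _ _).mpr hp)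
        (mt (hone σ).mp h1)
      exact ⟨mt (hfix σ z₁).mpr this.1, mt (hfix σ z₂).mpr this.2⟩
    · exact mt (hfix σ z₂).mpr (h₂ (c σ) ((hmem σ).mp hσ) ((hfix σ z₁).mpr hx)
        ((hpow _ _).mpr hp) (mt (hone σ).mp h1))

theorem PermIsomorphic.exists_equiv {X Y : Type*} {A : Subgroup (Equiv.Perm X)}
    {B : Subgroup (Equiv.Perm Y)} (h : PermIsomorphic A B) :
    ∃ e : X ≃ Y, ∀ σ, σ ∈ A ↔ e.permCongrHom σ ∈ B := by
  obtain ⟨e, φ, hφ⟩ := h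
  have key : ∀ a : A, e.permCongrHom (a : Equiv.Perm X) = φ a := fun a => by
    ext y
    obtain ⟨x, rfl⟩ := e.surjective y
    rw [← hφ]
    simp [Equiv.permCongrHom, Equiv.permCongr_apply]
  refine ⟨e, fun σ => ⟨fun hσ => ?_, fun hσ => ?_⟩⟩
  · rw [key ⟨σ, hσ⟩]
    exact (φ ⟨σ, hσ⟩).2
  · have := key (φ.symm ⟨_, hσ⟩)
    rw [φ.apply_symm_apply] at this
    rw [← e.permCongrHom.injective this]
    exact (φ.symm ⟨_, hσ⟩).2

variable {V : Type*} {Γ : SimpleGraph V} {G : Subgroup (Γ ≃g Γ)}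

theorem mem_localAction {a : V} {σ : Equiv.Perm (Γ.neighborSet a)} :
    σ ∈ localAction Γ G a ↔ ∃ g : G, g • a = a ∧ ∀ z, (σ z : V) = g • (z : V) := by
  constructor
  · rintro ⟨g, rfl⟩
    exact ⟨g, g.2, fun z => rfl⟩
  · rintro ⟨g, hg, hz⟩
    exact ⟨⟨g, hg⟩, Equiv.ext fun z => Subtype.ext (hz z).symm⟩

theorem localAction_smul (g : G) (a : V) :
    ∃ e : Γ.neighborSet (g • a) ≃ Γ.neighborSet a,
      ∀ σ, σ ∈ localAction Γ G (g • a) ↔ e.permCongrHom σ ∈ localAction Γ G a := by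
  let e : Γ.neighborSet a ≃ Γ.neighborSet (g • a) := SimpleGraph.Iso.mapNeighborSet (g : Γ ≃g Γ) a
  have he : ∀ z, (e z : V) = g • (z : V) := fun z => rfl
  have he' : ∀ z, (e.symm z : V) = g⁻¹ • (z : V) := fun z => by
    rw [eq_inv_smul_iff, ← he, e.apply_symm_apply]
  refine ⟨e.symm, fun σ => ?_⟩
  rw [mem_localAction, mem_localAction]
  have hc : ∀ z, e.symm.permCongrHom σ z = e.symm (σ (e z)) := fun z => rfl
  constructor
  · rintro ⟨k, hk, hz⟩
    refine ⟨g⁻¹ * k * g, by rw [mul_smul, mul_smul, hk, inv_smul_smul], fun z => ?_⟩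
    rw [hc, he', hz, he, mul_smul, mul_smul]
  · rintro ⟨k, hk, hz⟩
    refine ⟨g * k * g⁻¹, by rw [mul_smul, mul_smul, inv_smul_smul, hk], fun z => ?_⟩
    have := hz (e.symm z)
    rw [hc, e.apply_symm_apply, he', he', inv_smul_eq_iff] at this
    rw [this, mul_smul, mul_smul]

/-- Each property is pulled back along the action on the neighbours, whose kernel is `nbrFixer`:
equations between permutations become membership in it. -/
theorem isLocallyRankOne {p : ℕ} (hc : Γ.Connected) (ht : MulAction.IsPretransitive G V)
    (hr : ∀ x, IsRankOne p (localAction Γ G x)) : IsLocallyRankOne Γ G p := by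
  let φ : ∀ x : V, MulAction.stabilizer G x →* Equiv.Perm (Γ.neighborSet x) := fun x =>
    MulAction.toPermHom _ _
  have hmem : ∀ (x : V) (g : MulAction.stabilizer G x), φ x g ∈ localAction Γ G x :=
    fun x g => ⟨g, rfl⟩
  have happ : ∀ (x : V) (g : MulAction.stabilizer G x) (z : Γ.neighborSet x),
      (φ x g z : V) = (g : G) • (z : V) := fun _ _ _ => rfl
  have hfix : ∀ {x : V} {g : MulAction.stabilizer G x} {z : Γ.neighborSet x},
      φ x g z = z ↔ (g : G) • (z : V) = z := fun {x g z} => by rw [Subtype.ext_iff, happ]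
  have hone : ∀ {x : V} {g : MulAction.stabilizer G x},
      φ x g = 1 ↔ (g : G) ∈ nbrFixer Γ G x := by
    intro x g
    refine ⟨fun h => ⟨g.2, fun y hy => ?_⟩, fun h => Equiv.ext fun z => ?_⟩
    · exact hfix.mp (show φ x g ⟨y, hy⟩ = ⟨y, hy⟩ by rw [h]; rfl)
    · exact hfix.mpr (h.2 _ z.2)
  have hpow : ∀ {x : V} {g : MulAction.stabilizer G x} {n : ℕ},
      φ x g ^ n = 1 ↔ (g : G) ^ n ∈ nbrFixer Γ G x := by
    intro x g n
    rw [← map_pow, hone, Subgroup.coe_pow]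
  have hsub : ∀ {x : V} {N : Subgroup G},
      (N.subgroupOf (MulAction.stabilizer G x)).map (φ x) ≤ localAction Γ G x := by
    rintro x N _ ⟨g, -, rfl⟩
    exact hmem x g
  refine
    { connected := hc
      smul_adj := fun g x y h => (g : Γ ≃g Γ).map_adj_iff.mpr h
      exists_smul := fun x y => ht.exists_smul_eq x y
      exists_smul_nbr := fun {x y z} hy hz => ?_
      unip_of_pow := fun {x y g k} hy hx hgy hk => ?_
      cyclic := fun {x y a h} hy hax hay hhx hhy hap hhp ha => ?_
      exists_unip := fun {x y} hy => ?_
      normal := fun {x y} N hy hfixN hconj hp n hn => ?_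
      transitive := fun {x y z a b} A hy hz hA ha hay hap ha1 hb hbz hbp hb1 haz z₁ z₂ h₁ h₂ => ?_
      directions := fun {x y} hy => ?_ }
  · obtain ⟨_, ⟨g, rfl⟩, h⟩ := (hr x).trans ⟨y, hy⟩ ⟨z, hz⟩
    exact ⟨g, g.2, congrArg Subtype.val h⟩
  · exact hpow.mp ((hr x).pow (hmem x ⟨g, hx⟩) ((hfix (z := ⟨y, hy⟩)).mpr hgy) (hpow.mpr hk))
  · obtain ⟨k, hk⟩ := (hr x).cyclic (hmem x ⟨a, hax⟩) (hmem x ⟨h, hhx⟩)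
      ((hfix (z := ⟨y, hy⟩)).mpr hay) ((hfix (z := ⟨y, hy⟩)).mpr hhy) (hpow.mpr hap) (hpow.mpr hhp)
      (mt hone.mp ha)
    rw [← map_pow, ← map_mul, hone] at hk
    exact ⟨k, hk⟩
  · obtain ⟨_, ⟨g, rfl⟩, hgy, hgp, hg1⟩ := (hr x).exists_unip ⟨y, hy⟩
    exact ⟨g, g.2, hfix.mp hgy, hpow.mp hgp, mt hone.mpr hg1⟩
  · refine hone.mp ((hr x).normal (x := ⟨y, hy⟩) hsub ?_ ?_ ?_ (φ x ⟨n, (hfixN n hn).1⟩)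
      ⟨_, hn, rfl⟩)
    · rintro _ ⟨g, hg, rfl⟩
      exact hfix.mpr (hfixN _ hg).2
    · rintro _ ⟨k, rfl⟩ hky _ ⟨g, hg, rfl⟩
      refine ⟨k * g * k⁻¹, hconj k k.2 (hfix.mp hky) g hg, ?_⟩
      rw [map_mul, map_mul, map_inv]
    · rintro _ ⟨g, hg, rfl⟩ hgp
      exact hone.mpr (hp g hg (hpow.mp hgp))
  · obtain ⟨_, ⟨g, hg, rfl⟩, h⟩ := (hr x).transitive (x := ⟨y, hy⟩) (y := ⟨z, hz⟩)
      (σ := φ x ⟨a, hA a ha⟩) (τ := φ x ⟨b, hA b hb⟩) (hsub (N := A)) ⟨_, ha, rfl⟩ ⟨_, hb, rfl⟩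
      (hfix.mpr hay) (hpow.mpr hap) (mt hone.mp ha1) (hfix.mpr hbz) (hpow.mpr hbp)
      (mt hone.mp hb1) (mt hfix.mp haz) ⟨z₁, h₁⟩ ⟨z₂, h₂⟩
    exact ⟨g, hg, congrArg Subtype.val h⟩
  · obtain ⟨⟨z₁, h₁⟩, ⟨z₂, h₂⟩, hd, hd'⟩ := (hr x).directions ⟨y, hy⟩
    refine ⟨z₁, z₂, h₁, h₂, fun a hax hay hap ha => ?_, fun a hax haz hap ha => ?_⟩
    · have := hd _ (hmem x ⟨a, hax⟩) (hfix.mpr hay) (hpow.mpr hap) (mt hone.mp ha)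
      exact ⟨fun h => this.1 (hfix.mpr h), fun h => this.2 (hfix.mpr h)⟩
    · exact fun h => hd' _ (hmem x ⟨a, hax⟩) (hfix.mpr haz) (hpow.mpr hap) (mt hone.mp ha)
        (hfix.mpr h)

/-- The arc stabiliser acts on both neighbourhoods, and the kernel of the joint action lies in `K_a
∩ K_b`. -/
theorem card_stabilizer_inf_le [Finite V] (a b : V) :
    Nat.card ↥(MulAction.stabilizer G a ⊓ MulAction.stabilizer G b) ≤
      Nat.card ↥(nbrFixer Γ G a ⊓ nbrFixer Γ G b) *
        ((Nat.card (Γ.neighborSet a)).factorial * (Nat.card (Γ.neighborSet b)).factorial) := by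
  have : Finite (Γ ≃g Γ) := DFunLike.finite _
  let φ : ∀ x : V, MulAction.stabilizer G x →* Equiv.Perm (Γ.neighborSet x) := fun x =>
    MulAction.toPermHom _ _
  let ψ := ((φ a).comp (Subgroup.inclusion inf_le_left)).prod
    ((φ b).comp (Subgroup.inclusion (inf_le_right : MulAction.stabilizer G a ⊓ _ ≤ _)))
  rw [← ψ.ker.card_mul_index, Subgroup.index_ker, ← Nat.card_perm (α := Γ.neighborSet a),
    ← Nat.card_perm (α := Γ.neighborSet b), 
    ← Nat.card_prod (Equiv.Perm (Γ.neighborSet a))]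
  refine Nat.mul_le_mul ?_ (Subgroup.card_le_card_group ψ.range)
  have hker : ∀ g ∈ ψ.ker, (g : G) ∈ nbrFixer Γ G a ⊓ nbrFixer Γ G b := by
    intro g hg
    have hg' := Prod.ext_iff.mp (MonoidHom.mem_ker.mp hg)
    exact ⟨⟨g.2.1, fun y hy => congrArg Subtype.val
        (DFunLike.congr_fun hg'.1 (⟨y, hy⟩ : Γ.neighborSet a))⟩,
      ⟨g.2.2, fun y hy => congrArg Subtype.val
        (DFunLike.congr_fun hg'.2 (⟨y, hy⟩ : Γ.neighborSet b))⟩⟩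
  refine Nat.card_le_card_of_injective (fun g => ⟨_, hker g.1 g.2⟩) fun g h e => ?_
  exact Subtype.ext (Subtype.ext (Subtype.mk.inj e))

theorem IsRankOne.isGraphRestrictive {Ω : Type v} {L : Subgroup (Equiv.Perm Ω)} {p : ℕ}
    [Fact p.Prime] (hL : IsRankOne p L) : IsGraphRestrictive.{u, v} L := by
  refine ⟨⟨fun x y => ?_⟩, p ^ 6 * ((Nat.card Ω).factorial * (Nat.card Ω).factorial), ?_⟩
  · obtain ⟨σ, hσ, h⟩ := hL.trans x y
    exact ⟨⟨σ, hσ⟩, h⟩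
  · rintro V _ Γ G ⟨hc, ht, a₀, hiso⟩ a b hab
    obtain ⟨e₀, he₀⟩ := hiso.exists_equiv
    have hr₀ := hL.of_equiv e₀ he₀
    have hr : ∀ x, IsRankOne p (localAction Γ G x) ∧ Nat.card (Γ.neighborSet x) = Nat.card Ω := by
      intro x
      obtain ⟨g, rfl⟩ := ht.exists_smul_eq a₀ x
      obtain ⟨e, he⟩ := localAction_smul g a₀
      exact ⟨hr₀.of_equiv e he, Nat.card_congr (e.trans e₀)⟩
    have : Finite (Γ ≃g Γ) := DFunLike.finite _
    refine (card_stabilizer_inf_le a b).trans ?_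
    rw [(hr a).2, (hr b).2]
    exact Nat.mul_le_mul_right _
      (card_nbrFixer_inf_le (isLocallyRankOne hc ht fun x => (hr x).1) hab)

end LocalAction

/-! ### The groups of the theorem as vector models, and the kernel on orbits. -/

section Models

variable {p : ℕ} [Fact p.Prime]

theorem exists_smul_eq_of_mem_center {k : GL (Fin 2) (ZMod p)}
    (hk : k ∈ Subgroup.center (GL (Fin 2) (ZMod p))) :
    ∃ c : ZMod p, ∀ v : Fin 2 → ZMod p, k • v = c • v := by
  rw [Matrix.GeneralLinearGroup.center_eq_range_scalar] at hk
  obtain ⟨c, rfl⟩ := hk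
  refine ⟨c, fun v => ?_⟩
  change (Matrix.scalar (Fin 2) (c : ZMod p)).mulVec v = _
  simp [Matrix.scalar_apply, ← Matrix.smul_one_eq_diagonal, Matrix.smul_mulVec]

theorem isVectorModel_linearOrbitGroup {G K : Subgroup (GL (Fin 2) (ZMod p))}
    (hG : (Matrix.SpecialLinearGroup.toGL : SL(2, ZMod p) →* GL (Fin 2) (ZMod p)).range ≤ G)
    (hK : K ≤ Subgroup.center (GL (Fin 2) (ZMod p))) :
    IsVectorModel (linearOrbitGroup p G K hK) (Quotient.mk (MulAction.orbitRel K (NonzeroVec p)))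
    where
  surj := Quotient.mk_surjective
  line {v w} h := by
    obtain ⟨k, rfl⟩ := Quotient.exact h.symm
    obtain ⟨c, hc⟩ := exists_smul_eq_of_mem_center (hK k.2)
    exact ⟨c, hc v.1⟩
  linear := by
    rintro _ ⟨g, -, rfl⟩
    exact ⟨g, fun v => rfl⟩
  special g := ⟨_, ⟨g.toGL, hG ⟨g, rfl⟩, rfl⟩, fun v => rfl⟩

theorem isVectorModel_generalLinearGroup :
    IsVectorModel (inducedPermGroup (GL (Fin 2) (ZMod p)) (NonzeroVec p)) id where
  surj := Function.surjective_id
  line {v w} h := ⟨1, by rw [one_smul]; exact congrArg Subtype.val h.symm⟩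
  linear := by
    rintro _ ⟨g, rfl⟩
    exact ⟨g, fun v => rfl⟩
  special g := ⟨_, ⟨g.toGL, rfl⟩, fun v => rfl⟩

theorem isVectorModel_specialLinearGroup :
    IsVectorModel (inducedPermGroup SL(2, ZMod p) (NonzeroVec p)) id where
  surj := Function.surjective_id
  line {v w} h := ⟨1, by rw [one_smul]; exact congrArg Subtype.val h.symm⟩
  linear := by
    rintro _ ⟨g, rfl⟩
    exact ⟨g.toGL, fun v => rfl⟩
  special g := ⟨_, ⟨g, rfl⟩, fun v => rfl⟩

/-- The line spanned by a nonzero vector. -/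
def spanPoint (v : NonzeroVec p) : ℙ (ZMod p) (Fin 2 → ZMod p) :=
  Projectivization.mk (ZMod p) v.1 v.2

theorem spanPoint_surjective : Function.Surjective (spanPoint (p := p)) := fun x => by
  induction x using Projectivization.ind with
  | h v hv => exact ⟨⟨v, hv⟩, rfl⟩

theorem exists_smul_eq_of_spanPoint_eq {v w : NonzeroVec p} (h : spanPoint v = spanPoint w) :
    ∃ c : ZMod p, w.1 = c • v.1 := by
  obtain ⟨c, hc⟩ := (Projectivization.mk_eq_mk_iff' (ZMod p) _ _ _ _).mp h.symm
  exact ⟨c, hc.symm⟩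

theorem isVectorModel_projGenLinGroup :
    IsVectorModel (inducedPermGroup PGL(Fin 2, ZMod p) (ℙ (ZMod p) (Fin 2 → ZMod p)))
      (spanPoint (p := p)) where
  surj := spanPoint_surjective
  line := exists_smul_eq_of_spanPoint_eq
  linear := by
    rintro _ ⟨x, rfl⟩
    obtain ⟨g, rfl⟩ := Matrix.ProjGenLinGroup.mk_surjective x
    exact ⟨g, fun v => rfl⟩
  special g := ⟨_, ⟨Matrix.ProjGenLinGroup.mk g.toGL, rfl⟩, fun v => rfl⟩

theorem isVectorModel_projectiveSpecialLinearGroup :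
    IsVectorModel (inducedPermGroup PSL(2, ZMod p) (ℙ (ZMod p) (Fin 2 → ZMod p)))
      (spanPoint (p := p)) where
  surj := spanPoint_surjective
  line := exists_smul_eq_of_spanPoint_eq
  linear := by
    rintro _ ⟨x, rfl⟩
    obtain ⟨g, rfl⟩ := QuotientGroup.mk_surjective x
    exact ⟨g.toGL, fun v => rfl⟩
  special g := ⟨_, ⟨(g : PSL(2, ZMod p)), rfl⟩, fun v => rfl⟩

/-- A matrix that maps every vector into its orbit under a group of scalars is in that group. -/
theorem mem_of_forall_mem_orbit {g : GL (Fin 2) (ZMod p)} {K : Subgroup (GL (Fin 2) (ZMod p))}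
    (hK : K ≤ Subgroup.center (GL (Fin 2) (ZMod p)))
    (h : ∀ v : NonzeroVec p, ∃ k ∈ K, k • v = g • v) : g ∈ K := by
  have hline : ∀ v : NonzeroVec p, ∃ c : ZMod p, g.1.mulVec v.1 = c • v.1 := fun v => by
    obtain ⟨k, hk, e⟩ := h v
    obtain ⟨c, hc⟩ := exists_smul_eq_of_mem_center (hK hk)
    exact ⟨c, (congrArg Subtype.val e).symm.trans (hc v.1)⟩
  have hv : ∀ a b : ZMod p, a = 1 ∨ b = 1 → (![a, b] : Fin 2 → ZMod p) ≠ 0 := by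
    rintro a b hab h0
    rcases hab with rfl | rfl
    · exact one_ne_zero (congrFun h0 0)
    · exact one_ne_zero (congrFun h0 1)
  have h10 : g.1 1 0 = 0 := by
    obtain ⟨c, hc⟩ := hline ⟨![1, 0], hv _ _ (Or.inl rfl)⟩
    simpa [Matrix.mulVec, dotProduct, Fin.sum_univ_two] using congrFun hc 1
  have h01 : g.1 0 1 = 0 := by
    obtain ⟨c, hc⟩ := hline ⟨![0, 1], hv _ _ (Or.inr rfl)⟩
    simpa [Matrix.mulVec, dotProduct, Fin.sum_univ_two] using congrFun hc 0
  have h11 : g.1 0 0 = g.1 1 1 := by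
    obtain ⟨c, hc⟩ := hline ⟨![1, 1], hv _ _ (Or.inl rfl)⟩
    have e0 := congrFun hc 0
    have e1 := congrFun hc 1
    simp [Matrix.mulVec, dotProduct, Fin.sum_univ_two, h10, h01] at e0 e1
    rw [e0, e1]
  have hg : g ∈ Subgroup.center (GL (Fin 2) (ZMod p)) := by
    rw [Matrix.GeneralLinearGroup.mem_center_iff_val_mem_range_scalar]
    refine ⟨g.1 1 1, ?_⟩
    ext i j
    fin_cases i <;> fin_cases j <;> simp [h10, h01, h11]
  -- Now that `g` is known to be scalar, the orbit of a single vector already determines it as an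
  -- element of `K`.
  obtain ⟨k, hk, e⟩ := h ⟨![1, 0], hv _ _ (Or.inl rfl)⟩
  obtain ⟨c, hc⟩ := exists_smul_eq_of_mem_center hg
  obtain ⟨d, hd⟩ := exists_smul_eq_of_mem_center (hK hk)
  have hcd : d = c := by
    have := congrFun ((hd _).symm.trans ((congrArg Subtype.val e).trans (hc _))) 0
    simpa using this
  have : k = g := Units.ext (Matrix.mulVec_injective (funext fun v =>
    (hd v).trans ((congrArg (· • v) hcd).trans (hc v).symm)))
  exact this ▸ hk

theorem ker_orbitPermHom (K : Subgroup (GL (Fin 2) (ZMod p)))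
    (hK : K ≤ Subgroup.center (GL (Fin 2) (ZMod p))) :
    (orbitPermHom (NonzeroVec p) K hK).ker = K := by
  ext g
  refine ⟨fun hg => mem_of_forall_mem_orbit hK fun v => ?_, fun hg => Equiv.ext ?_⟩
  · obtain ⟨k, hk⟩ := Quotient.exact (DFunLike.congr_fun (MonoidHom.mem_ker.mp hg)
      (Quotient.mk (MulAction.orbitRel K (NonzeroVec p)) v))
    exact ⟨k, k.2, hk⟩
  · rintro ⟨v⟩
    exact Quotient.sound ⟨⟨g, hg⟩, rfl⟩

end Models

theorem mainTheorem4 (p : ℕ) [Fact p.Prime] :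
    (∀ (G K : Subgroup (GL (Fin 2) (ZMod p))),
      (Matrix.SpecialLinearGroup.toGL : SL(2, ZMod p) →* GL (Fin 2) (ZMod p)).range ≤ G →
      K ≤ G → ∀ hK : K ≤ Subgroup.center (GL (Fin 2) (ZMod p)),
        ((orbitPermHom (NonzeroVec p) K hK).comp G.subtype).ker = K.subgroupOf G ∧
        IsGraphRestrictive.{u, 0} (linearOrbitGroup p G K hK)) ∧
    IsGraphRestrictive.{u, 0} (inducedPermGroup (GL (Fin 2) (ZMod p)) (NonzeroVec p)) ∧
    IsGraphRestrictive.{u, 0} (inducedPermGroup SL(2, ZMod p) (NonzeroVec p)) ∧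
    IsGraphRestrictive.{u, 0}
      (inducedPermGroup PGL(Fin 2, ZMod p) (ℙ (ZMod p) (Fin 2 → ZMod p))) ∧
    IsGraphRestrictive.{u, 0}
      (inducedPermGroup PSL(2, ZMod p) (ℙ (ZMod p) (Fin 2 → ZMod p))) := by
  refine ⟨fun G K hG hKG hK =>
      ⟨?_, (isVectorModel_linearOrbitGroup hG hK).isRankOne.isGraphRestrictive⟩,
    isVectorModel_generalLinearGroup.isRankOne.isGraphRestrictive,
    isVectorModel_specialLinearGroup.isRankOne.isGraphRestrictive,
    isVectorModel_projGenLinGroup.isRankOne.isGraphRestrictive,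
    isVectorModel_projectiveSpecialLinearGroup.isRankOne.isGraphRestrictive⟩
  rw [← MonoidHom.comap_ker, ker_orbitPermHom]
  rfl
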